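/- **Corotating vortex pairs for the Euler equations.** Let $d>2$ and $\beta\in(0,1)$. For $g:\mathbb T\to\mathbb C$ on the unit circle use the normalized integral $\oint g\,d\tau=\frac1{2i\pi}\int_{\mathbb T}g(\tau)\,d\tau$, and write $f'=df/dw=-ie^{-i\eta}\,\frac{d}{d\eta}f(e^{i\eta})$. Let $$X=\Big\{f\in C^{1+\beta}(\mathbb T):\ f(w)=\sum_{n\ge1}a_nw^{-n},\ a_n\in\mathbb R\Big\},\qquad \widehat Y=\Big\{g\in C^\beta(\mathbb T):\ g=\sum_{n\ge2}a_ne_n,\ a_n\in\mathbb R\Big\},\quad e_n(w)=\operatorname{Im}(w^n)$$ (Fourier expansions), with the norms $\|f\|_{C^{1+\beta}}=\|f\|_\infty+\|f'\|_{C^\beta}$ and $\|g\|_{C^\beta}=\|g\|_\infty+\sup_{x\ne y}|g(x)-g(y)|/|x-y|^\beta$, and let $B_1$ be the open unit ball of $X$. With $A=\tau-w$, $B=f(\tau)-f(w)$ and $E=\varepsilon(\tau+w)+\varepsilon^2(f(\tau)+f(w))-2d$, define for $\varepsilon,\Omega\in\mathbb R$ $$\begin{aligned}F(\Omega,\varepsilon,f)(w)=\;&2\Omega\big(\varepsilon\overline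 w+\varepsilon^2f(\overline w)-d\big)w(1+\varepsilon f'(w))-f'(w)\\&+\Big(\oint \frac{\overline A+\varepsilon\overline B}{A+\varepsilon B}f'(\tau)\,d\tau+\oint \frac{A\overline B-\overline AB}{A(A+\varepsilon B)}\,d\tau\Big)w(1+\varepsilon f'(w))\\&-\Big(\oint \frac{(\overline\tau+\varepsilon f(\overline\tau))(1+\varepsilon f'(\tau))}{E}\,d\tau\Big)w(1+\varepsilon f'(w)),\end{aligned}$$ $$\Omega(\varepsilon,f)=\frac1{4d^2}\,\frac{1+\varepsilon T_1}{1-\varepsilon T_2},\qquad T_2=-\oint f\,dw+\frac{\varepsilon^2}{d}\oint f(\overline w)f'(w)(\overline w-w)\,dw,$$ $$T_1=\oint f\,dw+2d\oint g_2(w)(\overline w-w)(1+\varepsilon f'(w))\,dw+2d\oint \oint g_3(\tau,w)(1+\varepsilon f'(\tau))(w-\overline w)(1+\varepsilon f'(w))\,d\tau\,dw,$$ $$g_2(w)=\oint \frac{A\overline B-\overline AB}{A(A+\varepsilon B)}f'(\tau)\,d\tau+\oint \frac{(\overline AB-A\overline B)B}{A^2(A+\varepsilon B)}\,d\tau,\qquad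 g_3(\tau,w)=\frac{f(\overline\tau)}{E}+\frac{\overline\tau}{2d}\,\frac{\tau+w+\varepsilon(f(\tau)+f(w))}{E},$$ and $\widehat G(\varepsilon,f)=\operatorname{Im}F(\Omega(\varepsilon,f),\varepsilon,f)$. Then: 1. $\widehat G(\varepsilon,f)\in\widehat Y$ for $|\varepsilon|<\frac12$, $f\in B_1$; the map $f\mapsto\widehat G(0,f)\in\widehat Y$ is Fréchet differentiable at $f=0$ with $\partial_f\widehat G(0,0)h=-\operatorname{Im}h'$, and $\partial_f\widehat G(0,0):X\to\widehat Y$ is an isomorphism (linear homeomorphism). 2. There are $\varepsilon_0\in(0,\frac12)$ (depending on $d$ and $\beta$) and a $C^1$ curve $\varepsilon\in[-\varepsilon_0,\varepsilon_0]\mapsto f_\varepsilon\in X$ with $f_0=0$ such that $$\{(\varepsilon,f)\in[-\varepsilon_0,\varepsilon_0]\times B_1:\ \widehat G(\varepsilon,f)=0\}=\{(\varepsilon,f_\varepsilon):\ \varepsilon\in[-\varepsilon_0,\varepsilon_0]\},$$ and $f_\varepsilon\ne0$ for $\varepsilon\ne0$. 3. If $|\varepsilon|<\frac12$, $f\in B_1$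 and $\widehat G(\varepsilon,f)=0$, then $\tilde f(w)=f(-w)$ belongs to $B_1$ and $\widehat G(-\varepsilon,\tilde f)=0$. 4. With the same $\varepsilon_0$, for every $\varepsilon\in[-\varepsilon_0,\varepsilon_0]\setminus\{0\}$ the map $w\mapsto w+\varepsilon f_\varepsilon(w)$ is injective on $\mathbb T$; if $D_1$ is the region enclosed by this closed curve, then $D_1^\varepsilon=\varepsilon D_1$ is a nonempty open set with boundary $\{\varepsilon w+\varepsilon^2f_\varepsilon(w):w\in\mathbb T\}$ and is strictly convex (it is convex and its closure is strictly convex). -/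

import Mathlib

open Complex Set Filter Topology MeasureTheory
open scoped NNReal ComplexConjugate

noncomputable section

namespace VortexPair

/-! ### Calculus on the unit circle -/

/-- The normalized contour integral `(1 / 2πi) ∫_𝕋 g(τ) dτ`, with `τ = exp (iθ)` and
`dτ = i exp (iθ) dθ`. -/
def mean (g : Circle → ℂ) : ℂ :=
  (2 * Real.pi * I)⁻¹ * ∫ θ in (0 : ℝ)..2 * Real.pi, g (Circle.exp θ) * (I * (Circle.exp θ : ℂ))

/-- The derivative `f'(w) = df/dw = -i exp (-iη) g'(η)`, where `g(η) = f(exp (iη))` and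
`w = exp (iη)`. -/
def circleDeriv (f : Circle → ℂ) (w : Circle) : ℂ :=
  -I * (w : ℂ)⁻¹ * deriv (fun t : ℝ => f (w * Circle.exp t)) 0

/-- Differentiability along the circle at every point. -/
def CircleDifferentiable (f : Circle → ℂ) : Prop :=
  ∀ w : Circle, DifferentiableAt ℝ (fun t : ℝ => f (w * Circle.exp t)) 0

/-- The Fourier coefficient of `w ^ n`, `n ∈ ℤ`. -/
def fourierCoef (f : Circle → ℂ) (n : ℤ) : ℂ :=
  mean fun w => f w * (w : ℂ) ^ (-n - 1)

/-- The Fourier coefficient of `cos (nθ)` (for `n = 0`: twice the mean value). -/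
def cosCoef (g : Circle → ℝ) (n : ℕ) : ℝ :=
  Real.pi⁻¹ * ∫ θ in (0 : ℝ)..2 * Real.pi, g (Circle.exp θ) * ((Circle.exp θ : ℂ) ^ n).re

/-- The Fourier coefficient of `e_n = Im (w ^ n) = sin (nθ)`. -/
def sinCoef (g : Circle → ℝ) (n : ℕ) : ℝ :=
  Real.pi⁻¹ * ∫ θ in (0 : ℝ)..2 * Real.pi, g (Circle.exp θ) * ((Circle.exp θ : ℂ) ^ n).im

/-! ### Linearity of these operations (needed for the function spaces) -/

lemma mean_add {f g : Circle → ℂ} (hf : Continuous f) (hg : Continuous g) :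
    mean (fun w => f w + g w) = mean f + mean g := by
  have h1 : IntervalIntegrable (fun θ : ℝ => f (Circle.exp θ) * (I * (Circle.exp θ : ℂ)))
      volume 0 (2 * Real.pi) := by
    apply Continuous.intervalIntegrable
    fun_prop
  have h2 : IntervalIntegrable (fun θ : ℝ => g (Circle.exp θ) * (I * (Circle.exp θ : ℂ)))
      volume 0 (2 * Real.pi) := by
    apply Continuous.intervalIntegrable
    fun_prop
  simp only [mean, add_mul]
  rw [intervalIntegral.integral_add h1 h2, mul_add]

lemma mean_smul (c : ℝ) (f : Circle → ℂ) :
    mean (fun w => (c : ℂ) * f w) = c * mean f := by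
  simp only [mean, mul_assoc (c : ℂ)]
  rw [intervalIntegral.integral_const_mul]
  ring

lemma continuous_mul_zpow {f : Circle → ℂ} (hf : Continuous f) (n : ℤ) :
    Continuous (fun w : Circle => f w * (w : ℂ) ^ n) := by
  refine hf.mul (Continuous.zpow₀ (by fun_prop) n fun w => Or.inl (Circle.coe_ne_zero w))

lemma fourierCoef_add {f g : Circle → ℂ} (hf : Continuous f) (hg : Continuous g) (n : ℤ) :
    fourierCoef (f + g) n = fourierCoef f n + fourierCoef g n := by
  simp only [fourierCoef, Pi.add_apply, add_mul]
  exact mean_add (continuous_mul_zpow hf _) (continuous_mul_zpow hg _)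

lemma fourierCoef_smul (c : ℝ) (f : Circle → ℂ) (n : ℤ) :
    fourierCoef (c • f) n = c * fourierCoef f n := by
  simp only [fourierCoef, Pi.smul_apply, Complex.real_smul, mul_assoc (c : ℂ)]
  exact mean_smul c _

lemma cosCoef_add {f g : Circle → ℝ} (hf : Continuous f) (hg : Continuous g) (n : ℕ) :
    cosCoef (f + g) n = cosCoef f n + cosCoef g n := by
  have h (k : Circle → ℝ) (hk : Continuous k) :
      IntervalIntegrable (fun θ : ℝ => k (Circle.exp θ) * ((Circle.exp θ : ℂ) ^ n).re)
      volume 0 (2 * Real.pi) :=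
    Continuous.intervalIntegrable (by fun_prop) _ _
  simp only [cosCoef, Pi.add_apply, add_mul]
  rw [intervalIntegral.integral_add (h f hf) (h g hg), mul_add]

lemma sinCoef_add {f g : Circle → ℝ} (hf : Continuous f) (hg : Continuous g) (n : ℕ) :
    sinCoef (f + g) n = sinCoef f n + sinCoef g n := by
  have h (k : Circle → ℝ) (hk : Continuous k) :
      IntervalIntegrable (fun θ : ℝ => k (Circle.exp θ) * ((Circle.exp θ : ℂ) ^ n).im)
      volume 0 (2 * Real.pi) :=
    Continuous.intervalIntegrable (by fun_prop) _ _
  simp only [sinCoef, Pi.add_apply, add_mul]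
  rw [intervalIntegral.integral_add (h f hf) (h g hg), mul_add]

lemma cosCoef_smul (c : ℝ) (f : Circle → ℝ) (n : ℕ) :
    cosCoef (c • f) n = c * cosCoef f n := by
  simp only [cosCoef, Pi.smul_apply, smul_eq_mul, mul_assoc c]
  rw [intervalIntegral.integral_const_mul]
  ring

lemma sinCoef_smul (c : ℝ) (f : Circle → ℝ) (n : ℕ) :
    sinCoef (c • f) n = c * sinCoef f n := by
  simp only [sinCoef, Pi.smul_apply, smul_eq_mul, mul_assoc c]
  rw [intervalIntegral.integral_const_mul]
  ring

lemma circleDeriv_add {f g : Circle → ℂ} (hf : CircleDifferentiable f)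
    (hg : CircleDifferentiable g) : circleDeriv (f + g) = circleDeriv f + circleDeriv g := by
  funext w
  simp only [circleDeriv, Pi.add_apply]
  rw [deriv_fun_add (hf w) (hg w), mul_add]

lemma circleDeriv_smul {f : Circle → ℂ} (c : ℝ) (hf : CircleDifferentiable f) :
    circleDeriv (c • f) = c • circleDeriv f := by
  funext w
  simp only [circleDeriv, Pi.smul_apply]
  rw [deriv_fun_const_smul c (hf w), mul_smul_comm]

lemma circleDeriv_zero : circleDeriv (0 : Circle → ℂ) = 0 := by
  funext w
  simp [circleDeriv]

/-- A Hölder continuous function on the circle is bounded. -/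
lemma bddAbove_of_memHolder {β : ℝ≥0} {g : Circle → ℂ} (hg : MemHolder β g) :
    BddAbove (range fun w => ‖g w‖) := by
  obtain ⟨C, hC⟩ := hg
  refine ⟨‖g 1‖ + C * 2 ^ (β : ℝ), ?_⟩
  rintro _ ⟨w, rfl⟩
  have h2 : dist w 1 ≤ 2 := by
    have : dist w 1 = ‖(w : ℂ) - ((1 : Circle) : ℂ)‖ := by
      rw [← dist_eq_norm]; rfl
    rw [this]
    calc _ ≤ ‖(w : ℂ)‖ + ‖((1 : Circle) : ℂ)‖ := norm_sub_le _ _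
      _ = 2 := by rw [Circle.norm_coe, Circle.norm_coe]; norm_num
  have h3 : dist (g w) (g 1) ≤ C * 2 ^ (β : ℝ) := by
    refine (hC.dist_le w 1).trans ?_
    gcongr
  rw [dist_eq_norm] at h3
  have := norm_le_norm_add_norm_sub (g 1) (g w)
  rw [norm_sub_rev] at this
  change ‖g w‖ ≤ _
  linarith

/-! ### The space `X` -/

/-- `X = { f ∈ C^{1+β}(𝕋) : f(w) = ∑_{n ≥ 1} a_n w^{-n}, a_n ∈ ℝ }` as a real vector space; the
expansion is the Fourier expansion of `f`. -/
def XSubmodule (β : ℝ≥0) : Submodule ℝ C(Circle, ℂ) where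
  carrier := {f | CircleDifferentiable f ∧ MemHolder β (circleDeriv f) ∧
    (∀ n : ℕ, fourierCoef f n = 0) ∧ ∀ n : ℕ, (fourierCoef f (-(n : ℤ))).im = 0}
  add_mem' := by
    rintro f g ⟨hf1, hf2, hf3, hf4⟩ ⟨hg1, hg2, hg3, hg4⟩
    simp only [mem_ofPred_eq, ContinuousMap.coe_add]
    refine ⟨fun w => (hf1 w).add (hg1 w), ?_, fun n => ?_, fun n => ?_⟩
    · rw [circleDeriv_add hf1 hg1]
      exact hf2.add hg2
    · rw [fourierCoef_add f.continuous g.continuous, hf3, hg3, add_zero]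
    · rw [fourierCoef_add f.continuous g.continuous, Complex.add_im, hf4, hg4, add_zero]
  zero_mem' := by
    simp only [mem_ofPred_eq, ContinuousMap.coe_zero]
    refine ⟨fun w => ?_, ?_, fun n => ?_, fun n => ?_⟩
    · exact differentiableAt_const (0 : ℂ)
    · rw [circleDeriv_zero]
      exact memHolder_zero
    · simp [fourierCoef, mean]
    · simp [fourierCoef, mean]
  smul_mem' := by
    rintro c f ⟨hf1, hf2, hf3, hf4⟩
    simp only [mem_ofPred_eq, ContinuousMap.coe_smul]
    refine ⟨fun w => (hf1 w).const_smul c, ?_, fun n => ?_, fun n => ?_⟩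
    · rw [circleDeriv_smul c hf1]
      exact hf2.smul
    · rw [fourierCoef_smul, hf3, mul_zero]
    · rw [fourierCoef_smul, Complex.im_ofReal_mul, hf4, mul_zero]

/-- The space `X`. (It is a type of its own because its norm is not the one induced by the
uniform norm.) -/
def X (β : ℝ≥0) : Type := ↥(XSubmodule β)

namespace X

variable {β : ℝ≥0}

instance : AddCommGroup (X β) := inferInstanceAs (AddCommGroup ↥(XSubmodule β))

instance : Module ℝ (X β) := inferInstanceAs (Module ℝ ↥(XSubmodule β))

/-- The inclusion into the continuous functions on the circle. -/
def incl : X β →ₗ[ℝ] C(Circle, ℂ) := (XSubmodule β).subtype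

lemma incl_injective : Function.Injective (incl (β := β)) := Subtype.val_injective

lemma incl_mem (f : X β) : incl f ∈ XSubmodule β := f.2

instance : FunLike (X β) Circle ℂ where
  coe f := incl f
  coe_injective _ _ h := incl_injective (DFunLike.coe_injective h)

lemma coe_add (f g : X β) : ⇑(f + g) = ⇑f + ⇑g := rfl

lemma coe_smul (c : ℝ) (f : X β) : ⇑(c • f) = c • ⇑f := rfl

lemma coe_zero : ⇑(0 : X β) = 0 := rfl

lemma differentiable (f : X β) : CircleDifferentiable f := (incl_mem f).1

lemma memHolder_deriv (f : X β) : MemHolder β (circleDeriv f) := (incl_mem f).2.1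

/-- The norm of `C^{1+β}(𝕋)`: `‖f‖_∞ + ‖f'‖_∞ + sup_{x ≠ y} |f'(x) - f'(y)| / |x - y|^β`. -/
instance : Norm (X β) :=
  ⟨fun f => ‖incl f‖ + ((⨆ w, ‖circleDeriv f w‖) + (nnHolderNorm β (circleDeriv f) : ℝ))⟩

lemma norm_def (f : X β) :
    ‖f‖ = ‖incl f‖ + ((⨆ w, ‖circleDeriv f w‖) + (nnHolderNorm β (circleDeriv f) : ℝ)) := rfl

lemma normedSpaceCore : NormedSpace.Core ℝ (X β) where
  norm_nonneg f := by
    rw [norm_def]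
    have : 0 ≤ ⨆ w, ‖circleDeriv f w‖ := Real.iSup_nonneg fun w => norm_nonneg _
    positivity
  norm_smul c f := by
    rw [norm_def, norm_def, coe_smul, circleDeriv_smul c f.differentiable, f.memHolder_deriv.nnHolderNorm_smul]
    have h1 : ‖incl (c • f)‖ = ‖c‖ * ‖incl f‖ := norm_smul c (incl f)
    have h2 : (⨆ w, ‖(c • circleDeriv f) w‖) = ‖c‖ * ⨆ w, ‖circleDeriv f w‖ := by
      rw [Real.mul_iSup_of_nonneg (norm_nonneg c)]
      simp only [Pi.smul_apply, norm_smul]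
    rw [h1, h2]
    push_cast
    ring
  norm_triangle f g := by
    rw [norm_def, norm_def, norm_def, coe_add, circleDeriv_add f.differentiable g.differentiable]
    have h1 : ‖incl (f + g)‖ ≤ ‖incl f‖ + ‖incl g‖ := norm_add_le (incl f) (incl g)
    have h2 : (⨆ w, ‖(circleDeriv f + circleDeriv g) w‖) ≤
        (⨆ w, ‖circleDeriv f w‖) + ⨆ w, ‖circleDeriv g w‖ := by
      refine ciSup_le fun w => (norm_add_le _ _).trans (add_le_add ?_ ?_)
      · exact le_ciSup (bddAbove_of_memHolder f.memHolder_deriv) w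
      · exact le_ciSup (bddAbove_of_memHolder g.memHolder_deriv) w
    have h3 : (nnHolderNorm β (circleDeriv f + circleDeriv g) : ℝ) ≤
        nnHolderNorm β (circleDeriv f) + nnHolderNorm β (circleDeriv g) := by
      exact_mod_cast f.memHolder_deriv.nnHolderNorm_add_le g.memHolder_deriv
    linarith
  norm_eq_zero_iff f := by
    constructor
    · intro h
      rw [norm_def] at h
      have h0 : 0 ≤ ⨆ w, ‖circleDeriv f w‖ := Real.iSup_nonneg fun w => norm_nonneg _
      have h1 : ‖incl f‖ = 0 := by
        refine le_antisymm ?_ (norm_nonneg _)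
        have : (0 : ℝ) ≤ nnHolderNorm β (circleDeriv f) := NNReal.coe_nonneg _
        linarith
      exact incl_injective ((norm_eq_zero.1 h1).trans (map_zero incl).symm)
    · rintro rfl
      have h1 : circleDeriv (0 : X β) = 0 := circleDeriv_zero
      have h2 : ‖incl (0 : X β)‖ = 0 := norm_zero (E := C(Circle, ℂ))
      rw [norm_def, h1, h2]
      simp

instance : NormedAddCommGroup (X β) := NormedAddCommGroup.ofCore normedSpaceCore

instance : NormedSpace ℝ (X β) := NormedSpace.ofCore normedSpaceCore

end X

/-! ### The spaces `Y` and `Ŷ` -/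

/-- `Y = { g ∈ C^β(𝕋) : g = ∑_{n ≥ 1} a_n e_n, a_n ∈ ℝ }`, `e_n(w) = Im (w ^ n)`, as a real vector
space: the real-valued functions in `C^β(𝕋)` whose Fourier series is a sine series. -/
def YSubmodule (β : ℝ≥0) : Submodule ℝ C(Circle, ℝ) where
  carrier := {g | MemHolder β g ∧ ∀ n : ℕ, cosCoef g n = 0}
  add_mem' := by
    rintro f g ⟨hf1, hf2⟩ ⟨hg1, hg2⟩
    refine ⟨hf1.add hg1, fun n => ?_⟩
    rw [ContinuousMap.coe_add, cosCoef_add f.continuous g.continuous, hf2, hg2, add_zero]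
  zero_mem' := ⟨memHolder_zero, fun n => by simp [cosCoef]⟩
  smul_mem' := by
    rintro c f ⟨hf1, hf2⟩
    refine ⟨hf1.smul, fun n => ?_⟩
    rw [ContinuousMap.coe_smul, cosCoef_smul, hf2, mul_zero]

/-- `Ŷ = { g ∈ Y : a_1 = 0 }` as a real vector space. -/
def YhatSubmodule (β : ℝ≥0) : Submodule ℝ C(Circle, ℝ) where
  carrier := {g | g ∈ YSubmodule β ∧ sinCoef g 1 = 0}
  add_mem' := by
    rintro f g ⟨hf1, hf2⟩ ⟨hg1, hg2⟩
    refine ⟨add_mem hf1 hg1, ?_⟩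
    rw [ContinuousMap.coe_add, sinCoef_add f.continuous g.continuous, hf2, hg2, add_zero]
  zero_mem' := ⟨zero_mem _, by simp [sinCoef]⟩
  smul_mem' := by
    rintro c f ⟨hf1, hf2⟩
    refine ⟨Submodule.smul_mem _ c hf1, ?_⟩
    rw [ContinuousMap.coe_smul, sinCoef_smul, hf2, mul_zero]

/-- The space `Ŷ`. -/
def Yhat (β : ℝ≥0) : Type := ↥(YhatSubmodule β)

namespace Yhat

variable {β : ℝ≥0}

instance : AddCommGroup (Yhat β) := inferInstanceAs (AddCommGroup ↥(YhatSubmodule β))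

instance : Module ℝ (Yhat β) := inferInstanceAs (Module ℝ ↥(YhatSubmodule β))

/-- The inclusion into the continuous functions on the circle. -/
def incl : Yhat β →ₗ[ℝ] C(Circle, ℝ) := (YhatSubmodule β).subtype

lemma incl_injective : Function.Injective (incl (β := β)) := Subtype.val_injective

lemma incl_mem (f : Yhat β) : incl f ∈ YhatSubmodule β := f.2

instance : FunLike (Yhat β) Circle ℝ where
  coe f := incl f
  coe_injective _ _ h := incl_injective (DFunLike.coe_injective h)

lemma coe_add (f g : Yhat β) : ⇑(f + g) = ⇑f + ⇑g := rfl

lemma coe_smul (c : ℝ) (f : Yhat β) : ⇑(c • f) = c • ⇑f := rfl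

lemma coe_zero : ⇑(0 : Yhat β) = 0 := rfl

lemma memHolder (g : Yhat β) : MemHolder β g := (incl_mem g).1.1

/-- The norm of `C^β(𝕋)`: `‖g‖_∞ + sup_{x ≠ y} |g(x) - g(y)| / |x - y|^β`. -/
instance : Norm (Yhat β) := ⟨fun g => ‖incl g‖ + (nnHolderNorm β g : ℝ)⟩

lemma norm_def (g : Yhat β) : ‖g‖ = ‖incl g‖ + (nnHolderNorm β g : ℝ) := rfl

lemma normedSpaceCore : NormedSpace.Core ℝ (Yhat β) where
  norm_nonneg g := by
    rw [norm_def]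
    positivity
  norm_smul c g := by
    have h1 : ‖incl (c • g)‖ = ‖c‖ * ‖incl g‖ := norm_smul c (incl g)
    rw [norm_def, norm_def, coe_smul, g.memHolder.nnHolderNorm_smul, h1]
    push_cast
    ring
  norm_triangle f g := by
    rw [norm_def, norm_def, norm_def, coe_add]
    have h1 : ‖incl (f + g)‖ ≤ ‖incl f‖ + ‖incl g‖ := norm_add_le (incl f) (incl g)
    have h3 : (nnHolderNorm β (⇑f + ⇑g) : ℝ) ≤ nnHolderNorm β f + nnHolderNorm β g := by
      exact_mod_cast f.memHolder.nnHolderNorm_add_le g.memHolder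
    linarith
  norm_eq_zero_iff g := by
    constructor
    · intro h
      rw [norm_def] at h
      have h1 : ‖incl g‖ = 0 := by
        refine le_antisymm ?_ (norm_nonneg _)
        have : (0 : ℝ) ≤ nnHolderNorm β g := NNReal.coe_nonneg _
        linarith
      exact incl_injective ((norm_eq_zero.1 h1).trans (map_zero incl).symm)
    · rintro rfl
      have h1 : ⇑(0 : Yhat β) = 0 := rfl
      have h2 : ‖incl (0 : Yhat β)‖ = 0 := norm_zero (E := C(Circle, ℝ))
      rw [norm_def, h1, h2]
      simp

instance : NormedAddCommGroup (Yhat β) := NormedAddCommGroup.ofCore normedSpaceCore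

instance : NormedSpace ℝ (Yhat β) := NormedSpace.ofCore normedSpaceCore

end Yhat

/-! ### The nonlinear functional

Throughout `A = τ - w` and `B = f(τ) - f(w)`, and `f(w̄)` is `f w⁻¹`. All formulas are regular at
`ε = 0`. -/

/-- `F₁ = 2Ω (ε w̄ + ε² f(w̄) - d) w (1 + ε f'(w)) - f'(w)`. -/
def F₁ (d ε Ω : ℝ) (f : Circle → ℂ) (w : Circle) : ℂ :=
  2 * Ω * (ε * (w⁻¹ : Circle) + ε ^ 2 * f w⁻¹ - d) * w * (1 + ε * circleDeriv f w)
    - circleDeriv f w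

/-- `F₂ = (⨍ (Ā + ε B̄)/(A + ε B) f'(τ) dτ + ⨍ (A B̄ - Ā B)/(A (A + ε B)) dτ) w (1 + ε f'(w))`. -/
def F₂ (ε : ℝ) (f : Circle → ℂ) (w : Circle) : ℂ :=
  ((mean fun τ =>
      (conj ((τ : ℂ) - w) + ε * conj (f τ - f w)) / ((τ : ℂ) - w + ε * (f τ - f w))
        * circleDeriv f τ) +
    mean fun τ =>
      (((τ : ℂ) - w) * conj (f τ - f w) - conj ((τ : ℂ) - w) * (f τ - f w)) /
        (((τ : ℂ) - w) * ((τ : ℂ) - w + ε * (f τ - f w)))) *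
    w * (1 + ε * circleDeriv f w)

/-- `F₃ = -(⨍ (τ̄ + ε f(τ̄)) (1 + ε f'(τ)) / (ε (τ + w) + ε² (f(τ) + f(w)) - 2d) dτ)
  w (1 + ε f'(w))`. -/
def F₃ (d ε : ℝ) (f : Circle → ℂ) (w : Circle) : ℂ :=
  -(mean fun τ =>
      ((τ⁻¹ : Circle) + ε * f τ⁻¹) * (1 + ε * circleDeriv f τ) /
        (ε * ((τ : ℂ) + w) + ε ^ 2 * (f τ + f w) - 2 * d)) *
    w * (1 + ε * circleDeriv f w)

/-- `F = F₁ + F₂ + F₃`. -/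
def F (d Ω ε : ℝ) (f : Circle → ℂ) (w : Circle) : ℂ :=
  F₁ d ε Ω f w + F₂ ε f w + F₃ d ε f w

/-- `g₂ = ⨍ (A B̄ - Ā B)/(A (A + ε B)) f'(τ) dτ + ⨍ (Ā B - A B̄) B/(A² (A + ε B)) dτ`. -/
def g₂ (ε : ℝ) (f : Circle → ℂ) (w : Circle) : ℂ :=
  (mean fun τ =>
    (((τ : ℂ) - w) * conj (f τ - f w) - conj ((τ : ℂ) - w) * (f τ - f w)) /
      (((τ : ℂ) - w) * ((τ : ℂ) - w + ε * (f τ - f w))) * circleDeriv f τ) +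
  mean fun τ =>
    (conj ((τ : ℂ) - w) * (f τ - f w) - ((τ : ℂ) - w) * conj (f τ - f w)) * (f τ - f w) /
      (((τ : ℂ) - w) ^ 2 * ((τ : ℂ) - w + ε * (f τ - f w)))

/-- `g₃ = (f(τ̄) + τ̄ (τ + w + ε (f(τ) + f(w))) / (2d)) / (ε (τ + w) + ε² (f(τ) + f(w)) - 2d)`. -/
def g₃ (d ε : ℝ) (f : Circle → ℂ) (τ w : Circle) : ℂ :=
  f τ⁻¹ / (ε * ((τ : ℂ) + w) + ε ^ 2 * (f τ + f w) - 2 * d) +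
    1 / (2 * d) * ((τ : ℂ) + w + ε * (f τ + f w)) /
      (ε * ((τ : ℂ) + w) + ε ^ 2 * (f τ + f w) - 2 * d) * (τ⁻¹ : Circle)

/-- `T₁ = ⨍ f dτ + 2d ⨍ g₂ (w̄ - w) (1 + ε f'(w)) dw
  + 2d ⨍ ⨍ g₃ (1 + ε f'(τ)) (w - w̄) (1 + ε f'(w)) dτ dw`. -/
def T₁ (d ε : ℝ) (f : Circle → ℂ) : ℂ :=
  mean f +
    2 * d * (mean fun w => g₂ ε f w * ((w⁻¹ : Circle) - (w : ℂ)) * (1 + ε * circleDeriv f w)) +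
    2 * d * mean fun w => mean fun τ =>
      g₃ d ε f τ w * (1 + ε * circleDeriv f τ) * ((w : ℂ) - (w⁻¹ : Circle)) *
        (1 + ε * circleDeriv f w)

/-- `T₂ = -⨍ f dw + (ε² / d) ⨍ f(w̄) f'(w) (w̄ - w) dw`. -/
def T₂ (d ε : ℝ) (f : Circle → ℂ) : ℂ :=
  -mean f +
    ε ^ 2 / d * mean fun w => f w⁻¹ * circleDeriv f w * ((w⁻¹ : Circle) - (w : ℂ))

/-- The angular velocity `Ω(ε, f) = (1 / 4d²) (1 + ε T₁) / (1 - ε T₂)`; `T₁` and `T₂` are real for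
`f` with real Fourier coefficients. -/
def angularVelocity (d ε : ℝ) (f : Circle → ℂ) : ℝ :=
  1 / (4 * d ^ 2) * ((1 + ε * (T₁ d ε f).re) / (1 - ε * (T₂ d ε f).re))

/-- The reduced functional `Ĝ(ε, f) = Im F(Ω(ε, f), ε, f)`. -/
def Ghat (d ε : ℝ) (f : Circle → ℂ) (w : Circle) : ℝ :=
  (F d (angularVelocity d ε f) ε f w).im

open Classical in
/-- `Ĝ(ε, f)` as an element of `Ŷ` (and `0` should `Ĝ(ε, f)` not belong to `Ŷ`). -/
def GhatMap (d : ℝ) (β : ℝ≥0) (ε : ℝ) (f : X β) : Yhat β :=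
  if h : ∃ g : Yhat β, ∀ w, g w = Ghat d ε f w then h.choose else 0

/-! ### The vortex patch -/

/-- The parametrization `φ(w) = w + ε f(w)` of the boundary of `D₁`. -/
def boundaryCurve (ε : ℝ) (f : Circle → ℂ) (w : Circle) : ℂ :=
  w + ε * f w

/-- The region enclosed by a closed curve `Γ`: the points off `Γ` whose connected component in the
complement of `Γ` is bounded. -/
def enclosedRegion (Γ : Set ℂ) : Set ℂ :=
  {z | z ∈ Γᶜ ∧ Bornology.IsBounded (connectedComponentIn Γᶜ z)}

/-- The patch `D₁^ε = ε D₁`, where `D₁` is the region enclosed by the curve `φ(𝕋)`. -/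
def patch (ε : ℝ) (f : Circle → ℂ) : Set ℂ :=
  (fun z : ℂ => ε * z) '' enclosedRegion (range (boundaryCurve ε f))

/-- A strictly convex domain: nonempty, open, convex, and its closure is strictly convex (there are
no segments in its boundary). -/
def IsStrictlyConvexDomain (D : Set ℂ) : Prop :=
  D.Nonempty ∧ IsOpen D ∧ Convex ℝ D ∧ StrictConvex ℝ (closure D)

end VortexPair

end

/-! The mechanism is desingularization at `ε = 0` followed by the implicit function theorem. Write
`D = B / A` and use that `Ā / A = -τ̄ w̄` on the circle. The parts of the integrals in `F₂` that
carry no factor `ε` vanish by Fourier arguments: `f'` has only frequencies at most `-2`, and `D` has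
angular mean zero (`cint_divDiff`). The part of `F₃` free of `ε` is a constant multiple of `w (1 + ε
f')` (`F₂_eq`, `F₃_eq`). With the prescribed `Ω` the remaining constant `1/(2d) - 2Ωd` is also
divisible by `ε` (`mul_kC`). Hence `F = -f' + ε W w (1 + ε f')` with a regular velocity `W`
(`F_eq`). The same `Ω` is the solution of the linear equation that removes the first sine
coefficient (`re_meanW_kGhat`), and `F(w̄)` is the conjugate of `F(w)`, so `Ĝ` takes values in `Ŷ`
and `Ĝ(0, f) = -Im f'`.

Smoothness comes from an algebra of kernels. `Ker α` consists of the continuous `K(τ, w)` whose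
slices in `τ` depend `α`-Hölder continuously on `w` in `L^1`. It is a Banach algebra in which
kernels without zeros are invertible. Second divided differences of `f` are bounded by an integrable
singular weight, so `f ↦ D` is a bounded linear map into `Ker α` for every `α ≤ 1`
(`cint_divDiff_sub_le`). All of `F` is then assembled from bounded linear maps, products, inverses
and one scalar quotient, and `C^1` dependence is automatic.

The linearization `h ↦ -Im h'` is injective because a real function without frequencies above `-2`
is zero. It is onto because a sine series `g` without its first mode has a completion with negative
frequencies, a singular integral that is Hölder by Privalov's theorem (`norm_rotDiff_one_sub_le`),
and this completion has a primitive in `X` (`exists_linOp_eq`). The implicit function theorem yields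
the curve and uniqueness near `(0, 0)`. Uniqueness in all of `B_1` follows from the bound `‖f‖ ≤ C
|ε|` for every solution in `B_1` (`exists_bound_of_Ghat_eq_zero`). The function `f = 0` is excluded
for `ε ≠ 0` by explicit computation, and the reflection symmetry is a change of variables.

Strict convexity cannot be read off from `f ∈ C^{1+β}`, which has no curvature. But at a solution
`(1 - ε² W w)(1 + ε f') = 1 - ε F` is real and positive, so `w - ε² W̄` is an outward normal of the
curve. Since `W` does not contain `f'(w)`, it lies in `Ker 1`, and the normal is Lipschitz close to
that of the circle (`exists_nearCircle`). This suffices for the curve to lie strictly on one side of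
each tangent and for the enclosed region to be the intersection of the open tangent half planes
(`NearCircle.supportFun_curve_neg`, `NearCircle.enclosedRegion_eq`). -/

noncomputable section

namespace VortexPair

/-! ### Integration over the circle -/

section Integration

variable {E : Type*} [NormedAddCommGroup E] [NormedSpace ℝ E]

/-- The integral of a function on the circle with respect to the angle. -/
def cint (g : Circle → E) : E := ∫ θ in (0 : ℝ)..2 * Real.pi, g (Circle.exp θ)

lemma mean_eq_cint (g : Circle → ℂ) :
    mean g = (2 * Real.pi : ℂ)⁻¹ * cint (fun w => (w : ℂ) * g w) := by
  have h : (fun θ : ℝ => g (Circle.exp θ) * (I * (Circle.exp θ : ℂ))) =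
      fun θ : ℝ => I * ((Circle.exp θ : ℂ) * g (Circle.exp θ)) := by
    funext θ; ring
  rw [mean, cint, h, intervalIntegral.integral_const_mul, ← mul_assoc]
  congr 1
  have : (Real.pi : ℂ) ≠ 0 := by exact_mod_cast Real.pi_ne_zero
  field_simp

lemma cint_eq_shift (g : Circle → E) (a : ℝ) :
    cint g = ∫ θ in a..a + 2 * Real.pi, g (Circle.exp θ) := by
  have hp : Function.Periodic (fun θ => g (Circle.exp θ)) (2 * Real.pi) := fun θ => by
    simp only [Circle.exp_add_two_pi]
  rw [cint, hp.intervalIntegral_add_eq a 0, zero_add]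

lemma cint_eq_symm (g : Circle → E) :
    cint g = ∫ θ in (-Real.pi)..Real.pi, g (Circle.exp θ) := by
  rw [cint_eq_shift g (-Real.pi)]
  congr 1
  ring

lemma cint_mul_left (g : Circle → E) (σ : Circle) : cint (fun τ => g (σ * τ)) = cint g := by
  obtain ⟨a, rfl⟩ := Circle.exp_surjective σ
  simp only [cint, ← Circle.exp_add]
  rw [intervalIntegral.integral_comp_add_left (fun θ => g (Circle.exp θ)) a, ← cint,
    cint_eq_shift g a, add_zero]

lemma cint_mul_right (g : Circle → E) (σ : Circle) : cint (fun τ => g (τ * σ)) = cint g := by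
  simp only [mul_comm _ σ]
  exact cint_mul_left g σ

lemma cint_inv (g : Circle → E) : cint (fun τ => g τ⁻¹) = cint g := by
  simp only [cint, ← Circle.exp_neg]
  rw [intervalIntegral.integral_comp_neg (fun θ => g (Circle.exp θ)), ← cint,
    cint_eq_shift g (-(2 * Real.pi))]
  simp

lemma cint_neg_arg (g : Circle → E) : cint (fun τ => g (-τ)) = cint g := by
  have h := cint_mul_left g (-1)
  simpa using h

lemma countable_exp_preimage (w : Circle) : {θ : ℝ | Circle.exp θ = w}.Countable := by
  obtain ⟨a, rfl⟩ := Circle.exp_surjective w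
  refine (countable_range fun m : ℤ => a + m * (2 * Real.pi)).mono ?_
  rintro θ hθ
  obtain ⟨m, hm⟩ := Circle.exp_eq_exp.1 hθ
  exact ⟨m, hm.symm⟩

lemma ae_exp_ne (w : Circle) : ∀ᵐ θ : ℝ, Circle.exp θ ≠ w :=
  (countable_exp_preimage w).ae_notMem volume

/-- A point of the circle is hit by countably many angles, a null set. Integrands with `τ - w` in
the denominator have a meaningless value on the diagonal, and this permits trading them for kernels
that are continuous there. -/
lemma cint_congr_ne {g h : Circle → E} (w : Circle) (H : ∀ τ, τ ≠ w → g τ = h τ) :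
    cint g = cint h := by
  refine intervalIntegral.integral_congr_ae ?_
  filter_upwards [ae_exp_ne w] with θ hθ _
  exact H _ hθ

lemma mean_congr_ne {g h : Circle → ℂ} (w : Circle) (H : ∀ τ, τ ≠ w → g τ = h τ) :
    mean g = mean h := by
  rw [mean_eq_cint, mean_eq_cint, cint_congr_ne w]
  intro τ hτ
  rw [H τ hτ]

lemma intervalIntegrable_circle {F : Type*} [NormedAddCommGroup F] {g : Circle → F} (hg : Continuous g) (a b : ℝ) :
    IntervalIntegrable (fun θ => g (Circle.exp θ)) volume a b :=
  (hg.comp Circle.exp.continuous).intervalIntegrable a b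

lemma cint_add {g h : Circle → E} (hg : Continuous g) (hh : Continuous h) :
    cint (fun w => g w + h w) = cint g + cint h :=
  intervalIntegral.integral_add (intervalIntegrable_circle hg _ _)
    (intervalIntegrable_circle hh _ _)

lemma cint_sub {g h : Circle → E} (hg : Continuous g) (hh : Continuous h) :
    cint (fun w => g w - h w) = cint g - cint h :=
  intervalIntegral.integral_sub (intervalIntegrable_circle hg _ _)
    (intervalIntegrable_circle hh _ _)

lemma cint_const_mul (c : ℂ) (g : Circle → ℂ) : cint (fun w => c * g w) = c * cint g :=
  intervalIntegral.integral_const_mul _ _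

lemma cint_const_mul_real (c : ℝ) (g : Circle → ℝ) : cint (fun w => c * g w) = c * cint g :=
  intervalIntegral.integral_const_mul _ _

lemma cint_const [CompleteSpace E] (c : E) : cint (fun _ => c) = (2 * Real.pi) • c := by
  simp [cint]

lemma norm_cint_le_of_le {g : Circle → E} {C : ℝ} (h : ∀ w, ‖g w‖ ≤ C) :
    ‖cint g‖ ≤ 2 * Real.pi * C := by
  have := intervalIntegral.norm_integral_le_of_norm_le_const
    (a := 0) (b := 2 * Real.pi) (f := fun θ => g (Circle.exp θ)) (C := C) (fun θ _ => h _)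
  rw [sub_zero, abs_of_pos Real.two_pi_pos, mul_comm C] at this
  exact this

lemma cint_conj (g : Circle → ℂ) : cint (fun w => conj (g w)) = conj (cint g) := by
  simp only [cint, intervalIntegral.integral_of_le Real.two_pi_pos.le]
  exact integral_conj

lemma cint_re {g : Circle → ℂ} (hg : Continuous g) : (cint g).re = cint (fun w => (g w).re) := by
  have := ContinuousLinearMap.intervalIntegral_comp_comm reCLM
    (intervalIntegrable_circle hg 0 (2 * Real.pi))
  exact this.symm

lemma cint_im {g : Circle → ℂ} (hg : Continuous g) : (cint g).im = cint (fun w => (g w).im) := by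
  have := ContinuousLinearMap.intervalIntegral_comp_comm imCLM
    (intervalIntegrable_circle hg 0 (2 * Real.pi))
  exact this.symm

lemma norm_mean_le_of_le {g : Circle → ℂ} {C : ℝ} (h : ∀ w, ‖g w‖ ≤ C) : ‖mean g‖ ≤ C := by
  have h1 : ‖cint (fun w : Circle => (w : ℂ) * g w)‖ ≤ 2 * Real.pi * C :=
    norm_cint_le_of_le fun w => by rw [norm_mul, Circle.norm_coe, one_mul]; exact h w
  have h2 : ‖(2 * Real.pi : ℂ)⁻¹‖ = (2 * Real.pi)⁻¹ := by
    rw [norm_inv, norm_mul, Complex.norm_real, Real.norm_of_nonneg Real.pi_pos.le]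
    simp
  rw [mean_eq_cint, norm_mul, h2, inv_mul_le_iff₀ Real.two_pi_pos]
  exact h1

lemma mean_const_mul (c : ℂ) (g : Circle → ℂ) : mean (fun w => c * g w) = c * mean g := by
  have h : (fun w : Circle => (w : ℂ) * (c * g w)) = fun w : Circle => c * ((w : ℂ) * g w) := by
    funext w; ring
  rw [mean_eq_cint, mean_eq_cint, h, cint_const_mul]
  ring

lemma mean_mul_const (c : ℂ) (g : Circle → ℂ) : mean (fun w => g w * c) = mean g * c := by
  rw [mul_comm, ← mean_const_mul]
  congr 1
  funext w; ring

lemma mean_neg (g : Circle → ℂ) : mean (fun w => -g w) = -mean g := by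
  have := mean_const_mul (-1) g
  simpa using this

lemma mean_sub {f g : Circle → ℂ} (hf : Continuous f) (hg : Continuous g) :
    mean (fun w => f w - g w) = mean f - mean g := by
  simp only [sub_eq_add_neg]
  rw [← mean_neg]
  exact mean_add hf hg.neg

/-- The angle measure is invariant under `τ ↦ -τ`, but the factor `τ` in `dτ = iτ dθ` changes sign.
-/
lemma mean_neg_arg (g : Circle → ℂ) : mean (fun τ => g (-τ)) = -mean g := by
  rw [mean_eq_cint, mean_eq_cint, ← cint_neg_arg (fun w : Circle => (w : ℂ) * g w), ← mul_neg]
  congr 1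
  have := cint_const_mul (-1) (fun w : Circle => ((-w : Circle) : ℂ) * g (-w))
  rw [neg_one_mul] at this
  rw [← this]
  congr 1
  funext w
  simp

lemma continuous_cint_param {Z : Type*} [TopologicalSpace Z] {F : Z → Circle → ℂ}
    (hF : Continuous (Function.uncurry F)) : Continuous fun z => cint (F z) := by
  refine intervalIntegral.continuous_parametric_intervalIntegral_of_continuous' ?_ _ _
  fun_prop

lemma continuous_mean_param {Z : Type*} [TopologicalSpace Z] {F : Z → Circle → ℂ}
    (hF : Continuous (Function.uncurry F)) : Continuous fun z => mean (F z) := by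
  simp only [mean_eq_cint]
  refine continuous_const.mul (continuous_cint_param ?_)
  simp only [Function.uncurry_def] at hF ⊢
  fun_prop

end Integration

/-! ### Distances and derivatives on the circle -/

section Calculus

lemma dist_eq_norm_coe (p q : Circle) : dist p q = ‖(p : ℂ) - q‖ := by
  rw [← dist_eq_norm]; rfl

lemma dist_mul_left_circle (σ p q : Circle) : dist (σ * p) (σ * q) = dist p q := by
  rw [dist_eq_norm_coe, dist_eq_norm_coe, Circle.coe_mul, Circle.coe_mul, ← mul_sub, norm_mul,
    Circle.norm_coe, one_mul]

lemma dist_inv_circle (p q : Circle) : dist p⁻¹ q⁻¹ = dist p q := by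
  rw [dist_eq_norm_coe, dist_eq_norm_coe, Circle.coe_inv_eq_conj, Circle.coe_inv_eq_conj,
    ← map_sub, RCLike.norm_conj]

lemma dist_le_two (p q : Circle) : dist p q ≤ 2 := by
  rw [dist_eq_norm_coe]
  refine (norm_sub_le _ _).trans ?_
  rw [Circle.norm_coe, Circle.norm_coe]
  norm_num

lemma coe_sub_ne_zero {p q : Circle} (h : p ≠ q) : (p : ℂ) - q ≠ 0 :=
  sub_ne_zero.2 fun h' => h (Circle.ext h')

lemma dist_exp_one (s : ℝ) : dist (Circle.exp s) 1 = 2 * |Real.sin (s / 2)| := by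
  rw [dist_eq_norm_coe, Circle.coe_one, Circle.coe_exp, mul_comm]
  have := Complex.norm_exp_I_mul_ofReal_sub_one s
  rw [this, norm_mul, Real.norm_eq_abs, Real.norm_eq_abs, abs_of_pos (by norm_num : (0:ℝ) < 2)]

/-- Jordan's inequality for the sine of half the angle: arc and chord are comparable up to the
factor `π / 2`. -/
lemma abs_le_dist_exp {s : ℝ} (hs : |s| ≤ Real.pi) :
    |s| ≤ Real.pi / 2 * dist (Circle.exp s) 1 := by
  rw [dist_exp_one]
  have h := Real.mul_abs_le_abs_sin (x := s / 2) (by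
    rw [abs_div, abs_of_pos (by norm_num : (0:ℝ) < 2)]; linarith)
  rw [abs_div, abs_of_pos (by norm_num : (0:ℝ) < 2)] at h
  have hp := Real.pi_pos
  have h2 : Real.pi / 2 * (2 * (2 / Real.pi * (|s| / 2))) ≤
      Real.pi / 2 * (2 * |Real.sin (s / 2)|) := by gcongr
  have h3 : Real.pi / 2 * (2 * (2 / Real.pi * (|s| / 2))) = |s| := by field_simp
  linarith

lemma dist_exp_le (s : ℝ) : dist (Circle.exp s) 1 ≤ |s| := by
  rw [dist_exp_one]
  have := Real.abs_sin_le_abs (x := s / 2)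
  rw [abs_div, abs_of_pos (by norm_num : (0:ℝ) < 2)] at this
  linarith

lemma dist_exp_mul_le {s t : ℝ} (hs : |s| ≤ Real.pi) (ht : |t| ≤ |s|) :
    dist (Circle.exp t) 1 ≤ dist (Circle.exp s) 1 := by
  rw [dist_exp_one, dist_exp_one]
  gcongr 2 * ?_
  have h1 : |t / 2| ≤ |s / 2| := by
    rw [abs_div, abs_div]
    gcongr
  have h2 : |s / 2| ≤ Real.pi / 2 := by
    rw [abs_div, abs_of_pos (by norm_num : (0:ℝ) < 2)]; linarith
  rw [Real.abs_sin_eq_sin_abs_of_abs_le_pi (by linarith [Real.pi_pos]),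
    Real.abs_sin_eq_sin_abs_of_abs_le_pi (by linarith [Real.pi_pos])]
  exact Real.sin_le_sin_of_le_of_le_pi_div_two (by linarith [Real.pi_pos, abs_nonneg (t / 2)]) h2 h1

/-- The point `p` is reached from `q` along an arc whose length is comparable to the distance. -/
lemma exists_arc (p q : Circle) : ∃ s : ℝ, |s| ≤ Real.pi ∧ p = q * Circle.exp s ∧
    |s| ≤ Real.pi / 2 * dist p q ∧ ∀ t : ℝ, |t| ≤ |s| → dist (q * Circle.exp t) q ≤ dist p q := by
  obtain ⟨s, hs, hs'⟩ : ∃ s : ℝ, |s| ≤ Real.pi ∧ Circle.exp s = p / q :=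
    ⟨arg ((p / q : Circle) : ℂ), abs_arg_le_pi _, Circle.exp_arg _⟩
  have hp : p = q * Circle.exp s := by rw [hs']; simp
  have hd : ∀ t, dist (q * Circle.exp t) q = dist (Circle.exp t) 1 := fun t => by
    conv_lhs => rw [← mul_one q, mul_assoc, one_mul, dist_mul_left_circle]
  refine ⟨s, hs, hp, ?_, fun t ht => ?_⟩
  · rw [hp, hd]; exact abs_le_dist_exp hs
  · rw [hp, hd, hd]; exact dist_exp_mul_le hs ht

variable {f : Circle → ℂ}

/-- Differentiability is assumed at parameter `0` only, but for every base point; rotating the base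
point by `s` moves the derivative to any parameter. -/
lemma CircleDifferentiable.hasDerivAt (hf : CircleDifferentiable f) (q : Circle) (s : ℝ) :
    HasDerivAt (fun t : ℝ => f (q * Circle.exp t))
      (I * (q * Circle.exp s : Circle) * circleDeriv f (q * Circle.exp s)) s := by
  have h := (hf (q * Circle.exp s)).hasDerivAt
  have h1 : HasDerivAt (fun t : ℝ => f (q * Circle.exp s * Circle.exp (t - s)))
      (deriv (fun t : ℝ => f (q * Circle.exp s * Circle.exp t)) 0) s := by
    have := HasDerivAt.comp_sub_const s s (f := fun t : ℝ => f (q * Circle.exp s * Circle.exp t))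
      (by rw [sub_self]; exact h)
    exact this
  convert h1 using 1
  · funext t
    rw [mul_assoc, ← Circle.exp_add]
    simp
  · rw [circleDeriv]
    have := Circle.coe_ne_zero (q * Circle.exp s)
    have h2 : I * ((q * Circle.exp s : Circle) : ℂ) * (-I * ((q * Circle.exp s : Circle) : ℂ)⁻¹ *
        deriv (fun t : ℝ => f (q * Circle.exp s * Circle.exp t)) 0) =
        -(I * I) * (((q * Circle.exp s : Circle) : ℂ) * ((q * Circle.exp s : Circle) : ℂ)⁻¹) *
        deriv (fun t : ℝ => f (q * Circle.exp s * Circle.exp t)) 0 := by ring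
    rw [h2, mul_inv_cancel₀ this, I_mul_I]
    simp

lemma hasDerivAt_coe_exp (q : Circle) (s : ℝ) :
    HasDerivAt (fun t : ℝ => ((q * Circle.exp t : Circle) : ℂ))
      (I * (q * Circle.exp s : Circle)) s := by
  have h : HasDerivAt (fun t : ℝ => Complex.exp (t * I)) (Complex.exp (s * I) * (1 * I)) s :=
    ((hasDerivAt_id s).ofReal_comp.mul_const I).cexp
  have h2 := h.const_mul (q : ℂ)
  have h3 : I * ((q * Circle.exp s : Circle) : ℂ) = q * (Complex.exp (s * I) * (1 * I)) := by
    rw [Circle.coe_mul, Circle.coe_exp]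
    ring
  rw [h3]
  exact h2

lemma circleDeriv_eq_of_hasDerivAt {w : Circle} {c : ℂ}
    (h : HasDerivAt (fun t : ℝ => f (w * Circle.exp t)) (I * w * c) 0) : circleDeriv f w = c := by
  rw [circleDeriv, h.deriv]
  have := Circle.coe_ne_zero w
  field_simp
  rw [I_sq]; ring

/-- The mean value inequality on the shorter of the arcs between two points. -/
lemma norm_sub_sub_le (hf : CircleDifferentiable f) {p q : Circle} {c : ℂ} {M : ℝ}
    (hM : ∀ ξ, dist ξ q ≤ dist p q → ‖circleDeriv f ξ - c‖ ≤ M) :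
    ‖f p - f q - c * ((p : ℂ) - q)‖ ≤ M * (Real.pi / 2) * dist p q := by
  obtain ⟨s, -, hp, hs, ht⟩ := exists_arc p q
  have hM0 : 0 ≤ M := (norm_nonneg _).trans (hM p le_rfl)
  -- Subtracting `c` times the identity leaves a function with circle derivative `f' - c`, and the
  -- whole arc stays within `dist p q` of `q`.
  have hd : ∀ t ∈ Set.uIcc 0 s,
      HasDerivWithinAt (fun t : ℝ => f (q * Circle.exp t) - c * ((q * Circle.exp t : Circle) : ℂ))
      (I * (q * Circle.exp t : Circle) * (circleDeriv f (q * Circle.exp t) - c))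
      (Set.uIcc 0 s) t := fun t _ => by
    have h1 := ((hf.hasDerivAt q t).sub ((hasDerivAt_coe_exp q t).const_mul c)).hasDerivWithinAt
      (s := Set.uIcc 0 s)
    have h2 : I * (q * Circle.exp t : Circle) * (circleDeriv f (q * Circle.exp t) - c) =
        I * (q * Circle.exp t : Circle) * circleDeriv f (q * Circle.exp t) -
          c * (I * (q * Circle.exp t : Circle)) := by ring
    rw [h2]
    exact h1
  have hb : ∀ t ∈ Set.uIcc 0 s,
      ‖I * (q * Circle.exp t : Circle) * (circleDeriv f (q * Circle.exp t) - c)‖ ≤ M := by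
    intro t h
    rw [norm_mul, norm_mul, norm_I, Circle.norm_coe, one_mul, one_mul]
    refine hM _ (ht t ?_)
    have := Set.abs_sub_left_of_mem_uIcc h
    simpa using this
  have := Convex.norm_image_sub_le_of_norm_hasDerivWithin_le hd hb (convex_uIcc 0 s)
    Set.left_mem_uIcc Set.right_mem_uIcc
  simp only [Circle.exp_zero, mul_one, ← hp, sub_zero, Real.norm_eq_abs] at this
  calc _ = ‖f p - c * p - (f q - c * q)‖ := by congr 1; ring
    _ ≤ M * |s| := this
    _ ≤ M * (Real.pi / 2 * dist p q) := by gcongr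
    _ = _ := by ring

lemma norm_sub_le_of_deriv_le (hf : CircleDifferentiable f) {M : ℝ}
    (hM : ∀ ξ, ‖circleDeriv f ξ‖ ≤ M) (p q : Circle) :
    ‖f p - f q‖ ≤ M * (Real.pi / 2) * dist p q := by
  have := norm_sub_sub_le hf (p := p) (q := q) (c := 0) (M := M)
    (fun ξ _ => by rw [sub_zero]; exact hM ξ)
  simpa using this

/-- Since `arg` is continuous near `1`, `z ↦ arg (z / w)` is an angle coordinate near `w`, along
which `f` is differentiable. -/
lemma CircleDifferentiable.continuous (hf : CircleDifferentiable f) : Continuous f := by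
  rw [continuous_iff_continuousAt]
  intro w
  have h : ContinuousAt (fun z : Circle => f (w * Circle.exp (arg ((z / w : Circle) : ℂ)))) w := by
    have h1 : ContinuousAt (fun z : Circle => arg ((z / w : Circle) : ℂ)) w := by
      refine ContinuousAt.comp (f := fun z : Circle => ((z / w : Circle) : ℂ)) (g := arg) ?_ ?_
      · refine continuousAt_arg ?_
        simp
      · have : Continuous (fun z : Circle => ((z / w : Circle) : ℂ)) := by fun_prop
        exact this.continuousAt
    refine ContinuousAt.comp (f := fun z : Circle => arg ((z / w : Circle) : ℂ))
      (g := fun t : ℝ => f (w * Circle.exp t)) ?_ h1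
    exact (hf.hasDerivAt w _).continuousAt
  refine h.congr (Eventually.of_forall fun z => ?_)
  have h1 : Circle.exp (arg ((z / w : Circle) : ℂ)) = z / w := Circle.exp_arg _
  simp only [h1, mul_div_cancel]

/-- Integration by parts: a derivative along the circle has mean zero. -/
lemma cint_deriv (hf : CircleDifferentiable f) (hc : Continuous (circleDeriv f)) :
    cint (fun w => (w : ℂ) * circleDeriv f w) = 0 := by
  have h : ∀ θ ∈ Set.uIcc (0 : ℝ) (2 * Real.pi), HasDerivAt (fun t : ℝ => f (Circle.exp t))
      (I * (Circle.exp θ : ℂ) * circleDeriv f (Circle.exp θ)) θ := fun θ _ => by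
    simpa using hf.hasDerivAt 1 θ
  have h2 := intervalIntegral.integral_eq_sub_of_hasDerivAt h
    (Continuous.intervalIntegrable (by fun_prop) _ _)
  simp only [Circle.exp_two_pi, Circle.exp_zero, sub_self, mul_assoc] at h2
  rw [intervalIntegral.integral_const_mul] at h2
  simpa [cint] using h2

end Calculus

/-! ### A Banach algebra of kernels -/

lemma holderWith_of_dist_le {S Z : Type*} [PseudoMetricSpace S] [PseudoMetricSpace Z] {g : S → Z}
    {C r : ℝ≥0} (h : ∀ x y, dist (g x) (g y) ≤ C * dist x y ^ (r : ℝ)) : HolderWith C r g := by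
  intro x y
  have h1 : ENNReal.ofReal (dist x y) ^ (r : ℝ) = ENNReal.ofReal (dist x y ^ (r : ℝ)) :=
    ENNReal.ofReal_rpow_of_nonneg dist_nonneg r.2
  rw [edist_dist, edist_dist, h1, ← ENNReal.ofReal_coe_nnreal, ← ENNReal.ofReal_mul (NNReal.coe_nonneg C)]
  exact ENNReal.ofReal_le_ofReal (h x y)

/-- Lebesgue measure on the interval of angles. -/
def angleMeasure : Measure ℝ := volume.restrict (Ioc 0 (2 * Real.pi))

lemma integrable_angle (x : C(Circle, ℂ)) :
    Integrable (fun θ => x (Circle.exp θ)) angleMeasure :=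
  (intervalIntegrable_circle x.continuous 0 (2 * Real.pi)).1

/-- The inclusion of the continuous functions on the circle into the integrable functions. -/
def iota : C(Circle, ℂ) →ₗ[ℝ] Lp ℂ 1 angleMeasure where
  toFun x := (integrable_angle x).toL1 _
  map_add' x y := Integrable.toL1_add _ _ (integrable_angle x) (integrable_angle y)
  map_smul' c x := Integrable.toL1_smul _ (integrable_angle x) c

lemma norm_iota (x : C(Circle, ℂ)) : ‖iota x‖ = cint (fun w => ‖x w‖) := by
  have h : iota x = (integrable_angle x).toL1 _ := rfl
  rw [h, L1.norm_of_fun_eq_integral_norm, cint,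
    intervalIntegral.integral_of_le Real.two_pi_pos.le]
  rfl

lemma cint_mono {g h : Circle → ℝ} (hg : Continuous g) (hh : Continuous h) (H : ∀ w, g w ≤ h w) :
    cint g ≤ cint h :=
  intervalIntegral.integral_mono Real.two_pi_pos.le (intervalIntegrable_circle hg _ _)
    (intervalIntegrable_circle hh _ _) fun _ => H _

/-- The module property `L^∞ · L^1 ⊆ L^1`; it makes the kernel class closed under products. -/
lemma norm_iota_mul_le (x y : C(Circle, ℂ)) : ‖iota (x * y)‖ ≤ ‖x‖ * ‖iota y‖ := by
  rw [norm_iota, norm_iota, ← cint_const_mul_real]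
  refine cint_mono (by fun_prop) (by fun_prop) fun w => ?_
  rw [ContinuousMap.mul_apply, norm_mul]
  gcongr
  exact x.norm_coe_le_norm w

lemma norm_iota_le (x : C(Circle, ℂ)) : ‖iota x‖ ≤ 2 * Real.pi * ‖x‖ := by
  rw [norm_iota]
  refine (le_abs_self _).trans (norm_cint_le_of_le (g := fun w => ‖x w‖) fun w => ?_)
  rw [norm_norm]
  exact x.norm_coe_le_norm w

/-- The slices of a kernel as integrable functions. -/
def slice (K : C(Circle, C(Circle, ℂ))) (w : Circle) : Lp ℂ 1 angleMeasure := iota (K w)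

lemma slice_add (K K' : C(Circle, C(Circle, ℂ))) : slice (K + K') = slice K + slice K' := by
  funext w; exact map_add iota _ _

lemma slice_smul (c : ℝ) (K : C(Circle, C(Circle, ℂ))) : slice (c • K) = c • slice K := by
  funext w; exact map_smul iota _ _

lemma dist_slice (K : C(Circle, C(Circle, ℂ))) (w₁ w₂ : Circle) :
    dist (slice K w₁) (slice K w₂) = cint (fun τ => ‖K w₁ τ - K w₂ τ‖) := by
  rw [dist_eq_norm, slice, slice, ← map_sub, norm_iota]
  rfl

lemma holderWith_slice {K : C(Circle, C(Circle, ℂ))} {C α : ℝ≥0}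
    (h : ∀ w₁ w₂, cint (fun τ => ‖K w₁ τ - K w₂ τ‖) ≤ C * dist w₁ w₂ ^ (α : ℝ)) :
    HolderWith C α (slice K) :=
  holderWith_of_dist_le fun w₁ w₂ => by rw [dist_slice]; exact h w₁ w₂

/-- Product rule for increments: each increment is measured in `L^1`, the other factor in the sup
norm. -/
lemma holderWith_slice_mul {K K' : C(Circle, C(Circle, ℂ))} {C C' α : ℝ≥0}
    (h : HolderWith C α (slice K)) (h' : HolderWith C' α (slice K')) :
    HolderWith (‖K‖₊ * C' + C * ‖K'‖₊) α (slice (K * K')) := by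
  refine holderWith_of_dist_le fun w₁ w₂ => ?_
  have h1 := h.dist_le w₁ w₂
  have h2 := h'.dist_le w₁ w₂
  rw [dist_eq_norm, slice, slice, ← map_sub] at *
  have e : (K * K') w₁ - (K * K') w₂ = K w₁ * (K' w₁ - K' w₂) + K' w₂ * (K w₁ - K w₂) := by
    simp only [ContinuousMap.mul_apply]; ring
  rw [e, map_add]
  refine (norm_add_le _ _).trans ?_
  have a1 := norm_iota_mul_le (K w₁) (K' w₁ - K' w₂)
  have a2 := norm_iota_mul_le (K' w₂) (K w₁ - K w₂)
  have b1 := K.norm_coe_le_norm w₁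
  have b2 := K'.norm_coe_le_norm w₂
  push_cast
  calc _ ≤ ‖K‖ * (C' * dist w₁ w₂ ^ (α : ℝ)) + ‖K'‖ * (C * dist w₁ w₂ ^ (α : ℝ)) := by
        refine add_le_add (a1.trans ?_) (a2.trans ?_) <;> gcongr
    _ = _ := by ring

/-- The kernels whose slices depend on the parameter in a Hölder continuous way, in the mean. -/
def kerSubalgebra (α : ℝ≥0) : Subalgebra ℝ C(Circle, C(Circle, ℂ)) where
  carrier := {K | MemHolder α (slice K)}
  mul_mem' := fun ⟨_, h⟩ ⟨_, h'⟩ => ⟨_, holderWith_slice_mul h h'⟩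
  add_mem' := fun h h' => by
    change MemHolder α (slice (_ + _))
    rw [slice_add]
    exact MemHolder.add h h'
  algebraMap_mem' c := ⟨0, holderWith_slice fun w₁ w₂ => by simp [Algebra.algebraMap_eq_smul_one, cint]⟩

/-- The Banach algebra of kernels `K(τ, w)`, written `K w τ`. -/
def Ker (α : ℝ≥0) : Type := ↥(kerSubalgebra α)

namespace Ker

variable {α : ℝ≥0}

instance : CommRing (Ker α) := inferInstanceAs (CommRing ↥(kerSubalgebra α))

instance : Algebra ℝ (Ker α) := inferInstanceAs (Algebra ℝ ↥(kerSubalgebra α))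

/-- The underlying continuous kernel. -/
def incl : Ker α →ₐ[ℝ] C(Circle, C(Circle, ℂ)) := (kerSubalgebra α).val

lemma incl_injective : Function.Injective (incl (α := α)) := Subtype.val_injective

lemma memHolder (K : Ker α) : MemHolder α (slice (incl K)) := K.2

/-- A continuous kernel with Hölder continuous slices. -/
def ofMem (K : C(Circle, C(Circle, ℂ))) (h : MemHolder α (slice K)) : Ker α := ⟨K, h⟩

lemma incl_ofMem (K : C(Circle, C(Circle, ℂ))) (h : MemHolder α (slice K)) :
    incl (ofMem K h) = K := rfl

/-- The value of the kernel at `τ` for the parameter `w`. -/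
def eval (K : Ker α) (w τ : Circle) : ℂ := incl K w τ

lemma ext' {K K' : Ker α} (h : ∀ w τ, K.eval w τ = K'.eval w τ) : K = K' :=
  incl_injective (ContinuousMap.ext fun w => ContinuousMap.ext fun τ => h w τ)

@[simp] lemma eval_add (K K' : Ker α) (w τ : Circle) :
    (K + K').eval w τ = K.eval w τ + K'.eval w τ := rfl

@[simp] lemma eval_sub (K K' : Ker α) (w τ : Circle) :
    (K - K').eval w τ = K.eval w τ - K'.eval w τ := rfl

@[simp] lemma eval_neg (K : Ker α) (w τ : Circle) : (-K).eval w τ = -K.eval w τ := rfl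

@[simp] lemma eval_mul (K K' : Ker α) (w τ : Circle) :
    (K * K').eval w τ = K.eval w τ * K'.eval w τ := rfl

@[simp] lemma eval_smul (c : ℝ) (K : Ker α) (w τ : Circle) :
    (c • K).eval w τ = c * K.eval w τ := rfl

@[simp] lemma eval_one (w τ : Circle) : (1 : Ker α).eval w τ = 1 := rfl

@[simp] lemma eval_zero (w τ : Circle) : (0 : Ker α).eval w τ = 0 := rfl

lemma continuous_eval (K : Ker α) : Continuous (Function.uncurry K.eval) := by
  have : Continuous fun p : Circle × Circle => incl K p.1 p.2 := by fun_prop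
  exact this

lemma continuous_eval_right (K : Ker α) (w : Circle) : Continuous (K.eval w) :=
  (incl K w).continuous

/-- The Hölder seminorm. -/
def holder (K : Ker α) : ℝ≥0 := nnHolderNorm α (slice (incl K))

instance : Norm (Ker α) := ⟨fun K => ‖incl K‖ + (holder K : ℝ)⟩

lemma norm_def (K : Ker α) : ‖K‖ = ‖incl K‖ + (holder K : ℝ) := rfl

lemma norm_incl_le (K : Ker α) : ‖incl K‖ ≤ ‖K‖ := by
  rw [norm_def]
  exact le_add_of_nonneg_right K.holder.2

lemma norm_eval_le (K : Ker α) (w τ : Circle) : ‖K.eval w τ‖ ≤ ‖K‖ :=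
  (((incl K w).norm_coe_le_norm τ).trans ((incl K).norm_coe_le_norm w)).trans (norm_incl_le K)

lemma cint_eval_sub_le (K : Ker α) (w₁ w₂ : Circle) :
    cint (fun τ => ‖K.eval w₁ τ - K.eval w₂ τ‖) ≤ ‖K‖ * dist w₁ w₂ ^ (α : ℝ) := by
  have h := K.memHolder.holderWith.dist_le w₁ w₂
  rw [dist_slice] at h
  refine h.trans ?_
  gcongr
  rw [norm_def]
  exact le_add_of_nonneg_left (norm_nonneg _)

lemma normedSpaceCore : NormedSpace.Core ℝ (Ker α) where
  norm_nonneg K := by rw [norm_def]; positivity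
  norm_smul c K := by
    rw [norm_def, norm_def, holder, holder, map_smul, slice_smul, K.memHolder.nnHolderNorm_smul,
      norm_smul]
    push_cast
    ring
  norm_triangle K K' := by
    rw [norm_def, norm_def, norm_def, holder, holder, holder, map_add, slice_add]
    have h1 := norm_add_le (incl K) (incl K')
    have h2 : (nnHolderNorm α (slice (incl K) + slice (incl K')) : ℝ) ≤
        nnHolderNorm α (slice (incl K)) + nnHolderNorm α (slice (incl K')) := by
      exact_mod_cast K.memHolder.nnHolderNorm_add_le K'.memHolder
    linarith
  norm_eq_zero_iff K := by
    constructor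
    · intro h
      have h1 : ‖incl K‖ = 0 := le_antisymm (h ▸ norm_incl_le K) (norm_nonneg _)
      exact incl_injective ((norm_eq_zero.1 h1).trans (map_zero incl).symm)
    · rintro rfl
      have h1 : slice (0 : C(Circle, C(Circle, ℂ))) = 0 := by
        funext w; exact map_zero iota
      rw [norm_def, holder, map_zero, h1]
      simp

instance : NormedAddCommGroup (Ker α) := NormedAddCommGroup.ofCore normedSpaceCore

instance : NormedSpace ℝ (Ker α) := NormedSpace.ofCore normedSpaceCore

lemma norm_le_of_bounds {K : Ker α} {M C : ℝ} (hM : ∀ w τ, ‖K.eval w τ‖ ≤ M) (hC : 0 ≤ C)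
    (h : ∀ w₁ w₂, cint (fun τ => ‖K.eval w₁ τ - K.eval w₂ τ‖) ≤ C * dist w₁ w₂ ^ (α : ℝ)) :
    ‖K‖ ≤ M + C := by
  have hM0 : 0 ≤ M := (norm_nonneg _).trans (hM 1 1)
  rw [norm_def]
  refine add_le_add ?_ ?_
  · refine (ContinuousMap.norm_le _ hM0).2 fun w => (ContinuousMap.norm_le _ hM0).2 fun τ => hM w τ
  · have := (holderWith_slice (K := incl K) (C := ⟨C, hC⟩) h).nnholderNorm_le
    exact_mod_cast this

instance : NormedCommRing (Ker α) where
  __ := (inferInstance : NormedAddCommGroup (Ker α))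
  __ := (inferInstance : CommRing (Ker α))
  norm_mul_le K K' := by
    have h : (holder (K * K') : ℝ) ≤ ‖incl K‖ * holder K' + holder K * ‖incl K'‖ := by
      have := (holderWith_slice_mul K.memHolder.holderWith K'.memHolder.holderWith).nnholderNorm_le
      exact_mod_cast this
    have h2 : ‖incl (K * K')‖ ≤ ‖incl K‖ * ‖incl K'‖ := by
      rw [map_mul]; exact norm_mul_le _ _
    rw [norm_def, norm_def, norm_def]
    -- Expanding the product of the two norms gives all terms of the product rule and, in surplus,
    -- this one.
    have h3 : (0 : ℝ) ≤ holder K * holder K' := by positivity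
    nlinarith

instance : NormedAlgebra ℝ (Ker α) where
  norm_smul_le := norm_smul_le

/-- Uniform limits exist, and the Hölder seminorm is lower semicontinuous under them. The Cauchy
estimate for increments therefore passes to the limit (`key`), which gives first membership of the
limit and then convergence in the seminorm. -/
instance : CompleteSpace (Ker α) := by
  refine Metric.complete_of_cauchySeq_tendsto fun u hu => ?_
  have hi : LipschitzWith 1 (incl (α := α)) := LipschitzWith.of_dist_le_mul fun K K' => by
    rw [dist_eq_norm, dist_eq_norm, ← map_sub, NNReal.coe_one, one_mul]
    exact norm_incl_le _
  obtain ⟨K, hK⟩ := cauchySeq_tendsto_of_complete (hi.uniformContinuous.comp_cauchySeq hu)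
  have hKe : ∀ w τ, Tendsto (fun n => (u n).eval w τ) atTop (𝓝 (K w τ)) := fun w τ => by
    have h1 : Continuous fun k : C(Circle, C(Circle, ℂ)) => k w τ := by fun_prop
    exact (h1.tendsto K).comp hK
  have key : ∀ ε > 0, ∃ N, ∀ n ≥ N, ∀ w₁ w₂,
      dist (slice (incl (u n)) w₁ - slice K w₁) (slice (incl (u n)) w₂ - slice K w₂) ≤
        ε * dist w₁ w₂ ^ (α : ℝ) := by
    intro ε hε
    obtain ⟨N, hN⟩ := Metric.cauchySeq_iff.1 hu ε hε
    refine ⟨N, fun n hn w₁ w₂ => ?_⟩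
    have hs : ∀ w, Tendsto (fun m => slice (incl (u m)) w) atTop (𝓝 (slice K w)) := fun w => by
      have h1 : Continuous iota := AddMonoidHomClass.continuous_of_bound iota (2 * Real.pi) norm_iota_le
      have h2 : Continuous fun k : C(Circle, C(Circle, ℂ)) => iota (k w) := by fun_prop
      exact (h2.tendsto K).comp hK
    have hl : Tendsto (fun m => dist (slice (incl (u n)) w₁ - slice (incl (u m)) w₁)
        (slice (incl (u n)) w₂ - slice (incl (u m)) w₂)) atTop
        (𝓝 (dist (slice (incl (u n)) w₁ - slice K w₁) (slice (incl (u n)) w₂ - slice K w₂))) :=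
      (tendsto_const_nhds.sub (hs w₁)).dist (tendsto_const_nhds.sub (hs w₂))
    refine le_of_tendsto hl ?_
    filter_upwards [eventually_ge_atTop N] with m hm
    have h3 := (u n - u m).memHolder.holderWith.dist_le w₁ w₂
    have h4 : ∀ w, slice (incl (u n - u m)) w =
        slice (incl (u n)) w - slice (incl (u m)) w := fun w => by
      rw [map_sub]; exact map_sub iota _ _
    rw [h4, h4] at h3
    refine h3.trans ?_
    gcongr
    have h5 := hN n hn m hm
    rw [dist_eq_norm, norm_def] at h5
    have h6 := norm_nonneg (incl (u n - u m))
    have h7 : (nnHolderNorm α (slice (incl (u n - u m))) : ℝ) = (u n - u m).holder := rfl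
    linarith
  have hKm : MemHolder α (slice K) := by
    obtain ⟨N, hN⟩ := key 1 one_pos
    refine ⟨nnHolderNorm α (slice (incl (u N))) + 1, holderWith_of_dist_le fun w₁ w₂ => ?_⟩
    have h1 := hN N le_rfl w₁ w₂
    have h2 := (u N).memHolder.holderWith.dist_le w₁ w₂
    rw [dist_eq_norm] at *
    have e : slice K w₁ - slice K w₂ = (slice (incl (u N)) w₁ - slice (incl (u N)) w₂) -
      (slice (incl (u N)) w₁ - slice K w₁ - (slice (incl (u N)) w₂ - slice K w₂)) := by abel
    rw [e]
    refine (norm_sub_le _ _).trans ?_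
    push_cast
    linarith
  refine ⟨ofMem K hKm, ?_⟩
  have hincl := incl_ofMem K hKm
  rw [Metric.tendsto_atTop]
  intro ε hε
  obtain ⟨N₁, hN₁⟩ := key (ε / 3) (by positivity)
  obtain ⟨N₂, hN₂⟩ := Metric.tendsto_atTop.1 hK (ε / 3) (by positivity)
  refine ⟨max N₁ N₂, fun n hn => ?_⟩
  rw [dist_eq_norm, norm_def]
  have h1 := hN₂ n (le_of_max_le_right hn)
  rw [Function.comp_apply, dist_eq_norm] at h1
  rw [map_sub, hincl]
  have h2 : HolderWith (⟨ε / 3, by positivity⟩ : ℝ≥0) α (slice (incl (u n - ofMem K hKm))) := by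
    refine holderWith_of_dist_le fun w₁ w₂ => ?_
    have h4 : ∀ w, slice (incl (u n - ofMem K hKm)) w = slice (incl (u n)) w - slice K w := fun w => by
      rw [map_sub]; exact map_sub iota _ _
    rw [h4, h4]
    exact hN₁ n (le_of_max_le_left hn) w₁ w₂
  have h3 : (holder (u n - ofMem K hKm) : ℝ) ≤ ε / 3 := by exact_mod_cast h2.nnholderNorm_le
  linarith

/-- A kernel without zeros is invertible. -/
lemma isUnit_of_ne_zero {K : Ker α} (h : ∀ w τ, K.eval w τ ≠ 0) : IsUnit K := by
  have hne : ∀ w τ, incl K w τ ≠ 0 := h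
  have hc : Continuous fun p : Circle × Circle => (incl K p.1 p.2)⁻¹ :=
    Continuous.inv₀ (by fun_prop) fun p => hne p.1 p.2
  let J : C(Circle, C(Circle, ℂ)) := ContinuousMap.curry ⟨_, hc⟩
  have hJ : ∀ w τ, J w τ = (incl K w τ)⁻¹ := fun w τ => rfl
  have hb : ∀ w τ, ‖(incl K w τ)⁻¹‖ ≤ ‖J‖ := fun w τ => by
    rw [← hJ]
    exact ((J w).norm_coe_le_norm τ).trans (J.norm_coe_le_norm w)
  have hJm : MemHolder α (slice J) := by
    refine ⟨‖J‖₊ * ‖J‖₊ * K.holder, holderWith_slice fun w₁ w₂ => ?_⟩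
    have h1 := K.memHolder.holderWith.dist_le w₁ w₂
    rw [dist_slice] at h1
    have h2 : cint (fun τ => ‖J w₁ τ - J w₂ τ‖) ≤
        cint (fun τ => ‖J‖ * ‖J‖ * ‖incl K w₁ τ - incl K w₂ τ‖) := by
      refine cint_mono (by fun_prop) (by fun_prop) fun τ => ?_
      -- `1/a - 1/b = (b - a)/(ab)`; by compactness both reciprocals are bounded by `‖J‖`.
      rw [hJ, hJ, inv_sub_inv (hne _ _) (hne _ _), div_eq_mul_inv, mul_inv, norm_mul, norm_mul,
        mul_comm, norm_sub_rev]
      gcongr <;> exact hb _ _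
    rw [cint_const_mul_real] at h2
    refine h2.trans ?_
    push_cast
    rw [mul_assoc (‖J‖ * ‖J‖)]
    gcongr
    exact h1
  refine IsUnit.of_mul_eq_one (ofMem J hJm) (ext' fun w τ => ?_)
  rw [eval_mul, eval_one]
  exact mul_inv_cancel₀ (hne w τ)

lemma eval_inverse {K : Ker α} (h : IsUnit K) (w τ : Circle) :
    (Ring.inverse K).eval w τ = (K.eval w τ)⁻¹ := by
  have := Ring.mul_inverse_cancel K h
  have h2 : (K * Ring.inverse K).eval w τ = 1 := by rw [this, eval_one]
  rw [eval_mul] at h2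
  exact eq_inv_of_mul_eq_one_right h2

end Ker

/-! ### Weakly singular integrals -/

lemma intervalIntegrable_abs_rpow {r : ℝ} (hr : -1 < r) (a b : ℝ) :
    IntervalIntegrable (fun s : ℝ => |s| ^ r) volume a b := by
  have h : ∀ c : ℝ, 0 ≤ c → IntervalIntegrable (fun s : ℝ => |s| ^ r) volume 0 c := fun c hc => by
    refine (intervalIntegral.intervalIntegrable_rpow' (a := 0) (b := c) hr).congr ?_
    intro s hs
    rw [uIoc_of_le hc] at hs
    simp only [abs_of_pos hs.1]
  have h2 : ∀ c : ℝ, IntervalIntegrable (fun s : ℝ => |s| ^ r) volume 0 c := fun c => by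
    rcases le_total 0 c with hc | hc
    · exact h c hc
    · have := (h (-c) (by linarith)).comp_mul_left (c := -1)
      simpa using this
  exact (h2 a).symm.trans (h2 b)

/-- The bound for the integral of `|τ - w| ^ (β - 1)` over the circle. -/
def singConst (β : ℝ) : ℝ := ∫ s in (-Real.pi)..Real.pi, (2 / Real.pi) ^ (β - 1) * |s| ^ (β - 1)

lemma singConst_nonneg (β : ℝ) : 0 ≤ singConst β :=
  intervalIntegral.integral_nonneg (by linarith [Real.pi_pos]) fun s _ => by positivity

lemma dist_mul_exp (w : Circle) (s : ℝ) : dist (w * Circle.exp s) w = dist (Circle.exp s) 1 := by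
  have := dist_mul_left_circle w (Circle.exp s) 1
  rwa [mul_one] at this

/-- Integrals in the angle, centred at a point of the circle. -/
lemma norm_cint_le_integral {E : Type*} [NormedAddCommGroup E] [NormedSpace ℝ E] {g : Circle → E}
    (w : Circle) {φ : ℝ → ℝ} (hφ : IntervalIntegrable φ volume (-Real.pi) Real.pi)
    (h : ∀ s, |s| ≤ Real.pi → s ≠ 0 → ‖g (w * Circle.exp s)‖ ≤ φ s) :
    ‖cint g‖ ≤ ∫ s in (-Real.pi)..Real.pi, φ s := by
  rw [← cint_mul_left g w, cint_eq_symm]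
  refine intervalIntegral.norm_integral_le_of_norm_le (by linarith [Real.pi_pos]) ?_ hφ
  filter_upwards [compl_mem_ae_iff.2 (measure_singleton (0 : ℝ))] with s hs hs'
  exact h s (abs_le.2 ⟨hs'.1.le, hs'.2⟩) hs

lemma two_div_pi_mul_le {s : ℝ} (hs : |s| ≤ Real.pi) :
    2 / Real.pi * |s| ≤ dist (Circle.exp s) 1 := by
  have h := abs_le_dist_exp hs
  have hp := Real.pi_pos
  calc 2 / Real.pi * |s| ≤ 2 / Real.pi * (Real.pi / 2 * dist (Circle.exp s) 1) := by gcongr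
    _ = _ := by field_simp

/-- The chord is at least `2/π` times the arc, and the negative exponent reverses this, so `|s| ^ (β
- 1)` dominates; it is integrable because `β > 0`. -/
lemma norm_cint_le_of_singular {E : Type*} [NormedAddCommGroup E] [NormedSpace ℝ E] {g : Circle → E}
    {β M : ℝ} (hβ : 0 < β) (hβ₁ : β < 1) (hM : 0 ≤ M) (w : Circle)
    (h : ∀ τ, τ ≠ w → ‖g τ‖ ≤ M * dist τ w ^ (β - 1)) : ‖cint g‖ ≤ M * singConst β := by
  have h1 : M * singConst β = ∫ s in (-Real.pi)..Real.pi,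
      M * ((2 / Real.pi) ^ (β - 1) * |s| ^ (β - 1)) := by
    rw [intervalIntegral.integral_const_mul, singConst]
  rw [h1]
  refine norm_cint_le_integral w
    (((intervalIntegrable_abs_rpow (by linarith) _ _).const_mul _).const_mul _) fun s hs hs0 => ?_
  have hp := Real.pi_pos
  have hs1 : 0 < |s| := abs_pos.2 hs0
  have hd : 0 < dist (Circle.exp s) 1 := lt_of_lt_of_le (by positivity) (two_div_pi_mul_le hs)
  refine (h _ ?_).trans ?_
  · intro h'
    rw [← dist_mul_exp w, h', dist_self] at hd
    exact lt_irrefl _ hd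
  · rw [dist_mul_exp, ← Real.mul_rpow (by positivity) hs1.le]
    refine mul_le_mul_of_nonneg_left ?_ hM
    exact Real.rpow_le_rpow_of_nonpos (by positivity) (two_div_pi_mul_le hs) (by linarith)

/-! ### Elements of `X` -/

namespace X

variable {β : ℝ≥0} (f : X β)

lemma continuous : Continuous f := (incl f).continuous

lemma norm_deriv_nonneg : 0 ≤ ⨆ w, ‖circleDeriv f w‖ := Real.iSup_nonneg fun _ => norm_nonneg _

lemma norm_apply_le (w : Circle) : ‖f w‖ ≤ ‖f‖ := by
  refine ((incl f).norm_coe_le_norm w).trans ?_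
  rw [norm_def]
  have := norm_deriv_nonneg f
  have : (0 : ℝ) ≤ nnHolderNorm β (circleDeriv f) := NNReal.coe_nonneg _
  linarith

lemma norm_deriv_le (w : Circle) : ‖circleDeriv f w‖ ≤ ‖f‖ := by
  refine (le_ciSup (bddAbove_of_memHolder f.memHolder_deriv) w).trans ?_
  rw [norm_def]
  have := norm_nonneg (incl f)
  have : (0 : ℝ) ≤ nnHolderNorm β (circleDeriv f) := NNReal.coe_nonneg _
  linarith

lemma norm_deriv_sub_le (p q : Circle) :
    ‖circleDeriv f p - circleDeriv f q‖ ≤ ‖f‖ * dist p q ^ (β : ℝ) := by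
  rw [← dist_eq_norm]
  refine (f.memHolder_deriv.holderWith.dist_le p q).trans ?_
  gcongr
  rw [norm_def]
  have := norm_nonneg (incl f)
  have := norm_deriv_nonneg f
  linarith

lemma norm_sub_le' (p q : Circle) : ‖f p - f q‖ ≤ ‖f‖ * (Real.pi / 2) * dist p q :=
  norm_sub_le_of_deriv_le f.differentiable (norm_deriv_le f) p q

lemma continuous_deriv (hβ : 0 < β) : Continuous (circleDeriv f) :=
  f.memHolder_deriv.holderWith.continuous hβ

/-- Freezing the derivative at `q` leaves only the Hölder oscillation of `f'` on the short arc. -/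
lemma norm_taylor_le (p q : Circle) :
    ‖f p - f q - circleDeriv f q * ((p : ℂ) - q)‖ ≤
      ‖f‖ * dist p q ^ (β : ℝ) * (Real.pi / 2) * dist p q := by
  refine norm_sub_sub_le f.differentiable fun ξ hξ => (norm_deriv_sub_le f ξ q).trans ?_
  gcongr

end X

/-! ### Divided differences and their dependence on the base point. -/

/-- The divided difference `B / A`, extended to the diagonal by the derivative. -/
def divDiff (f : Circle → ℂ) (w τ : Circle) : ℂ :=
  open Classical in if τ = w then circleDeriv f w else (f τ - f w) / ((τ : ℂ) - w)

section divDiff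

variable {f : Circle → ℂ}

lemma divDiff_of_ne {w τ : Circle} (h : τ ≠ w) :
    divDiff f w τ = (f τ - f w) / ((τ : ℂ) - w) := if_neg h

lemma divDiff_self (w : Circle) : divDiff f w w = circleDeriv f w := if_pos rfl

lemma divDiff_comm (w τ : Circle) : divDiff f w τ = divDiff f τ w := by
  rcases eq_or_ne τ w with rfl | h
  · rfl
  · rw [divDiff_of_ne h, divDiff_of_ne h.symm, ← neg_sub (f w), ← neg_sub (w : ℂ), neg_div_neg_eq]

end divDiff

namespace X

variable {β : ℝ≥0} (f : X β)

lemma norm_divDiff_le (w τ : Circle) : ‖divDiff f w τ‖ ≤ ‖f‖ * (Real.pi / 2) := by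
  rcases eq_or_ne τ w with rfl | h
  · rw [divDiff_self]
    refine (norm_deriv_le f τ).trans (le_mul_of_one_le_right (norm_nonneg _) ?_)
    linarith [Real.pi_gt_three]
  · rw [divDiff_of_ne h, norm_div, ← dist_eq_norm_coe, div_le_iff₀ (dist_pos.2 h)]
    exact norm_sub_le' f τ w

lemma norm_divDiff_sub_deriv_le (w τ : Circle) :
    ‖divDiff f w τ - circleDeriv f w‖ ≤ ‖f‖ * (Real.pi / 2) * dist τ w ^ (β : ℝ) := by
  rcases eq_or_ne τ w with rfl | h
  · rw [divDiff_self, sub_self, norm_zero]; positivity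
  · have h0 := coe_sub_ne_zero h
    have e : divDiff f w τ - circleDeriv f w =
        (f τ - f w - circleDeriv f w * ((τ : ℂ) - w)) / ((τ : ℂ) - w) := by
      rw [divDiff_of_ne h]; field_simp
    rw [e, norm_div, ← dist_eq_norm_coe, div_le_iff₀ (dist_pos.2 h)]
    refine (norm_taylor_le f τ w).trans (le_of_eq ?_)
    ring

/-- Both quotients are compared with `f'` at the common vertex `q`. -/
lemma norm_divDiff_sub_le_aux (p q r : Circle) {D : ℝ} (h1 : dist p q ≤ D) (h2 : dist q r ≤ D) :
    ‖divDiff f p q - divDiff f q r‖ ≤ ‖f‖ * Real.pi * D ^ (β : ℝ) := by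
  have a := norm_divDiff_sub_deriv_le f q p
  have b := norm_divDiff_sub_deriv_le f q r
  rw [divDiff_comm p q]
  have e : divDiff f q p - divDiff f q r =
    (divDiff f q p - circleDeriv f q) - (divDiff f q r - circleDeriv f q) := by ring
  rw [e]
  refine (norm_sub_le _ _).trans ?_
  have a' : ‖f‖ * (Real.pi / 2) * dist p q ^ (β : ℝ) ≤ ‖f‖ * (Real.pi / 2) * D ^ (β : ℝ) := by
    gcongr
  have b' : ‖f‖ * (Real.pi / 2) * dist r q ^ (β : ℝ) ≤ ‖f‖ * (Real.pi / 2) * D ^ (β : ℝ) := by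
    rw [dist_comm]; gcongr
  linarith

/-- The bound for second divided differences. -/
lemma norm_divDiff_sub_le {x y z : Circle} (hβ : β < 1) (hxy : x ≠ y) (hzy : z ≠ y) (hxz : x ≠ z)
    {m : ℝ} (hm0 : 0 < m) (hm : m ≤ max (dist x z) (max (dist x y) (dist y z))) :
    ‖divDiff f x y - divDiff f z y‖ ≤ ‖f‖ * Real.pi * dist x z * m ^ ((β : ℝ) - 1) := by
  have hβ' : (β : ℝ) < 1 := hβ
  have key : ∀ D T : ℝ, 0 < D → m ≤ D → T * D ≤ ‖f‖ * Real.pi * D ^ (β : ℝ) →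
      dist x z * T ≤ ‖f‖ * Real.pi * dist x z * m ^ ((β : ℝ) - 1) := by
    intro D T hD hmD hT
    have h1 : T ≤ ‖f‖ * Real.pi * D ^ ((β : ℝ) - 1) := by
      rw [Real.rpow_sub_one hD.ne', ← mul_div_assoc, le_div_iff₀ hD]
      exact hT
    have h2 : D ^ ((β : ℝ) - 1) ≤ m ^ ((β : ℝ) - 1) :=
      Real.rpow_le_rpow_of_nonpos hm0 hmD (by linarith)
    calc dist x z * T ≤ dist x z * (‖f‖ * Real.pi * m ^ ((β : ℝ) - 1)) := by
          refine mul_le_mul_of_nonneg_left (h1.trans ?_) dist_nonneg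
          have := Real.pi_pos
          gcongr
      _ = _ := by ring
  have n1 := coe_sub_ne_zero hxy
  have n2 := coe_sub_ne_zero hzy
  have n3 := coe_sub_ne_zero hxz
  have n1' := coe_sub_ne_zero hxy.symm
  have n2' := coe_sub_ne_zero hzy.symm
  have n3' := coe_sub_ne_zero hxz.symm
  have hmul : ∀ (p q : Circle) (a b : ℂ), p ≠ q → a = ((p : ℂ) - q) * b →
      ‖b‖ * dist p q = ‖a‖ := by
    intro p q a b _ h
    rw [h, norm_mul, dist_eq_norm_coe, mul_comm]
  -- `T` is the second divided difference at `x, y, z`, which is symmetric: its product with any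
  -- side of the triangle is a difference of two first quotients sharing a vertex. Taking the
  -- longest side bounds `T` by a multiple of its power `β - 1`, and as this exponent is negative
  -- the longest side may be replaced by the smaller `m`.
  set T : ℂ := (divDiff f x y - divDiff f z y) / ((x : ℂ) - z) with hT
  have e0 : divDiff f x y - divDiff f z y = ((x : ℂ) - z) * T := by rw [hT]; field_simp
  have e1 : divDiff f x z - divDiff f z y = ((x : ℂ) - y) * T := by
    rw [hT, divDiff_of_ne hxy.symm, divDiff_of_ne hzy.symm, divDiff_of_ne hxz.symm]
    field_simp
    ring
  have e2 : divDiff f y x - divDiff f x z = ((y : ℂ) - z) * T := by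
    rw [hT, divDiff_of_ne hxy.symm, divDiff_of_ne hzy.symm, divDiff_of_ne hxz.symm,
      divDiff_of_ne hxy]
    field_simp
    ring
  have e3 : divDiff f x y - divDiff f y z = ((x : ℂ) - z) * T := by
    rw [divDiff_comm y z, e0]
  rw [e0, norm_mul, ← dist_eq_norm_coe]
  rcases le_total (dist x z) (max (dist x y) (dist y z)) with h | h
  · rw [max_eq_right h] at hm
    rcases le_total (dist x y) (dist y z) with h' | h'
    · rw [max_eq_right h'] at hm h
      refine key (dist y z) ‖T‖ (dist_pos.2 hzy.symm) hm ?_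
      rw [hmul y z _ T hzy.symm e2]
      exact norm_divDiff_sub_le_aux f y x z (by rw [dist_comm]; exact h') h
    · rw [max_eq_left h'] at hm h
      refine key (dist x y) ‖T‖ (dist_pos.2 hxy) hm ?_
      rw [hmul x y _ T hxy e1]
      exact norm_divDiff_sub_le_aux f x z y h (by rw [dist_comm]; exact h')
  · rw [max_eq_left h] at hm
    refine key (dist x z) ‖T‖ (dist_pos.2 hxz) hm ?_
    rw [hmul x z _ T hxz e3]
    exact norm_divDiff_sub_le_aux f x y z ((le_max_left _ _).trans h) ((le_max_right _ _).trans h)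

lemma norm_divDiff_sub_le_rpow (hβ : β < 1) (x z y : Circle) :
    ‖divDiff f x y - divDiff f z y‖ ≤ ‖f‖ * Real.pi * dist x z ^ (β : ℝ) := by
  have hp := Real.pi_pos
  rcases eq_or_ne x z with rfl | hxz
  · rw [sub_self, norm_zero]; positivity
  have hd : 0 < dist x z := dist_pos.2 hxz
  have hf := norm_nonneg f
  have half : ‖f‖ * (Real.pi / 2) * dist x z ^ (β : ℝ) ≤ ‖f‖ * Real.pi * dist x z ^ (β : ℝ) := by
    gcongr; linarith
  rcases eq_or_ne x y with rfl | hxy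
  · rw [divDiff_self, divDiff_comm z x, norm_sub_rev]
    refine (norm_divDiff_sub_deriv_le f x z).trans ?_
    rw [dist_comm]; exact half
  rcases eq_or_ne z y with rfl | hzy
  · rw [divDiff_self, divDiff_comm x z]
    exact (norm_divDiff_sub_deriv_le f z x).trans half
  have := norm_divDiff_sub_le f hβ hxy hzy hxz hd (le_max_left _ _)
  rwa [Real.rpow_sub_one hd.ne', mul_assoc (‖f‖ * Real.pi), mul_div_cancel₀ _ hd.ne'] at this

/-- The full first power of `dist x z` is kept, and the loss is put on `dist y z`, where it is
integrable in `y`. -/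
lemma norm_divDiff_sub_le_singular (hβ : β < 1) {x z y : Circle} (hzy : y ≠ z) :
    ‖divDiff f x y - divDiff f z y‖ ≤
      ‖f‖ * Real.pi * dist x z * dist y z ^ ((β : ℝ) - 1) := by
  have hp := Real.pi_pos
  rcases eq_or_ne x z with rfl | hxz
  · rw [sub_self, norm_zero]; positivity
  rcases eq_or_ne x y with rfl | hxy
  · have hd : 0 < dist x z := dist_pos.2 hxz
    refine (norm_divDiff_sub_le_rpow f hβ x z x).trans (le_of_eq ?_)
    rw [Real.rpow_sub_one hd.ne', mul_assoc (‖f‖ * Real.pi), mul_div_cancel₀ _ hd.ne']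
  exact norm_divDiff_sub_le f hβ hxy hzy.symm hxz (dist_pos.2 hzy)
    ((le_max_right _ _).trans (le_max_right _ _))

lemma continuous_divDiff (hβ₀ : 0 < β) (hβ : β < 1) :
    Continuous (Function.uncurry (divDiff f)) := by
  rw [continuous_iff_continuousAt]
  rintro ⟨w₀, τ₀⟩
  rw [ContinuousAt, tendsto_iff_norm_sub_tendsto_zero]
  have hc : Continuous fun p : Circle × Circle => ‖f‖ * Real.pi * dist p.1 w₀ ^ (β : ℝ) +
      ‖f‖ * Real.pi * dist p.2 τ₀ ^ (β : ℝ) := by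
    refine (continuous_const.mul ?_).add (continuous_const.mul ?_)
    · exact Continuous.rpow_const (by fun_prop) fun _ => Or.inr β.2
    · exact Continuous.rpow_const (by fun_prop) fun _ => Or.inr β.2
  have hβ' : (β : ℝ) ≠ 0 := by exact_mod_cast hβ₀.ne'
  have h0 := hc.tendsto (w₀, τ₀)
  simp only [dist_self, Real.zero_rpow hβ', mul_zero, add_zero] at h0
  refine squeeze_zero (fun _ => norm_nonneg _) ?_ h0
  rintro ⟨w, τ⟩
  simp only [Function.uncurry_apply_pair]
  have e : divDiff f w τ - divDiff f w₀ τ₀ =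
      (divDiff f w τ - divDiff f w₀ τ) + (divDiff f τ w₀ - divDiff f τ₀ w₀) := by
    rw [divDiff_comm τ w₀, divDiff_comm τ₀ w₀]; ring
  rw [e]
  exact (norm_add_le _ _).trans (add_le_add (norm_divDiff_sub_le_rpow f hβ _ _ _)
    (norm_divDiff_sub_le_rpow f hβ _ _ _))

/-- Averaging over `τ` turns the singular pointwise bound into a Lipschitz bound in `w`, whereas the
uniform bound has only exponent `β`. So `B / A` is a kernel of every exponent `α ≤ 1`; the convexity
argument uses `α = 1`. -/
lemma cint_divDiff_sub_le (hβ₀ : 0 < β) (hβ : β < 1) (w₁ w₂ : Circle) :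
    cint (fun τ => ‖divDiff f w₁ τ - divDiff f w₂ τ‖) ≤
      ‖f‖ * Real.pi * singConst β * dist w₁ w₂ := by
  have hp := Real.pi_pos
  refine (le_abs_self _).trans ?_
  have := norm_cint_le_of_singular (g := fun τ => ‖divDiff f w₁ τ - divDiff f w₂ τ‖)
    (M := ‖f‖ * Real.pi * dist w₁ w₂) (β := β) hβ₀ hβ (by positivity) w₂ (fun τ hτ => by
      rw [norm_norm]
      exact norm_divDiff_sub_le_singular f hβ hτ)
  refine this.trans (le_of_eq ?_)
  ring

end X

/-! ### Elements of the Banach algebra and bounded operators -/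

lemma dist_le_two_mul_rpow {α : ℝ≥0} (hα : α ≤ 1) (p q : Circle) :
    dist p q ≤ 2 * dist p q ^ (α : ℝ) := by
  have hα' : (α : ℝ) ≤ 1 := hα
  rcases (dist_nonneg (x := p) (y := q)).eq_or_lt with h | h
  · rw [← h]; positivity
  · have h1 : dist p q = dist p q ^ (1 - (α : ℝ)) * dist p q ^ (α : ℝ) := by
      rw [← Real.rpow_add h]; simp
    have h2 : dist p q ^ (1 - (α : ℝ)) ≤ 2 := by
      calc dist p q ^ (1 - (α : ℝ)) ≤ 2 ^ (1 - (α : ℝ)) :=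
            Real.rpow_le_rpow dist_nonneg (dist_le_two p q) (by linarith)
        _ ≤ 2 ^ (1 : ℝ) := Real.rpow_le_rpow_of_exponent_le (by norm_num) (by linarith [α.2])
        _ = 2 := by norm_num
    calc dist p q = dist p q ^ (1 - (α : ℝ)) * dist p q ^ (α : ℝ) := h1
      _ ≤ _ := by gcongr

lemma cint_norm_sub_le_of_le {α : ℝ≥0} {F : Circle → Circle → ℂ} {C : ℝ} {w₁ w₂ : Circle}
    (h : ∀ τ, ‖F w₁ τ - F w₂ τ‖ ≤ C * dist w₁ w₂ ^ (α : ℝ)) :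
    cint (fun τ => ‖F w₁ τ - F w₂ τ‖) ≤ 2 * Real.pi * C * dist w₁ w₂ ^ (α : ℝ) := by
  refine (le_abs_self _).trans ?_
  rw [mul_assoc]
  exact norm_cint_le_of_le (g := fun τ => ‖F w₁ τ - F w₂ τ‖) fun τ => by
    rw [norm_norm]; exact h τ

namespace Ker

variable {α : ℝ≥0}

/-- The kernel given by a jointly continuous function. -/
def ofFun (F : Circle → Circle → ℂ) (hF : Continuous (Function.uncurry F)) (C : ℝ) (hC : 0 ≤ C)
    (h : ∀ w₁ w₂, cint (fun τ => ‖F w₁ τ - F w₂ τ‖) ≤ C * dist w₁ w₂ ^ (α : ℝ)) : Ker α :=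
  ofMem (ContinuousMap.curry ⟨_, hF⟩) ⟨⟨C, hC⟩, holderWith_slice h⟩

@[simp] lemma eval_ofFun (F : Circle → Circle → ℂ) (hF : Continuous (Function.uncurry F)) (C : ℝ)
    (hC : 0 ≤ C) (h : ∀ w₁ w₂, cint (fun τ => ‖F w₁ τ - F w₂ τ‖) ≤ C * dist w₁ w₂ ^ (α : ℝ))
    (w τ : Circle) : (ofFun F hF C hC h).eval w τ = F w τ := rfl

/-- The bounded operator given by a family of functions which depends linearly on a parameter. -/
def mkCLM {V : Type*} [NormedAddCommGroup V] [NormedSpace ℝ V] (Φ : V → Circle → Circle → ℂ)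
    (hadd : ∀ f g w τ, Φ (f + g) w τ = Φ f w τ + Φ g w τ)
    (hsmul : ∀ (c : ℝ) f w τ, Φ (c • f) w τ = c * Φ f w τ)
    (hcont : ∀ f, Continuous (Function.uncurry (Φ f))) (M C : ℝ) (hC : 0 ≤ C)
    (hM : ∀ f w τ, ‖Φ f w τ‖ ≤ M * ‖f‖)
    (h : ∀ f w₁ w₂, cint (fun τ => ‖Φ f w₁ τ - Φ f w₂ τ‖) ≤
      C * ‖f‖ * dist w₁ w₂ ^ (α : ℝ)) : V →L[ℝ] Ker α :=
  LinearMap.mkContinuous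
    { toFun := fun f => ofFun (Φ f) (hcont f) (C * ‖f‖) (by positivity) (h f)
      map_add' := fun f g => ext' fun w τ => hadd f g w τ
      map_smul' := fun c f => ext' fun w τ => hsmul c f w τ } (M + C) fun f => by
    rw [add_mul]
    exact norm_le_of_bounds (hM f) (by positivity) (h f)

@[simp] lemma eval_mkCLM {V : Type*} [NormedAddCommGroup V] [NormedSpace ℝ V]
    (Φ : V → Circle → Circle → ℂ) (hadd : ∀ f g w τ, Φ (f + g) w τ = Φ f w τ + Φ g w τ)
    (hsmul : ∀ (c : ℝ) f w τ, Φ (c • f) w τ = c * Φ f w τ)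
    (hcont : ∀ f, Continuous (Function.uncurry (Φ f))) (M C : ℝ) (hC : 0 ≤ C)
    (hM : ∀ f w τ, ‖Φ f w τ‖ ≤ M * ‖f‖)
    (h : ∀ f w₁ w₂, cint (fun τ => ‖Φ f w₁ τ - Φ f w₂ τ‖) ≤
      C * ‖f‖ * dist w₁ w₂ ^ (α : ℝ)) (f : V) (w τ : Circle) :
    (mkCLM Φ hadd hsmul hcont M C hC hM h f).eval w τ = Φ f w τ := rfl

lemma cint_norm_sub_self (F : Circle → ℂ) {C : ℝ} (hC : 0 ≤ C) (w₁ w₂ : Circle) :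
    cint (fun τ => ‖F τ - F τ‖) ≤ C * dist w₁ w₂ ^ (α : ℝ) := by
  simp only [sub_self, norm_zero, cint, intervalIntegral.integral_zero]
  positivity

/-- The kernel `τ`. -/
def varT : Ker α := ofFun (fun _ τ => (τ : ℂ)) (by fun_prop) 0 le_rfl
  fun _ _ => cint_norm_sub_self _ le_rfl _ _

/-- The kernel `τ̄`. -/
def varTInv : Ker α := ofFun (fun _ τ => ((τ⁻¹ : Circle) : ℂ)) (by fun_prop) 0 le_rfl
  fun _ _ => cint_norm_sub_self _ le_rfl _ _

/-- The kernel `w`. -/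
def varW [hα : Fact (α ≤ 1)] : Ker α := ofFun (fun w _ => (w : ℂ)) (by fun_prop) (2 * Real.pi * 2) (by positivity)
  fun w₁ w₂ => cint_norm_sub_le_of_le (F := fun w _ => (w : ℂ)) fun _ => by
    rw [← dist_eq_norm_coe]; exact dist_le_two_mul_rpow hα.out _ _

/-- The kernel `w̄`. -/
def varWInv [hα : Fact (α ≤ 1)] : Ker α := ofFun (fun w _ => ((w⁻¹ : Circle) : ℂ)) (by fun_prop) (2 * Real.pi * 2)
  (by positivity)
  fun w₁ w₂ => cint_norm_sub_le_of_le (F := fun w _ => ((w⁻¹ : Circle) : ℂ)) fun _ => by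
    rw [← dist_eq_norm_coe, dist_inv_circle]; exact dist_le_two_mul_rpow hα.out _ _

@[simp] lemma eval_varT (w τ : Circle) : (varT : Ker α).eval w τ = τ := rfl
@[simp] lemma eval_varTInv (w τ : Circle) : (varTInv : Ker α).eval w τ = (τ⁻¹ : Circle) := rfl
@[simp] lemma eval_varW [Fact (α ≤ 1)] (w τ : Circle) : (varW : Ker α).eval w τ = w := rfl
@[simp] lemma eval_varWInv [Fact (α ≤ 1)] (w τ : Circle) : (varWInv : Ker α).eval w τ = (w⁻¹ : Circle) := rfl

lemma continuous_swap_eval (K : Ker α) : Continuous fun w => K.eval w 1 :=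
  K.continuous_eval.comp (by fun_prop : Continuous fun w : Circle => (w, (1 : Circle)))

/-- Complex conjugation of kernels. -/
def conjK : Ker α →L[ℝ] Ker α :=
  mkCLM (fun K w τ => conj (K.eval w τ)) (fun _ _ _ _ => by simp) (fun _ _ _ _ => by simp)
    (fun K => continuous_conj.comp K.continuous_eval) 1 1 zero_le_one
    (fun K w τ => by rw [RCLike.norm_conj, one_mul]; exact K.norm_eval_le w τ)
    (fun K w₁ w₂ => by
      simp only [← map_sub, RCLike.norm_conj, one_mul]
      exact K.cint_eval_sub_le w₁ w₂)

@[simp] lemma eval_conjK (K : Ker α) (w τ : Circle) :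
    (conjK K).eval w τ = conj (K.eval w τ) := rfl

lemma norm_mean_le_cint (g : Circle → ℂ) :
    ‖mean g‖ ≤ (2 * Real.pi)⁻¹ * cint (fun τ => ‖g τ‖) := by
  have h2 : ‖(2 * Real.pi : ℂ)⁻¹‖ = (2 * Real.pi)⁻¹ := by
    rw [norm_inv, norm_mul, Complex.norm_real, Real.norm_of_nonneg Real.pi_pos.le]
    simp
  have h3 : cint (fun τ => ‖g τ‖) = cint (fun τ : Circle => ‖(τ : ℂ) * g τ‖) := by
    simp only [norm_mul, Circle.norm_coe, one_mul]
  rw [mean_eq_cint, norm_mul, h2, h3]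
  gcongr
  exact intervalIntegral.norm_integral_le_integral_norm Real.two_pi_pos.le

/-- The contour integral of a kernel with respect to `τ`. -/
def meanK : Ker α →L[ℝ] Ker α :=
  mkCLM (fun K w _ => mean (K.eval w))
    (fun K K' w _ => mean_add (K.continuous_eval_right w) (K'.continuous_eval_right w))
    (fun c K w _ => mean_smul c _)
    (fun K => (continuous_mean_param K.continuous_eval).comp continuous_fst)
    1 1 zero_le_one
    (fun K w τ => by rw [one_mul]; exact norm_mean_le_of_le fun τ => K.norm_eval_le w τ)
    (fun K w₁ w₂ => by
      rw [cint_const, ← mean_sub (K.continuous_eval_right w₁) (K.continuous_eval_right w₂),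
        one_mul, smul_eq_mul]
      have h := norm_mean_le_cint fun τ => K.eval w₁ τ - K.eval w₂ τ
      rw [inv_mul_eq_div, le_div_iff₀ Real.two_pi_pos, mul_comm] at h
      exact h.trans (K.cint_eval_sub_le w₁ w₂))

@[simp] lemma eval_meanK (K : Ker α) (w τ : Circle) :
    (meanK K).eval w τ = mean (K.eval w) := rfl

/-- The contour integral with respect to `w`, as a linear map. -/
def meanWLin : Ker α →ₗ[ℝ] ℂ where
  toFun K := mean (fun w => K.eval w 1)
  map_add' K K' := mean_add K.continuous_swap_eval K'.continuous_swap_eval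
  map_smul' c K := mean_smul c fun w => K.eval w 1

lemma meanWLin_apply (K : Ker α) : meanWLin K = mean (fun w => K.eval w 1) := rfl

lemma norm_meanWLin_le (K : Ker α) : ‖meanWLin K‖ ≤ 1 * ‖K‖ := by
  rw [one_mul, meanWLin_apply]
  exact norm_mean_le_of_le fun w => K.norm_eval_le w 1

/-- The contour integral with respect to `w`. -/
def meanW : Ker α →L[ℝ] ℂ := meanWLin.mkContinuous 1 norm_meanWLin_le

@[simp] lemma meanW_apply (K : Ker α) : meanW K = mean (fun w => K.eval w 1) := rfl

end Ker

namespace X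

open Ker

variable {α β : ℝ≥0}

lemma add_apply (f g : X β) (w : Circle) : (f + g) w = f w + g w := rfl

lemma smul_apply (c : ℝ) (f : X β) (w : Circle) : (c • f) w = c * f w := rfl

lemma deriv_add (f g : X β) (w : Circle) :
    circleDeriv (f + g : X β) w = circleDeriv f w + circleDeriv g w := by
  rw [coe_add, circleDeriv_add f.differentiable g.differentiable]; rfl

lemma deriv_smul (c : ℝ) (f : X β) (w : Circle) :
    circleDeriv (c • f : X β) w = c * circleDeriv f w := by
  rw [coe_smul, circleDeriv_smul c f.differentiable]; rfl

lemma divDiff_add (f g : X β) (w τ : Circle) :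
    divDiff (f + g : X β) w τ = divDiff f w τ + divDiff g w τ := by
  rcases eq_or_ne τ w with rfl | h
  · simp only [divDiff_self, deriv_add]
  · simp only [divDiff_of_ne h, add_apply]; ring

lemma divDiff_smul (c : ℝ) (f : X β) (w τ : Circle) :
    divDiff (c • f : X β) w τ = c * divDiff f w τ := by
  rcases eq_or_ne τ w with rfl | h
  · simp only [divDiff_self, deriv_smul]
  · simp only [divDiff_of_ne h, smul_apply]; ring

/-- The divided difference of an element of `X` as a kernel. -/
def kB [hα : Fact (α ≤ 1)] [hβ₀ : Fact (0 < β)] [hβ₁ : Fact (β < 1)] : X β →L[ℝ] Ker α :=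
  mkCLM (fun f => divDiff f) divDiff_add divDiff_smul
    (fun f => continuous_divDiff f hβ₀.out hβ₁.out) (Real.pi / 2) (Real.pi * singConst β * 2)
    (by have := singConst_nonneg β; positivity)
    (fun f w τ => by rw [mul_comm]; exact norm_divDiff_le f w τ)
    (fun f w₁ w₂ => by
      refine (cint_divDiff_sub_le f hβ₀.out hβ₁.out w₁ w₂).trans ?_
      have h1 := dist_le_two_mul_rpow hα.out w₁ w₂
      have h2 := singConst_nonneg β
      calc _ ≤ ‖f‖ * Real.pi * singConst β * (2 * dist w₁ w₂ ^ (α : ℝ)) := by gcongr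
        _ = _ := by ring)

@[simp] lemma eval_kB [Fact (α ≤ 1)] [Fact (0 < β)] [Fact (β < 1)] (f : X β)
    (w τ : Circle) : (kB f : Ker α).eval w τ = divDiff f w τ := rfl

/-- The kernel `f(τ)`. -/
def kFt : X β →L[ℝ] Ker α :=
  mkCLM (fun f _ τ => f τ) (fun _ _ _ _ => rfl) (fun _ _ _ _ => rfl)
    (fun f => f.continuous.comp continuous_snd) 1 0 le_rfl
    (fun f _ τ => by rw [one_mul]; exact norm_apply_le f τ)
    (fun f w₁ w₂ => cint_norm_sub_self (fun τ => f τ) (by simp) w₁ w₂)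

@[simp] lemma eval_kFt (f : X β) (w τ : Circle) : (kFt f : Ker α).eval w τ = f τ := rfl

/-- The kernel `f(τ̄)`. -/
def kFtInv : X β →L[ℝ] Ker α :=
  mkCLM (fun f _ τ => f τ⁻¹) (fun _ _ _ _ => rfl) (fun _ _ _ _ => rfl)
    (fun f => f.continuous.comp continuous_snd.inv) 1 0 le_rfl
    (fun f _ τ => by rw [one_mul]; exact norm_apply_le f τ⁻¹)
    (fun f w₁ w₂ => cint_norm_sub_self (fun τ => f τ⁻¹) (by simp) w₁ w₂)

@[simp] lemma eval_kFtInv (f : X β) (w τ : Circle) : (kFtInv f : Ker α).eval w τ = f τ⁻¹ := rfl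

/-- The kernel `f'(τ)`. -/
def kDt [hβ₀ : Fact (0 < β)] : X β →L[ℝ] Ker α :=
  mkCLM (fun f _ τ => circleDeriv f τ) (fun f g _ τ => deriv_add f g τ)
    (fun c f _ τ => deriv_smul c f τ)
    (fun f => (f.continuous_deriv hβ₀.out).comp continuous_snd) 1 0 le_rfl
    (fun f _ τ => by rw [one_mul]; exact norm_deriv_le f τ)
    (fun f w₁ w₂ => cint_norm_sub_self (fun τ => circleDeriv f τ) (by simp) w₁ w₂)

@[simp] lemma eval_kDt [Fact (0 < β)] (f : X β) (w τ : Circle) :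
    (kDt f : Ker α).eval w τ = circleDeriv f τ := rfl

lemma norm_sub_le_rpow (hα : α ≤ 1) (f : X β) (p q : Circle) :
    ‖f p - f q‖ ≤ Real.pi * ‖f‖ * dist p q ^ (α : ℝ) := by
  refine (norm_sub_le' f p q).trans ?_
  have h1 := dist_le_two_mul_rpow hα p q
  have hp := Real.pi_pos
  calc _ ≤ ‖f‖ * (Real.pi / 2) * (2 * dist p q ^ (α : ℝ)) := by gcongr
    _ = _ := by ring

/-- The kernel `f(w)`. -/
def kFw [hα : Fact (α ≤ 1)] : X β →L[ℝ] Ker α :=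
  mkCLM (fun f w _ => f w) (fun _ _ _ _ => rfl) (fun _ _ _ _ => rfl)
    (fun f => f.continuous.comp continuous_fst) 1 (2 * Real.pi * Real.pi) (by positivity)
    (fun f w _ => by rw [one_mul]; exact norm_apply_le f w)
    (fun f w₁ w₂ => by
      rw [mul_assoc (2 * Real.pi)]
      exact cint_norm_sub_le_of_le (F := fun w _ => f w) fun _ =>
        norm_sub_le_rpow hα.out f w₁ w₂)

@[simp] lemma eval_kFw [Fact (α ≤ 1)] (f : X β) (w τ : Circle) :
    (kFw f : Ker α).eval w τ = f w := rfl

/-- The kernel `f(w̄)`. -/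
def kFwInv [hα : Fact (α ≤ 1)] : X β →L[ℝ] Ker α :=
  mkCLM (fun f w _ => f w⁻¹) (fun _ _ _ _ => rfl) (fun _ _ _ _ => rfl)
    (fun f => f.continuous.comp continuous_fst.inv) 1 (2 * Real.pi * Real.pi) (by positivity)
    (fun f w _ => by rw [one_mul]; exact norm_apply_le f w⁻¹)
    (fun f w₁ w₂ => by
      rw [mul_assoc (2 * Real.pi)]
      exact cint_norm_sub_le_of_le (F := fun w _ => f w⁻¹) fun _ => by
        rw [← dist_inv_circle w₁ w₂]
        exact norm_sub_le_rpow hα.out f w₁⁻¹ w₂⁻¹)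

@[simp] lemma eval_kFwInv [Fact (α ≤ 1)] (f : X β) (w τ : Circle) :
    (kFwInv f : Ker α).eval w τ = f w⁻¹ := rfl

/-- The kernel `f'(w)`. -/
def kDw [hβ₀ : Fact (0 < β)] : X β →L[ℝ] Ker β :=
  mkCLM (fun f w _ => circleDeriv f w) (fun f g w _ => deriv_add f g w)
    (fun c f w _ => deriv_smul c f w)
    (fun f => (f.continuous_deriv hβ₀.out).comp continuous_fst) 1 (2 * Real.pi) (by positivity)
    (fun f w _ => by rw [one_mul]; exact norm_deriv_le f w)
    (fun f w₁ w₂ => cint_norm_sub_le_of_le (F := fun w _ => circleDeriv f w) fun _ =>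
      norm_deriv_sub_le f w₁ w₂)

@[simp] lemma eval_kDw [Fact (0 < β)] (f : X β) (w τ : Circle) :
    (kDw f).eval w τ = circleDeriv f w := rfl

end X

/-! ### Fourier coefficients -/

lemma continuous_zpow_coe (n : ℤ) : Continuous fun w : Circle => (w : ℂ) ^ n :=
  Continuous.zpow₀ (by fun_prop) n fun w => Or.inl (Circle.coe_ne_zero w)

lemma fourierCoef_eq_cint (g : Circle → ℂ) (n : ℤ) :
    fourierCoef g n = (2 * Real.pi : ℂ)⁻¹ * cint (fun w => g w * (w : ℂ) ^ (-n)) := by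
  rw [fourierCoef, mean_eq_cint]
  congr 2
  funext w
  rw [zpow_sub_one₀ (Circle.coe_ne_zero w)]
  have := Circle.coe_ne_zero w
  field_simp

/-- A rotation by `σ` multiplies the integral by `σ ^ n` and preserves it; for `σ = exp (iπ/n)` this
factor is `-1`. -/
lemma cint_zpow {n : ℤ} (hn : n ≠ 0) : cint (fun w => (w : ℂ) ^ n) = 0 := by
  obtain ⟨σ, hσ⟩ : ∃ σ : Circle, (σ : ℂ) ^ n ≠ 1 := by
    refine ⟨Circle.exp (Real.pi / n), ?_⟩
    rw [← Circle.coe_zpow, ← Circle.exp_zsmul, zsmul_eq_mul,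
      mul_div_cancel₀ _ (by exact_mod_cast hn)]
    intro h
    exact Circle.exp_pi_ne_one (Circle.ext h)
  have h := cint_mul_left (fun w : Circle => (w : ℂ) ^ n) σ
  simp only [Circle.coe_mul, mul_zpow] at h
  rw [cint_const_mul] at h
  have h2 : ((σ : ℂ) ^ n - 1) * cint (fun w : Circle => (w : ℂ) ^ n) = 0 := by
    rw [sub_mul, h]; ring
  exact (mul_eq_zero.1 h2).resolve_left (sub_ne_zero.2 hσ)

lemma cint_one : cint (fun _ : Circle => (1 : ℂ)) = 2 * Real.pi := by
  rw [cint_const]; simp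

/-- A continuous function with vanishing Fourier coefficients vanishes. -/
lemma eq_zero_of_fourierCoef {g : Circle → ℂ} (hg : Continuous g)
    (h : ∀ n, fourierCoef g n = 0) (w : Circle) : g w = 0 := by
  have : Fact (0 < 2 * Real.pi) := ⟨Real.two_pi_pos⟩
  let G : C(AddCircle (2 * Real.pi), ℂ) := ⟨fun x => g (AddCircle.toCircle x),
    hg.comp AddCircle.continuous_toCircle⟩
  have hG : ∀ n, fourierCoeff G n = 0 := fun n => by
    rw [fourierCoeff_eq_intervalIntegral _ n 0]
    have h1 := h n
    rw [fourierCoef_eq_cint] at h1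
    have h2 : cint (fun w => g w * (w : ℂ) ^ (-n)) = 0 := by
      refine (mul_eq_zero.1 h1).resolve_left ?_
      have : (Real.pi : ℂ) ≠ 0 := by exact_mod_cast Real.pi_ne_zero
      simp [this]
    have h3 : ∀ x : ℝ, (fourier (-n) (x : AddCircle (2 * Real.pi)) • G x : ℂ) =
        g (Circle.exp x) * (Circle.exp x : ℂ) ^ (-n) := fun x => by
      have e : (AddCircle.toCircle (x : AddCircle (2 * Real.pi))) = Circle.exp x := by
        rw [AddCircle.toCircle_apply_mk, div_self Real.two_pi_pos.ne', one_mul]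
      rw [fourier_apply, AddCircle.toCircle_zsmul, e, Circle.coe_zpow, smul_eq_mul, mul_comm]
      change g (AddCircle.toCircle (x : AddCircle (2 * Real.pi))) * _ = _
      rw [e]
    simp only [h3, zero_add]
    rw [cint] at h2
    rw [h2, smul_zero]
  -- With all coefficients zero the Fourier series is trivially summable, and therefore represents
  -- `G` pointwise.
  have hs : Summable (fourierCoeff G) := by
    have : fourierCoeff G = 0 := funext hG
    rw [this]; exact summable_zero
  obtain ⟨θ, rfl⟩ := Circle.exp_surjective w
  have h4 := has_pointwise_sum_fourier_series_of_summable hs (θ : AddCircle (2 * Real.pi))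
  simp only [hG, zero_smul] at h4
  have h5 := h4.unique hasSum_zero
  have e : (AddCircle.toCircle (θ : AddCircle (2 * Real.pi))) = Circle.exp θ := by
    rw [AddCircle.toCircle_apply_mk, div_self Real.two_pi_pos.ne', one_mul]
  rw [← e]
  exact h5

lemma fourierCoef_comp_inv (g : Circle → ℂ) (n : ℤ) :
    fourierCoef (fun w => g w⁻¹) n = fourierCoef g (-n) := by
  rw [fourierCoef_eq_cint, fourierCoef_eq_cint, ← cint_inv]
  congr 2
  funext w
  simp

lemma fourierCoef_conj (g : Circle → ℂ) (n : ℤ) :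
    fourierCoef (fun w => conj (g w)) n = conj (fourierCoef g (-n)) := by
  rw [fourierCoef_eq_cint, fourierCoef_eq_cint, map_mul, ← cint_conj]
  congr 2
  · simp [Complex.conj_ofNat]
  · funext w
    rw [map_mul, map_zpow₀, ← Circle.coe_inv_eq_conj, Circle.coe_inv]
    simp

lemma fourierCoef_sub {f g : Circle → ℂ} (hf : Continuous f) (hg : Continuous g) (n : ℤ) :
    fourierCoef (fun w => f w - g w) n = fourierCoef f n - fourierCoef g n := by
  simp only [fourierCoef, sub_mul]
  exact mean_sub (continuous_mul_zpow hf _) (continuous_mul_zpow hg _)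

lemma circleDeriv_mul_zpow {f : Circle → ℂ} (hf : CircleDifferentiable f) (n : ℤ) (w : Circle) :
    HasDerivAt (fun t : ℝ => f (w * Circle.exp t) * ((w * Circle.exp t : Circle) : ℂ) ^ n)
      (I * w * (circleDeriv f w * (w : ℂ) ^ n + n * f w * (w : ℂ) ^ (n - 1))) 0 := by
  have h1 := hf.hasDerivAt w 0
  have h2 := hasDerivAt_coe_exp w 0
  have h3 := (hasDerivAt_zpow n ((w * Circle.exp 0 : Circle) : ℂ)
    (Or.inl (Circle.coe_ne_zero _))).comp (0 : ℝ) h2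
  have h4 := h1.mul h3
  simp only [Circle.exp_zero, mul_one, Function.comp_def] at h4
  have e : I * w * (circleDeriv f w * (w : ℂ) ^ n + n * f w * (w : ℂ) ^ (n - 1)) =
    I * w * circleDeriv f w * (w : ℂ) ^ n + f w * (n * (w : ℂ) ^ (n - 1) * (I * w)) := by ring
  rw [e]
  exact h4

/-- The Fourier coefficients of the derivative. -/
lemma fourierCoef_circleDeriv {f : Circle → ℂ} (hf : CircleDifferentiable f)
    (hc : Continuous (circleDeriv f)) (n : ℤ) :
    fourierCoef (circleDeriv f) n = (n + 1) * fourierCoef f (n + 1) := by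
  have hd : ∀ w, circleDeriv (fun w : Circle => f w * (w : ℂ) ^ (-n - 1)) w =
      circleDeriv f w * (w : ℂ) ^ (-n - 1) + (-n - 1 : ℤ) * f w * (w : ℂ) ^ (-n - 1 - 1) :=
    fun w => circleDeriv_eq_of_hasDerivAt (circleDeriv_mul_zpow hf _ w)
  have hcd : CircleDifferentiable (fun w : Circle => f w * (w : ℂ) ^ (-n - 1)) := fun w =>
    (circleDeriv_mul_zpow hf (-n - 1) w).differentiableAt
  have c1 := continuous_mul_zpow hc (-n - 1)
  have c2 : Continuous fun w : Circle => ((-n - 1 : ℤ) : ℂ) * (f w * (w : ℂ) ^ (-n - 1 - 1)) :=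
    continuous_const.mul (continuous_mul_zpow hf.continuous _)
  -- The derivative of `f(w) w ^ (-n - 1)` has mean zero; its two terms give the two coefficients.
  have h := cint_deriv hcd (by
    rw [funext hd]; simp only [mul_assoc]; exact c1.add c2)
  have h2 : mean (circleDeriv (fun w : Circle => f w * (w : ℂ) ^ (-n - 1))) = 0 := by
    rw [mean_eq_cint, h, mul_zero]
  rw [funext hd] at h2
  simp only [mul_assoc] at h2
  rw [mean_add c1 c2, mean_const_mul] at h2
  rw [fourierCoef, fourierCoef, eq_neg_of_add_eq_zero_left h2]
  have e : -(n + 1) - 1 = -n - 1 - 1 := by ring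
  rw [e]
  push_cast
  ring

/-! ### Difference quotients along rotations -/

/-- Fubini's theorem with a majorant depending on the rotation angle alone; the exceptional angle `s
= 0` is null. -/
lemma cint_swap {F : ℝ → Circle → ℂ} {φ : ℝ → ℝ}
    (hF : Measurable fun p : ℝ × ℝ => F p.1 (Circle.exp p.2))
    (hφ : IntervalIntegrable φ volume (-Real.pi) Real.pi)
    (h : ∀ s, |s| ≤ Real.pi → s ≠ 0 → ∀ w, ‖F s w‖ ≤ φ s) :
    cint (fun w => ∫ s in (-Real.pi)..Real.pi, F s w) =
      ∫ s in (-Real.pi)..Real.pi, cint (F s) := by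
  have hπ : -Real.pi ≤ Real.pi := by linarith [Real.pi_pos]
  simp only [cint]
  rw [intervalIntegral_intervalIntegral_swap]
  rw [uIoc_of_le hπ, uIoc_of_le Real.two_pi_pos.le]
  have hm : Measurable (Function.uncurry fun θ s : ℝ => F s (Circle.exp θ)) :=
    hF.comp measurable_swap
  have hb : Integrable (fun p : ℝ × ℝ => φ p.2) ((volume.restrict (Ioc 0 (2 * Real.pi))).prod
      (volume.restrict (Ioc (-Real.pi) Real.pi))) := by
    exact Integrable.comp_snd hφ.1 _
  rw [IntegrableOn, Measure.volume_eq_prod, ← Measure.prod_restrict]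
  refine hb.mono' hm.aestronglyMeasurable ?_
  have h1 : ∀ᵐ s ∂(volume.restrict (Ioc (-Real.pi) Real.pi)), ∀ w, ‖F s w‖ ≤ φ s := by
    filter_upwards [ae_restrict_mem measurableSet_Ioc,
      ae_restrict_of_ae (compl_mem_ae_iff.2 (measure_singleton (0 : ℝ)))] with s hs hs' w
    exact h s (abs_le.2 ⟨hs.1.le, hs.2⟩) hs' w
  filter_upwards [Measure.quasiMeasurePreserving_snd.ae h1] with p hp
  exact hp _

/-- The integral of the difference quotients along rotations, with the weight `σ ^ k`. -/
def rotDiff (k : ℤ) (g : Circle → ℂ) (w : Circle) : ℂ :=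
  cint fun σ => (σ : ℂ) ^ k * ((g (σ * w) - g w) / ((σ : ℂ) - 1))

lemma norm_rotDiff_kernel_le {g : Circle → ℂ} {γ C : ℝ}
    (hg : ∀ p q, ‖g p - g q‖ ≤ C * dist p q ^ γ) (k : ℤ) {σ : Circle} (hσ : σ ≠ 1) (w : Circle) :
    ‖(σ : ℂ) ^ k * ((g (σ * w) - g w) / ((σ : ℂ) - 1))‖ ≤ C * dist σ 1 ^ (γ - 1) := by
  have hd : 0 < dist σ 1 := dist_pos.2 hσ
  have h1 := hg (σ * w) w
  have h2 : dist (σ * w) w = dist σ 1 := by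
    rw [mul_comm]
    have := dist_mul_left_circle w σ 1
    rwa [mul_one] at this
  have h3 : ‖(σ : ℂ) - 1‖ = dist σ 1 := by rw [dist_eq_norm_coe, Circle.coe_one]
  rw [h2] at h1
  rw [norm_mul, norm_zpow, Circle.norm_coe, one_zpow, one_mul, norm_div, h3, div_le_iff₀ hd,
    Real.rpow_sub_one hd.ne', mul_assoc, div_mul_cancel₀ _ hd.ne']
  exact h1

lemma exp_ne_one {s : ℝ} (hs : |s| ≤ Real.pi) (hs0 : s ≠ 0) : Circle.exp s ≠ 1 := by
  intro h
  have := abs_le_dist_exp hs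
  rw [h, dist_self, mul_zero] at this
  exact hs0 (abs_nonpos_iff.1 this)

lemma dist_exp_rpow_le {r s : ℝ} (hs : |s| ≤ Real.pi) (hs0 : s ≠ 0) (hr : r ≤ 0) :
    dist (Circle.exp s) 1 ^ r ≤ (2 / Real.pi) ^ r * |s| ^ r := by
  have hp := Real.pi_pos
  have hs1 : 0 < |s| := abs_pos.2 hs0
  rw [← Real.mul_rpow (by positivity) hs1.le]
  exact Real.rpow_le_rpow_of_nonpos (by positivity) (two_div_pi_mul_le hs) hr

/-- A rotation by `σ` multiplies the `n`-th coefficient by `σ ^ n`. After exchanging the integrals,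
which the Hölder bound justifies, the operator is thus a Fourier multiplier. -/
lemma fourierCoef_rotDiff {g : Circle → ℂ} (hgc : Continuous g) {γ C : ℝ} (hγ : 0 < γ)
    (hγ₁ : γ < 1) (hC : 0 ≤ C) (hg : ∀ p q, ‖g p - g q‖ ≤ C * dist p q ^ γ) (k n : ℤ) :
    fourierCoef (rotDiff k g) n =
      fourierCoef g n * cint (fun σ => (σ : ℂ) ^ k * (((σ : ℂ) ^ n - 1) / ((σ : ℂ) - 1))) := by
  rw [fourierCoef_eq_cint, fourierCoef_eq_cint, mul_assoc]
  congr 1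
  have h1 : (fun w => rotDiff k g w * (w : ℂ) ^ (-n)) = fun w : Circle =>
      ∫ s in (-Real.pi)..Real.pi, (Circle.exp s : ℂ) ^ k *
        ((g (Circle.exp s * w) - g w) / ((Circle.exp s : ℂ) - 1)) * (w : ℂ) ^ (-n) := by
    funext w
    rw [rotDiff, cint_eq_symm, intervalIntegral.integral_mul_const]
  rw [h1, cint_swap (φ := fun s => C * ((2 / Real.pi) ^ (γ - 1) * |s| ^ (γ - 1)))]
  · rw [cint_eq_symm (fun σ : Circle => (σ : ℂ) ^ k * (((σ : ℂ) ^ n - 1) / ((σ : ℂ) - 1))),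
      ← intervalIntegral.integral_const_mul]
    refine intervalIntegral.integral_congr fun s _ => ?_
    have h2 : ∀ w : Circle, (Circle.exp s : ℂ) ^ k *
        ((g (Circle.exp s * w) - g w) / ((Circle.exp s : ℂ) - 1)) * (w : ℂ) ^ (-n) =
        (Circle.exp s : ℂ) ^ k / ((Circle.exp s : ℂ) - 1) *
        ((Circle.exp s : ℂ) ^ n * (g (Circle.exp s * w) * ((Circle.exp s * w : Circle) : ℂ) ^ (-n))
          - g w * (w : ℂ) ^ (-n)) := fun w => by
      rw [Circle.coe_mul, mul_zpow, zpow_neg (Circle.exp s : ℂ)]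
      have h3 : (Circle.exp s : ℂ) ^ n ≠ 0 := zpow_ne_zero _ (Circle.coe_ne_zero _)
      field_simp
    simp only [h2]
    have hc := continuous_mul_zpow hgc (-n)
    have hc2 : Continuous fun w : Circle => (Circle.exp s : ℂ) ^ n *
        (g (Circle.exp s * w) * ((Circle.exp s * w : Circle) : ℂ) ^ (-n)) :=
      continuous_const.mul (hc.comp (continuous_const_mul _))
    rw [cint_const_mul, cint_sub hc2 hc,
      cint_const_mul, cint_mul_left (fun w : Circle => g w * (w : ℂ) ^ (-n))]
    ring
  · have hm1 : Measurable fun p : ℝ × ℝ => g (Circle.exp p.1 * Circle.exp p.2) -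
        g (Circle.exp p.2) := Continuous.measurable (by fun_prop)
    have hm2 : Measurable fun p : ℝ × ℝ => (Circle.exp p.1 : ℂ) - 1 :=
      Continuous.measurable (by fun_prop)
    have hm3 : Measurable fun p : ℝ × ℝ => (Circle.exp p.1 : ℂ) ^ k :=
      Continuous.measurable ((continuous_zpow_coe k).comp (by fun_prop))
    have hm4 : Measurable fun p : ℝ × ℝ => (Circle.exp p.2 : ℂ) ^ (-n) :=
      Continuous.measurable ((continuous_zpow_coe (-n)).comp (by fun_prop))
    exact (hm3.mul (hm1.div hm2)).mul hm4
  · exact ((intervalIntegrable_abs_rpow (by linarith) _ _).const_mul _).const_mul _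
  · intro s hs hs0 w
    rw [norm_mul, norm_zpow _ (-n), Circle.norm_coe, one_zpow, mul_one]
    refine (norm_rotDiff_kernel_le hg k (exp_ne_one hs hs0) w).trans ?_
    exact mul_le_mul_of_nonneg_left (dist_exp_rpow_le hs hs0 (by linarith)) hC

lemma cint_sum_zpow {ι : Type*} (s : Finset ι) (e : ι → ℤ) :
    cint (fun σ => ∑ j ∈ s, (σ : ℂ) ^ e j) = ∑ j ∈ s, cint (fun σ => (σ : ℂ) ^ e j) :=
  intervalIntegral.integral_finsetSum fun j _ =>
    intervalIntegrable_circle (continuous_zpow_coe (e j)) _ _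

lemma cint_geom_nonneg (k : ℤ) (n : ℕ) :
    cint (fun σ => (σ : ℂ) ^ k * (((σ : ℂ) ^ (n : ℤ) - 1) / ((σ : ℂ) - 1))) =
      ∑ j ∈ Finset.range n, cint (fun σ => (σ : ℂ) ^ (k + j)) := by
  rw [← cint_sum_zpow]
  refine cint_congr_ne 1 fun σ hσ => ?_
  have h0 : (σ : ℂ) ≠ 1 := fun h => hσ (Circle.ext h)
  rw [zpow_natCast, ← geom_sum_eq h0, Finset.mul_sum]
  refine Finset.sum_congr rfl fun j _ => ?_
  rw [zpow_add₀ (Circle.coe_ne_zero σ), zpow_natCast]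

lemma cint_geom_neg (k : ℤ) (m : ℕ) :
    cint (fun σ => (σ : ℂ) ^ k * (((σ : ℂ) ^ (-m : ℤ) - 1) / ((σ : ℂ) - 1))) =
      -∑ j ∈ Finset.range m, cint (fun σ => (σ : ℂ) ^ (k - m + j)) := by
  have h1 := cint_const_mul (-1) (fun σ : Circle =>
    ∑ j ∈ Finset.range m, (σ : ℂ) ^ (k - m + j))
  rw [← cint_sum_zpow, neg_eq_neg_one_mul (cint _), ← h1]
  refine cint_congr_ne 1 fun σ hσ => ?_
  have h0 : (σ : ℂ) ≠ 1 := fun h => hσ (Circle.ext h)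
  have h2 : ∑ j ∈ Finset.range m, (σ : ℂ) ^ (k - m + j) =
      (σ : ℂ) ^ (k - m) * (((σ : ℂ) ^ m - 1) / ((σ : ℂ) - 1)) := by
    rw [← geom_sum_eq h0, Finset.mul_sum]
    refine Finset.sum_congr rfl fun j _ => ?_
    rw [zpow_add₀ (Circle.coe_ne_zero σ), zpow_natCast]
  have h3 : (σ : ℂ) ^ m ≠ 0 := pow_ne_zero _ (Circle.coe_ne_zero σ)
  have h4 : (σ : ℂ) - 1 ≠ 0 := sub_ne_zero.2 h0
  rw [h2, zpow_sub₀ (Circle.coe_ne_zero σ), zpow_neg, zpow_natCast]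
  field_simp
  ring

/-- The geometric sum has the exponents `1, …, n`, none of them zero. -/
lemma cint_geom_one_nonneg (n : ℕ) :
    cint (fun σ => (σ : ℂ) ^ (1 : ℤ) * (((σ : ℂ) ^ (n : ℤ) - 1) / ((σ : ℂ) - 1))) = 0 := by
  rw [cint_geom_nonneg]
  exact Finset.sum_eq_zero fun j _ => cint_zpow (by omega)

/-- Here the exponents are `-m, …, -1`, again without zero. -/
lemma cint_geom_zero_neg (m : ℕ) :
    cint (fun σ => (σ : ℂ) ^ (0 : ℤ) * (((σ : ℂ) ^ (-m : ℤ) - 1) / ((σ : ℂ) - 1))) = 0 := by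
  rw [cint_geom_neg, Finset.sum_eq_zero, neg_zero]
  intro j hj
  have := Finset.mem_range.1 hj
  exact cint_zpow (by omega)

/-- The exponents are `1 - m, …, 0`; only the last one, `j = m - 1`, contributes. -/
lemma cint_geom_one_neg {m : ℕ} (hm : m ≠ 0) :
    cint (fun σ => (σ : ℂ) ^ (1 : ℤ) * (((σ : ℂ) ^ (-m : ℤ) - 1) / ((σ : ℂ) - 1))) =
      -(2 * Real.pi) := by
  rw [cint_geom_neg]
  congr 1
  have h1 : m - 1 ∈ Finset.range m := Finset.mem_range.2 (by omega)
  rw [Finset.sum_eq_single_of_mem _ h1 fun j _ hj => cint_zpow (by omega)]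
  have e : (1 : ℤ) - m + (m - 1 : ℕ) = 0 := by omega
  simp only [e, zpow_zero]
  exact cint_one

/-! ### Consequences for the elements of `X` -/

namespace X

variable {β : ℝ≥0} (f : X β)

lemma fourierCoef_nonneg (n : ℕ) : fourierCoef f n = 0 := (incl_mem f).2.2.1 n

lemma fourierCoef_im (n : ℤ) : (fourierCoef f n).im = 0 := by
  rcases Int.eq_nat_or_neg n with ⟨k, rfl | rfl⟩
  · rw [fourierCoef_nonneg]; rfl
  · exact (incl_mem f).2.2.2 k

/-- Both sides have the same Fourier coefficients, because those of `f` are real. -/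
lemma apply_inv (w : Circle) : f w⁻¹ = conj (f w) := by
  have hc1 : Continuous fun w : Circle => f w⁻¹ := f.continuous.comp continuous_inv
  have hc2 : Continuous fun w : Circle => conj (f w) := continuous_conj.comp f.continuous
  refine sub_eq_zero.1 (eq_zero_of_fourierCoef (g := fun w => f w⁻¹ - conj (f w))
    (hc1.sub hc2) (fun n => ?_) w)
  rw [fourierCoef_sub hc1 hc2, fourierCoef_comp_inv, fourierCoef_conj, sub_eq_zero]
  exact (Complex.conj_eq_iff_im.2 (fourierCoef_im f _)).symm

lemma deriv_inv (w : Circle) : circleDeriv f w⁻¹ = conj (circleDeriv f w) := by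
  refine circleDeriv_eq_of_hasDerivAt ?_
  have h1 : HasDerivAt (fun t : ℝ => f (w * Circle.exp (-t)))
      (-(I * w * circleDeriv f w)) 0 := by
    have h := f.differentiable.hasDerivAt w 0
    simp only [Circle.exp_zero, mul_one] at h
    have h2 := HasDerivAt.scomp (0 : ℝ) (g₁ := fun t : ℝ => f (w * Circle.exp t))
      (h := fun t : ℝ => -t) (h' := -1) (by rw [neg_zero]; exact h) (hasDerivAt_neg _)
    rw [neg_one_smul] at h2
    exact h2
  have h3 := (conjCLE : ℂ →L[ℝ] ℂ).hasFDerivAt.comp_hasDerivAt (0 : ℝ) h1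
  have e : (fun t : ℝ => f (w⁻¹ * Circle.exp t)) =
      (conjCLE : ℂ →L[ℝ] ℂ) ∘ fun t : ℝ => f (w * Circle.exp (-t)) := by
    funext t
    simp only [Function.comp_apply]
    change _ = conj (f (w * Circle.exp (-t)))
    rw [← apply_inv, mul_inv, Circle.exp_neg, inv_inv]
  rw [e]
  have e2 : I * ((w⁻¹ : Circle) : ℂ) * conj (circleDeriv f w) =
      (conjCLE : ℂ →L[ℝ] ℂ) (-(I * w * circleDeriv f w)) := by
    change _ = conj (-(I * w * circleDeriv f w))
    rw [map_neg, map_mul, map_mul, conj_I, ← Circle.coe_inv_eq_conj]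
    ring
  rw [e2]
  exact h3

/-- Differentiation lowers frequencies by one, so `f'` has only frequencies at most `-2`. -/
lemma fourierCoef_deriv (hβ : 0 < β) (n : ℤ) (hn : -1 ≤ n) :
    fourierCoef (circleDeriv f) n = 0 := by
  rw [fourierCoef_circleDeriv f.differentiable (f.continuous_deriv hβ)]
  obtain ⟨k, hk⟩ := Int.eq_ofNat_of_zero_le (by omega : 0 ≤ n + 1)
  rw [hk, fourierCoef_nonneg, mul_zero]

/-- The divided difference has mean zero in each variable. -/
lemma cint_divDiff (hβ₀ : 0 < β) (hβ₁ : β < 1) (w : Circle) : cint (divDiff f w) = 0 := by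
  -- Substituting `τ = σ w` makes the mean of the divided difference a rotation multiplier with
  -- weight `σ ^ 0`. This multiplier kills the negative frequencies, and `f` has no others.
  have h1 : ∀ w : Circle, rotDiff 0 f w = w * cint (divDiff f w) := fun w => by
    rw [← cint_const_mul, ← cint_mul_right _ w, rotDiff]
    refine cint_congr_ne 1 fun σ hσ => ?_
    have h2 : σ * w ≠ w := fun h => hσ (by simpa using h)
    have h3 := coe_sub_ne_zero hσ
    have h4 := Circle.coe_ne_zero w
    rw [divDiff_of_ne h2, Circle.coe_mul, zpow_zero, one_mul]
    rw [Circle.coe_one] at h3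
    have e : (σ : ℂ) * w - w = (σ - 1) * w := by ring
    rw [e]
    field_simp
  have hc : Continuous (rotDiff 0 f) := by
    rw [funext h1]
    exact Continuous.mul (by fun_prop) (continuous_cint_param (continuous_divDiff f hβ₀ hβ₁))
  have h2 : ∀ n, fourierCoef (rotDiff 0 f) n = 0 := fun n => by
    have hh : ∀ p q, ‖f p - f q‖ ≤ Real.pi * ‖f‖ * dist p q ^ (β : ℝ) :=
      norm_sub_le_rpow hβ₁.le f
    rw [fourierCoef_rotDiff f.continuous (γ := β) hβ₀ hβ₁ (by positivity) hh]
    rcases Int.eq_nat_or_neg n with ⟨k, rfl | rfl⟩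
    · rw [fourierCoef_nonneg, zero_mul]
    · rw [cint_geom_zero_neg, mul_zero]
  have h3 := eq_zero_of_fourierCoef hc h2 w
  rw [h1] at h3
  exact (mul_eq_zero.1 h3).resolve_left (Circle.coe_ne_zero w)

end X

set_option linter.unusedSectionVars false

open Ker X

/-! ### The functional in terms of kernels -/

section Kernels

variable {α β : ℝ≥0} [Fact (α ≤ 1)] [Fact (0 < β)] [Fact (β < 1)]

/-- The kernel `Ā / A = -τ̄ w̄`. -/
def zeta : Ker α := -(varTInv * varWInv)

lemma eval_zeta (w τ : Circle) : (zeta : Ker α).eval w τ = -((τ : ℂ)⁻¹ * (w : ℂ)⁻¹) := by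
  simp [zeta]

/-- The kernel `1 + ε B / A`. -/
def kN (ε : ℝ) (f : X β) : Ker α := 1 + ε • kB f

/-- The kernel `E`. -/
def kE (d ε : ℝ) (f : X β) : Ker α :=
  ε • (varT + varW) + ε ^ 2 • (kFt f + kFw f) - (2 * d) • 1

/-- The kernel of `g₂`. -/
def kG2 (ε : ℝ) (f : X β) : Ker α :=
  meanK (zeta * (conjK (kB f) - kB f) * Ring.inverse (kN ε f) * kDt f) +
    meanK (zeta * (kB f - conjK (kB f)) * kB f * Ring.inverse (kN ε f))

/-- The kernel of `g₃`. -/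
def kG3 (d ε : ℝ) (f : X β) : Ker α :=
  kFtInv f * Ring.inverse (kE d ε f) +
    (1 / (2 * d)) • ((varT + varW + ε • (kFt f + kFw f)) * Ring.inverse (kE d ε f) * varTInv)

/-- The kernel of `g₂ - ⨍ g₃ (1 + ε f'(τ)) dτ`. -/
def kV (d ε : ℝ) (f : X β) : Ker α := kG2 ε f - meanK (kG3 d ε f * (1 + ε • kDt f))

/-- The velocity kernel `W`, for which `F = -f' + ε W w (1 + ε f')`. -/
def kW (d Ω c ε : ℝ) (f : X β) : Ker α :=
  (2 * Ω) • (varWInv + ε • kFwInv f) + c • 1 + kV d ε f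

lemma eval_kN (ε : ℝ) (f : X β) (w τ : Circle) :
    (kN ε f : Ker α).eval w τ = 1 + ε * divDiff f w τ := by simp [kN]

lemma eval_kE (d ε : ℝ) (f : X β) (w τ : Circle) : (kE d ε f : Ker α).eval w τ =
    ε * ((τ : ℂ) + w) + ε ^ 2 * (f τ + f w) - 2 * d := by
  simp [kE]
  ring

variable {d ε : ℝ} {f : X β}

lemma one_add_ne_zero_of_norm_lt {z : ℂ} (h : ‖z‖ < 1) : 1 + z ≠ 0 := by
  intro h0
  have : z = -1 := by linear_combination h0
  rw [this, norm_neg, norm_one] at h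
  exact lt_irrefl _ h

/-- On the unit ball divided differences are at most `π / 2 < 2`, so `|ε| < 1/2` keeps `1 + ε B / A`
away from zero. -/
lemma norm_mul_divDiff_lt (hε : |ε| < 1 / 2) (hf : ‖f‖ < 1) (w τ : Circle) :
    ‖(ε : ℂ) * divDiff f w τ‖ < 1 := by
  have h1 := norm_divDiff_le f w τ
  have h2 := Real.pi_lt_four
  have h3 := Real.pi_pos
  rw [norm_mul, Complex.norm_real, Real.norm_eq_abs]
  have h4 : ‖divDiff f w τ‖ ≤ 2 := by nlinarith
  nlinarith [abs_nonneg ε, norm_nonneg (divDiff f w τ)]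

lemma norm_mul_deriv_lt (hε : |ε| < 1 / 2) (hf : ‖f‖ < 1) (w : Circle) :
    ‖(ε : ℂ) * circleDeriv f w‖ < 1 / 2 := by
  have h1 := norm_deriv_le f w
  rw [norm_mul, Complex.norm_real, Real.norm_eq_abs]
  nlinarith [abs_nonneg ε, norm_nonneg (circleDeriv f w)]

lemma isUnit_kN (hε : |ε| < 1 / 2) (hf : ‖f‖ < 1) : IsUnit (kN ε f : Ker α) :=
  isUnit_of_ne_zero fun w τ => by
    rw [eval_kN]
    exact one_add_ne_zero_of_norm_lt (norm_mul_divDiff_lt hε hf w τ)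

/-- `|E + 2d| ≤ 2|ε| + 2ε² < 3/2`, while `2d > 4`. -/
lemma kE_eval_ne_zero (hd : 2 < d) (hε : |ε| < 1 / 2) (hf : ‖f‖ < 1) (w τ : Circle) :
    (ε * ((τ : ℂ) + w) + ε ^ 2 * (f τ + f w) - 2 * d : ℂ) ≠ 0 := by
  intro h0
  have h1 : (ε * ((τ : ℂ) + w) + ε ^ 2 * (f τ + f w) : ℂ) = ((2 * d : ℝ) : ℂ) := by
    push_cast; linear_combination h0
  have h2 : ‖(ε * ((τ : ℂ) + w) + ε ^ 2 * (f τ + f w) : ℂ)‖ ≤ |ε| * 2 + |ε| ^ 2 * 2 := by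
    refine (norm_add_le _ _).trans ?_
    rw [norm_mul, norm_mul, norm_pow, Complex.norm_real, Real.norm_eq_abs]
    have a1 : ‖(τ : ℂ) + w‖ ≤ 2 := by
      refine (norm_add_le _ _).trans ?_
      rw [Circle.norm_coe, Circle.norm_coe]; norm_num
    have a2 : ‖f τ + f w‖ ≤ 2 := by
      refine (norm_add_le _ _).trans ?_
      linarith [norm_apply_le f τ, norm_apply_le f w]
    gcongr
  rw [h1, Complex.norm_real, Real.norm_eq_abs, abs_of_pos (by linarith)] at h2
  nlinarith [abs_nonneg ε]

lemma isUnit_kE (hd : 2 < d) (hε : |ε| < 1 / 2) (hf : ‖f‖ < 1) : IsUnit (kE d ε f : Ker α) :=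
  isUnit_of_ne_zero fun w τ => by
    rw [eval_kE]
    exact kE_eval_ne_zero hd hε hf w τ

lemma conj_sub_coe (τ w : Circle) :
    conj ((τ : ℂ) - w) = -((τ : ℂ)⁻¹ * (w : ℂ)⁻¹) * ((τ : ℂ) - w) := by
  have h1 := Circle.coe_ne_zero τ
  have h2 := Circle.coe_ne_zero w
  rw [map_sub, ← Circle.coe_inv_eq_conj, ← Circle.coe_inv_eq_conj, Circle.coe_inv, Circle.coe_inv]
  field_simp
  ring

lemma sub_eq_mul_divDiff {w τ : Circle} (h : τ ≠ w) (f : Circle → ℂ) :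
    f τ - f w = ((τ : ℂ) - w) * divDiff f w τ := by
  have := coe_sub_ne_zero h
  rw [divDiff_of_ne h]
  field_simp

lemma conj_sub_eq {w τ : Circle} (h : τ ≠ w) (f : Circle → ℂ) : conj (f τ - f w) =
    -((τ : ℂ)⁻¹ * (w : ℂ)⁻¹) * ((τ : ℂ) - w) * conj (divDiff f w τ) := by
  rw [sub_eq_mul_divDiff h, map_mul, conj_sub_coe]

/-- Off the null diagonal, dividing out `A` through `B = A D`, `Ā = ζ A` and `B̄ = ζ A D̄` removes
the singularity. -/
lemma eval_kG2 (hε : |ε| < 1 / 2) (hf : ‖f‖ < 1) (w τ₀ : Circle) :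
    (kG2 ε f : Ker α).eval w τ₀ = g₂ ε f w := by
  have hN := isUnit_kN (α := α) hε hf
  rw [kG2, eval_add, eval_meanK, eval_meanK, g₂]
  congr 1
  · refine mean_congr_ne w fun τ hτ => ?_
    have hA := coe_sub_ne_zero hτ
    have h1 := one_add_ne_zero_of_norm_lt (norm_mul_divDiff_lt hε hf w τ)
    rw [conj_sub_eq hτ, conj_sub_coe, sub_eq_mul_divDiff hτ]
    simp only [eval_mul, eval_sub, eval_conjK, eval_kB, eval_kDt, eval_zeta, eval_inverse hN,
      eval_kN]
    have h2 : (τ : ℂ) - w + ε * (((τ : ℂ) - w) * divDiff f w τ) =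
      ((τ : ℂ) - w) * (1 + ε * divDiff f w τ) := by ring
    rw [h2]
    have h3 := Circle.coe_ne_zero τ
    have h4 := Circle.coe_ne_zero w
    field_simp
    ring
  · refine mean_congr_ne w fun τ hτ => ?_
    have hA := coe_sub_ne_zero hτ
    have h1 := one_add_ne_zero_of_norm_lt (norm_mul_divDiff_lt hε hf w τ)
    rw [conj_sub_eq hτ, conj_sub_coe, sub_eq_mul_divDiff hτ]
    simp only [eval_mul, eval_sub, eval_conjK, eval_kB, eval_zeta, eval_inverse hN, eval_kN]
    have h2 : (τ : ℂ) - w + ε * (((τ : ℂ) - w) * divDiff f w τ) =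
      ((τ : ℂ) - w) * (1 + ε * divDiff f w τ) := by ring
    rw [h2]
    have h3 := Circle.coe_ne_zero τ
    have h4 := Circle.coe_ne_zero w
    field_simp
    ring

lemma eval_kG3 (hd : 2 < d) (hε : |ε| < 1 / 2) (hf : ‖f‖ < 1) (w τ : Circle) :
    (kG3 d ε f : Ker α).eval w τ = g₃ d ε f τ w := by
  simp only [kG3, g₃, eval_add, eval_mul, eval_smul, eval_inverse (isUnit_kE hd hε hf), eval_kE,
    eval_kFtInv, eval_kFt, eval_kFw, eval_varT, eval_varW, eval_varTInv]
  push_cast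
  ring

/-- Up to the factor `-w̄` this is the coefficient of `f'` of index `0`, beyond its highest
frequency `-2`. -/
lemma mean_zeta_deriv (w : Circle) :
    mean (fun τ : Circle => -((τ : ℂ)⁻¹ * (w : ℂ)⁻¹) * circleDeriv f τ) = 0 := by
  have h1 := fourierCoef_deriv f Fact.out 0 (by norm_num)
  rw [fourierCoef] at h1
  have h2 := mean_const_mul (-(w : ℂ)⁻¹)
    (fun τ : Circle => circleDeriv f τ * (τ : ℂ) ^ (-0 - 1 : ℤ))
  rw [h1, mul_zero] at h2
  rw [← h2]
  congr 1
  funext τ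
  simp only [neg_zero, zero_sub, zpow_neg_one]
  ring

/-- The factor `τ̄` cancels the `τ` of `dτ = iτ dθ`. Only angular means of the divided difference
and its conjugate remain, and these vanish by `cint_divDiff`. -/
lemma mean_zeta_divDiff (w : Circle) :
    mean (fun τ : Circle => -((τ : ℂ)⁻¹ * (w : ℂ)⁻¹) *
      (conj (divDiff f w τ) - divDiff f w τ)) = 0 := by
  have hc : Continuous (divDiff f w) :=
    (continuous_divDiff f Fact.out Fact.out).comp (Continuous.prodMk_right w)
  have hc2 : Continuous fun τ => conj (divDiff f w τ) := continuous_conj.comp hc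
  have h1 := cint_divDiff f Fact.out Fact.out w
  have h2 : cint (fun τ => conj (divDiff f w τ) - divDiff f w τ) = 0 := by
    rw [cint_sub hc2 hc, cint_conj, h1, map_zero, sub_zero]
  have h3 := cint_const_mul (-(w : ℂ)⁻¹) fun τ => conj (divDiff f w τ) - divDiff f w τ
  rw [h2, mul_zero] at h3
  rw [mean_eq_cint]
  convert mul_zero _ using 2
  rw [← h3]
  congr 1
  funext τ
  have := Circle.coe_ne_zero τ
  field_simp

lemma meanK_eq_zero {K : Ker α} (h : ∀ w, mean (K.eval w) = 0) : meanK K = 0 :=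
  ext' fun w τ => by rw [eval_meanK, h, eval_zero]

/-- The two integrals in `F₂` combine to `ε g₂`. -/
lemma F₂_eq (hε : |ε| < 1 / 2) (hf : ‖f‖ < 1) (w : Circle) :
    F₂ ε f w = ε * g₂ ε f w * w * (1 + ε * circleDeriv f w) := by
  have hα : Fact (β ≤ 1) := ⟨(Fact.out : β < 1).le⟩
  have hN := isUnit_kN (α := β) hε hf
  have key : meanK (zeta * (1 + ε • conjK (kB f)) * Ring.inverse (kN ε f) * kDt f : Ker β) +
      meanK (zeta * (conjK (kB f) - kB f) * Ring.inverse (kN ε f)) = ε • kG2 ε f := by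
    -- `(1 + ε D̄)/(1 + ε D) = 1 + ε (D̄ - D)/(1 + ε D)`; the part free of `ε` integrates to zero by
    -- `mean_zeta_deriv`.
    have e1 : (zeta * (1 + ε • conjK (kB f)) * Ring.inverse (kN ε f) * kDt f : Ker β) =
        zeta * kDt f + ε • (zeta * (conjK (kB f) - kB f) * Ring.inverse (kN ε f) * kDt f) := by
      refine ext' fun w τ => ?_
      have h1 := one_add_ne_zero_of_norm_lt (norm_mul_divDiff_lt hε hf w τ)
      simp only [eval_mul, eval_add, eval_sub, eval_smul, eval_one, eval_conjK, eval_kB, eval_kDt,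
        eval_inverse hN, eval_kN]
      have hx := mul_inv_cancel₀ h1
      linear_combination ((zeta : Ker β).eval w τ * circleDeriv f τ) * hx
    -- `1/(1 + ε D) = 1 - ε D/(1 + ε D)`; the part free of `ε` integrates to zero by
    -- `mean_zeta_divDiff`.
    have e2 : (zeta * (conjK (kB f) - kB f) * Ring.inverse (kN ε f) : Ker β) =
        zeta * (conjK (kB f) - kB f) +
          ε • (zeta * (kB f - conjK (kB f)) * kB f * Ring.inverse (kN ε f)) := by
      refine ext' fun w τ => ?_
      have h1 := one_add_ne_zero_of_norm_lt (norm_mul_divDiff_lt hε hf w τ)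
      simp only [eval_mul, eval_add, eval_sub, eval_smul, eval_conjK, eval_kB,
        eval_inverse hN, eval_kN]
      have hx := mul_inv_cancel₀ h1
      linear_combination ((zeta : Ker β).eval w τ * (conj (divDiff f w τ) - divDiff f w τ)) * hx
    have z1 : meanK (zeta * kDt f : Ker β) = 0 := meanK_eq_zero fun w => by
      rw [← mean_zeta_deriv (f := f) w]
      congr 1
    have z2 : meanK (zeta * (conjK (kB f) - kB f) : Ker β) = 0 := meanK_eq_zero fun w => by
      rw [← mean_zeta_divDiff (f := f) w]
      congr 1
    have m1 : meanK (zeta * (1 + ε • conjK (kB f)) * Ring.inverse (kN ε f) * kDt f : Ker β) =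
        ε • meanK (zeta * (conjK (kB f) - kB f) * Ring.inverse (kN ε f) * kDt f) := by
      rw [e1, map_add, map_smul, z1, zero_add]
    have m2 : meanK (zeta * (conjK (kB f) - kB f) * Ring.inverse (kN ε f) : Ker β) =
        ε • meanK (zeta * (kB f - conjK (kB f)) * kB f * Ring.inverse (kN ε f)) := by
      rw [e2, map_add, map_smul, z2, zero_add]
    rw [m1, m2, ← smul_add]
    rfl
  have h := congrArg (fun K => K.eval w w) key
  simp only [eval_add, eval_smul, eval_meanK] at h
  rw [eval_kG2 hε hf] at h
  have p1 : mean (fun τ : Circle => (conj ((τ : ℂ) - w) + ε * conj (f τ - f w)) /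
      ((τ : ℂ) - w + ε * (f τ - f w)) * circleDeriv f τ) =
      mean ((zeta * (1 + ε • conjK (kB f)) * Ring.inverse (kN ε f) * kDt f : Ker β).eval w) := by
    refine mean_congr_ne w fun τ hτ => ?_
    have hA := coe_sub_ne_zero hτ
    have h1 := one_add_ne_zero_of_norm_lt (norm_mul_divDiff_lt hε hf w τ)
    rw [conj_sub_eq hτ, conj_sub_coe, sub_eq_mul_divDiff hτ]
    simp only [eval_mul, eval_add, eval_smul, eval_one, eval_conjK, eval_kB, eval_kDt, eval_zeta,
      eval_inverse hN, eval_kN]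
    have h2 : (τ : ℂ) - w + ε * (((τ : ℂ) - w) * divDiff f w τ) =
      ((τ : ℂ) - w) * (1 + ε * divDiff f w τ) := by ring
    rw [h2]
    have h3 := Circle.coe_ne_zero τ
    have h4 := Circle.coe_ne_zero w
    field_simp
    ring
  have p2 : mean (fun τ : Circle => (((τ : ℂ) - w) * conj (f τ - f w) -
      conj ((τ : ℂ) - w) * (f τ - f w)) /
      (((τ : ℂ) - w) * ((τ : ℂ) - w + ε * (f τ - f w)))) =
      mean ((zeta * (conjK (kB f) - kB f) * Ring.inverse (kN ε f) : Ker β).eval w) := by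
    refine mean_congr_ne w fun τ hτ => ?_
    have hA := coe_sub_ne_zero hτ
    have h1 := one_add_ne_zero_of_norm_lt (norm_mul_divDiff_lt hε hf w τ)
    rw [conj_sub_eq hτ, conj_sub_coe, sub_eq_mul_divDiff hτ]
    simp only [eval_mul, eval_sub, eval_conjK, eval_kB, eval_zeta, eval_inverse hN, eval_kN]
    have h2 : (τ : ℂ) - w + ε * (((τ : ℂ) - w) * divDiff f w τ) =
      ((τ : ℂ) - w) * (1 + ε * divDiff f w τ) := by ring
    rw [h2]
    have h3 := Circle.coe_ne_zero τ
    have h4 := Circle.coe_ne_zero w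
    field_simp
    ring
  rw [← h, F₂, p1, p2]

lemma mean_inv : mean (fun τ : Circle => (τ : ℂ)⁻¹) = 1 := by
  rw [mean_eq_cint]
  have h : (fun w : Circle => (w : ℂ) * (w : ℂ)⁻¹) = fun _ => 1 :=
    funext fun w => mul_inv_cancel₀ (Circle.coe_ne_zero w)
  have : (Real.pi : ℂ) ≠ 0 := by exact_mod_cast Real.pi_ne_zero
  rw [h, cint_one]
  field_simp

/-- The integral in `F₃`. -/
lemma F₃_eq (hd : 2 < d) (hε : |ε| < 1 / 2) (hf : ‖f‖ < 1) (w : Circle) :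
    F₃ d ε f w = (1 / (2 * d) - ε * mean fun τ => g₃ d ε f τ w * (1 + ε * circleDeriv f τ)) *
      w * (1 + ε * circleDeriv f w) := by
  have hα : Fact (β ≤ 1) := ⟨(Fact.out : β < 1).le⟩
  have hE := isUnit_kE (α := β) hd hε hf
  have hd0 : (d : ℂ) ≠ 0 := by
    have : d ≠ 0 := by linarith
    exact_mod_cast this
  -- `-1/(2d)` is the value of `1/E` at `ε = 0`. The remainder carries a factor `ε`, and `g₃` is
  -- designed to be its quotient by `ε`.
  have key : ((varTInv + ε • kFtInv f) * (1 + ε • kDt f) * Ring.inverse (kE d ε f) : Ker β) =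
      ε • (kG3 d ε f * (1 + ε • kDt f)) + (-(1 / (2 * d))) • (varTInv * (1 + ε • kDt f)) := by
    refine ext' fun w τ => ?_
    have h1 := kE_eval_ne_zero hd hε hf w τ
    simp only [eval_mul, eval_add, eval_smul, eval_one, eval_kDt, eval_inverse hE, eval_kE,
      eval_kFtInv, eval_varTInv, kG3, eval_kFt, eval_kFw, eval_varT, eval_varW]
    push_cast
    have hx := mul_inv_cancel₀ h1
    have hcd : (1 / (2 * d) : ℂ) * (2 * d) = 1 := by field_simp
    linear_combination (-(1 / (2 * d) : ℂ) * (τ : ℂ)⁻¹ * (1 + ε * circleDeriv f τ)) * hx -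
      ((τ : ℂ)⁻¹ * (1 + ε * circleDeriv f τ) *
        (ε * ((τ : ℂ) + w) + ε ^ 2 * (f τ + f w) - 2 * d : ℂ)⁻¹) * hcd
  -- `τ̄` has mean `1`, and the mean of `τ̄ f'(τ)` is the coefficient of `f'` of index `0`, which is
  -- zero.
  have hm : meanK (varTInv * (1 + ε • kDt f) : Ker β) = 1 := by
    refine ext' fun w τ₀ => ?_
    have e : (varTInv * (1 + ε • kDt f) : Ker β) = varTInv + ε • (varTInv * kDt f) := by
      refine ext' fun w τ => ?_
      simp only [eval_mul, eval_add, eval_smul, eval_one]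
      ring
    have z1 : mean ((varTInv * kDt f : Ker β).eval w) = 0 := by
      have h1 := fourierCoef_deriv f Fact.out 0 (by norm_num)
      rw [fourierCoef] at h1
      rw [← h1]
      congr 1
      funext τ
      simp only [eval_mul, eval_varTInv, eval_kDt, neg_zero, zero_sub, zpow_neg_one,
        Circle.coe_inv]
      ring
    have z2 : mean ((varTInv : Ker β).eval w) = 1 := by
      rw [← mean_inv]
      congr 1
    rw [e, map_add, map_smul, eval_add, eval_smul, eval_meanK, eval_meanK, z1, z2, eval_one]
    ring
  have h := congrArg (fun K => (meanK K).eval w w) key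
  simp only [map_add, map_smul, hm, eval_add, eval_smul, eval_meanK, eval_one] at h
  have e1 : mean ((kG3 d ε f * (1 + ε • kDt f) : Ker β).eval w) =
      mean fun τ => g₃ d ε f τ w * (1 + ε * circleDeriv f τ) := by
    congr 1
    funext τ
    rw [eval_mul, eval_kG3 hd hε hf]
    rfl
  rw [e1] at h
  have e2 : mean (((varTInv + ε • kFtInv f) * (1 + ε • kDt f) *
      Ring.inverse (kE d ε f) : Ker β).eval w) = mean fun τ =>
      ((τ⁻¹ : Circle) + ε * f τ⁻¹) * (1 + ε * circleDeriv f τ) /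
        (ε * ((τ : ℂ) + w) + ε ^ 2 * (f τ + f w) - 2 * d) := by
    congr 1
    funext τ
    rw [eval_mul, eval_mul, eval_inverse hE, eval_kE, div_eq_mul_inv]
    rfl
  rw [e2] at h
  rw [F₃, h]
  push_cast
  ring

lemma eval_kV (hd : 2 < d) (hε : |ε| < 1 / 2) (hf : ‖f‖ < 1) (w τ₀ : Circle) :
    (kV d ε f : Ker α).eval w τ₀ =
      g₂ ε f w - mean fun τ => g₃ d ε f τ w * (1 + ε * circleDeriv f τ) := by
  rw [kV, eval_sub, eval_kG2 hε hf, eval_meanK]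
  congr 2
  funext τ
  rw [eval_mul, eval_kG3 hd hε hf]
  rfl

lemma eval_kW (hd : 2 < d) (hε : |ε| < 1 / 2) (hf : ‖f‖ < 1) (Ω c : ℝ) (w τ₀ : Circle) :
    (kW d Ω c ε f : Ker α).eval w τ₀ =
      2 * Ω * ((w⁻¹ : Circle) + ε * f w⁻¹) + c +
      (g₂ ε f w - mean fun τ => g₃ d ε f τ w * (1 + ε * circleDeriv f τ)) := by
  rw [kW, eval_add, eval_add, eval_kV hd hε hf]
  simp
  ring

/-- The functional as a perturbation of its linear part. -/
lemma F_eq (hd : 2 < d) (hε : |ε| < 1 / 2) (hf : ‖f‖ < 1) {Ω c : ℝ}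
    (hc : ε * c = 1 / (2 * d) - 2 * Ω * d) (w τ₀ : Circle) :
    F d Ω ε f w = -circleDeriv f w +
      ε * (kW d Ω c ε f : Ker α).eval w τ₀ * w * (1 + ε * circleDeriv f w) := by
  have hc' : (ε * c : ℂ) = 1 / (2 * d) - 2 * Ω * d := by exact_mod_cast hc
  rw [F, F₁, F₂_eq hε hf, F₃_eq hd hε hf, eval_kW hd hε hf]
  -- Apart from `-f'`, the terms without an explicit factor `ε` are `1/(2d) - 2Ωd` times `w (1 + ε
  -- f')`; the hypothesis turns this constant into `ε c`.
  linear_combination (-(w : ℂ) * (1 + ε * circleDeriv f w)) * hc'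

end Kernels

instance factLeOfLt {β : ℝ≥0} [h : Fact (β < 1)] : Fact (β ≤ 1) := ⟨h.out.le⟩

instance factOneLe : Fact ((1 : ℝ≥0) ≤ 1) := ⟨le_rfl⟩

/-! ### The angular velocity -/

section AngularVelocity

variable {β : ℝ≥0} [Fact (0 < β)] [Fact (β < 1)]

/-- The kernel `w̄ - w`. -/
def kQ : Ker β := varWInv - varW

/-- `T₁` in terms of kernels. -/
def kT₁ (d ε : ℝ) (f : X β) : ℂ :=
  meanW (kFw f : Ker β) + (2 * d) • meanW (kV d ε f * kQ * (1 + ε • kDw f) : Ker β)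

/-- `T₂` in terms of kernels. -/
def kT₂ (d ε : ℝ) (f : X β) : ℂ :=
  -meanW (kFw f : Ker β) + (ε ^ 2 / d) • meanW (kFwInv f * kDw f * kQ : Ker β)

/-- The angular velocity in terms of kernels. -/
def kΩ (d ε : ℝ) (f : X β) : ℝ :=
  1 / (4 * d ^ 2) * ((1 + ε * (kT₁ d ε f).re) / (1 - ε * (kT₂ d ε f).re))

/-- The constant for which `ε c = 1 / (2d) - 2Ωd`. -/
def kC (d ε : ℝ) (f : X β) : ℝ :=
  -(1 / (2 * d)) * (((kT₁ d ε f).re + (kT₂ d ε f).re) / (1 - ε * (kT₂ d ε f).re))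

/-- `F(Ω(ε, f), ε, f)` as a kernel. -/
def kGhat (d ε : ℝ) (f : X β) : Ker β :=
  -kDw f + ε • (kW d (kΩ d ε f) (kC d ε f) ε f * varW * (1 + ε • kDw f))

lemma T₂_eq (d ε : ℝ) (f : X β) : T₂ d ε f = kT₂ d ε f := by
  rw [T₂, kT₂, meanW_apply, meanW_apply, Complex.real_smul]
  push_cast
  rfl

variable {d ε : ℝ} {f : X β}

/-- Factors depending on `w` alone leave the inner integral, and the opposite signs of `w - w̄` and
`w̄ - w` merge the two contributions into one integral against `kV`. -/
lemma T₁_eq (hd : 2 < d) (hε : |ε| < 1 / 2) (hf : ‖f‖ < 1) : T₁ d ε f = kT₁ d ε f := by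
  have h : (kV d ε f * kQ * (1 + ε • kDw f) : Ker β) = kG2 ε f * kQ * (1 + ε • kDw f) +
      meanK (kG3 d ε f * (1 + ε • kDt f)) * (-kQ) * (1 + ε • kDw f) := by
    rw [kV]; ring
  have e1 : meanW (kG2 ε f * kQ * (1 + ε • kDw f) : Ker β) =
      mean fun w => g₂ ε f w * ((w⁻¹ : Circle) - (w : ℂ)) * (1 + ε * circleDeriv f w) := by
    rw [meanW_apply]
    congr 1
    funext w
    rw [eval_mul, eval_mul, eval_kG2 hε hf]
    simp [kQ]
  have e2 : meanW (meanK (kG3 d ε f * (1 + ε • kDt f)) * (-kQ) * (1 + ε • kDw f) : Ker β) =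
      mean fun w => mean fun τ =>
      g₃ d ε f τ w * (1 + ε * circleDeriv f τ) * ((w : ℂ) - (w⁻¹ : Circle)) *
        (1 + ε * circleDeriv f w) := by
    rw [meanW_apply]
    congr 1
    funext w
    rw [mean_mul_const, mean_mul_const, eval_mul, eval_mul, eval_meanK]
    congr 2
    · congr 1
      funext τ
      rw [eval_mul, eval_kG3 hd hε hf]
      simp
    · simp [kQ]
  rw [T₁, kT₁, h, map_add, e1, e2, meanW_apply, Complex.real_smul]
  push_cast
  have e3 : (mean fun w => (kFw f : Ker β).eval w 1) = mean f := rfl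
  rw [e3]
  ring

/-- `|∮ f| ≤ 1`, and the second term is at most `2 ε²/d ≤ 1/4`, so `|T₂| ≤ 5/4`. Half of this is
`5/8`, which leaves `3/8` for the denominator of `Ω`. -/
lemma abs_mul_kT₂_le (hd : 2 < d) (hε : |ε| < 1 / 2) (hf : ‖f‖ < 1) :
    |ε * (kT₂ d ε f).re| ≤ 5 / 8 := by
  have h1 : ‖meanW (kFw f : Ker β)‖ ≤ 1 := by
    rw [meanW_apply]
    exact norm_mean_le_of_le fun w => (norm_apply_le f w).trans hf.le
  have h2 : ‖meanW (kFwInv f * kDw f * kQ : Ker β)‖ ≤ 2 := by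
    rw [meanW_apply]
    refine norm_mean_le_of_le fun w => ?_
    simp only [eval_mul, eval_kFwInv, eval_kDw, kQ, eval_sub, eval_varWInv, eval_varW, norm_mul]
    have a1 : ‖(((w⁻¹ : Circle) : ℂ)) - w‖ ≤ 2 := by
      refine (norm_sub_le _ _).trans ?_
      rw [Circle.norm_coe, Circle.norm_coe]; norm_num
    have a2 := (norm_apply_le f w⁻¹).trans hf.le
    have a3 := (norm_deriv_le f w).trans hf.le
    calc _ ≤ (1 : ℝ) * 1 * 2 := by gcongr
      _ ≤ 2 := by norm_num
  have h3 : ‖kT₂ d ε f‖ ≤ 5 / 4 := by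
    refine (norm_add_le _ _).trans ?_
    rw [norm_neg, norm_smul, Real.norm_eq_abs, abs_div, abs_pow, abs_of_pos (by linarith : 0 < d)]
    have h4 : |ε| ^ 2 / d ≤ 1 / 8 := by
      rw [div_le_iff₀ (by linarith)]
      nlinarith [abs_nonneg ε]
    have h5 : 0 ≤ |ε| ^ 2 / d := by
      have : 0 < d := by linarith
      positivity
    nlinarith [norm_nonneg (meanW (kFwInv f * kDw f * kQ : Ker β))]
  have h6 := (Complex.abs_re_le_norm (kT₂ d ε f)).trans h3
  rw [abs_mul]
  nlinarith [abs_nonneg ε, abs_nonneg (kT₂ d ε f).re]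

lemma one_sub_mul_kT₂_pos (hd : 2 < d) (hε : |ε| < 1 / 2) (hf : ‖f‖ < 1) :
    3 / 8 ≤ 1 - ε * (kT₂ d ε f).re := by
  have := (abs_le.1 (abs_mul_kT₂_le hd hε hf)).2
  linarith

lemma angularVelocity_eq (hd : 2 < d) (hε : |ε| < 1 / 2) (hf : ‖f‖ < 1) :
    angularVelocity d ε f = kΩ d ε f := by
  rw [angularVelocity, kΩ, T₁_eq hd hε hf, T₂_eq]

/-- In `1/(2d) - 2Ωd = (1/(2d)) (1 - (1 + εT₁)/(1 - εT₂))` the numerator is divisible by `ε`; `kC`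
is the quotient, regular at `ε = 0`. -/
lemma mul_kC (hd : 2 < d) (hε : |ε| < 1 / 2) (hf : ‖f‖ < 1) :
    ε * kC d ε f = 1 / (2 * d) - 2 * kΩ d ε f * d := by
  have h1 : 1 - ε * (kT₂ d ε f).re ≠ 0 := by
    have := one_sub_mul_kT₂_pos hd hε hf
    linarith
  have h2 : d ≠ 0 := by linarith
  rw [kC, kΩ]
  field_simp
  ring

lemma F_eq_eval_kGhat (hd : 2 < d) (hε : |ε| < 1 / 2) (hf : ‖f‖ < 1) (w τ : Circle) :
    F d (angularVelocity d ε f) ε f w = (kGhat d ε f).eval w τ := by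
  rw [angularVelocity_eq hd hε hf, F_eq (α := β) hd hε hf (mul_kC hd hε hf) w τ, kGhat]
  simp
  ring

lemma Ghat_eq (hd : 2 < d) (hε : |ε| < 1 / 2) (hf : ‖f‖ < 1) (w τ : Circle) :
    Ghat d ε f w = ((kGhat d ε f).eval w τ).im := by
  rw [Ghat, F_eq_eval_kGhat hd hε hf w τ]

/-! ### Conjugation symmetry and the first sine coefficient. -/

lemma conj_mean (g : Circle → ℂ) : conj (mean g) = mean fun w => conj (g w⁻¹) := by
  have h : (fun w : Circle => (w : ℂ) * conj (g w⁻¹)) =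
      fun w : Circle => (fun τ : Circle => conj ((τ : ℂ) * g τ)) w⁻¹ := by
    funext w
    simp only [map_mul]
    rw [← Circle.coe_inv_eq_conj, inv_inv]
  have h1 : cint (fun w : Circle => (fun τ : Circle => conj ((τ : ℂ) * g τ)) w⁻¹) =
      conj (cint fun τ : Circle => (τ : ℂ) * g τ) :=
    (cint_inv fun τ : Circle => conj ((τ : ℂ) * g τ)).trans (cint_conj _)
  have h2 : conj ((2 * Real.pi : ℂ)⁻¹) = (2 * Real.pi : ℂ)⁻¹ := by
    rw [map_inv₀, map_mul, Complex.conj_ofReal, map_ofNat]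
  calc conj (mean g) = (2 * Real.pi : ℂ)⁻¹ * conj (cint fun τ : Circle => (τ : ℂ) * g τ) := by
        rw [mean_eq_cint, map_mul, h2]
    _ = _ := by rw [← h1, mean_eq_cint, h]

/-- The functional is equivariant with respect to complex conjugation. -/
lemma F_inv (d Ω ε : ℝ) (f : X β) (w : Circle) : F d Ω ε f w⁻¹ = conj (F d Ω ε f w) := by
  have hw : ∀ w : Circle, ((w⁻¹ : Circle) : ℂ) = conj (w : ℂ) := Circle.coe_inv_eq_conj
  have h2 : F₂ ε f w⁻¹ = conj (F₂ ε f w) := by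
    simp only [F₂, map_mul, map_add, conj_mean, map_div₀, map_sub, map_one, hw, deriv_inv, apply_inv,
      Complex.conj_conj, Complex.conj_ofReal]
  have h3 : F₃ d ε f w⁻¹ = conj (F₃ d ε f w) := by
    simp only [F₃, map_mul, map_add, map_neg, conj_mean, map_div₀, map_sub, map_one, hw, deriv_inv,
      apply_inv, Complex.conj_conj, Complex.conj_ofReal, map_pow, map_ofNat]
  rw [F, F, map_add, map_add, h2, h3]
  congr 2
  simp only [F₁, map_mul, map_add, map_sub, map_one, hw, deriv_inv,
      apply_inv, Complex.conj_conj, Complex.conj_ofReal, map_pow, map_ofNat, inv_inv]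

lemma Ghat_inv (d ε : ℝ) (f : X β) (w : Circle) : Ghat d ε f w⁻¹ = -Ghat d ε f w := by
  rw [Ghat, F_inv, Complex.conj_im, Ghat]

lemma fourierCoef_meanW (g : Circle → ℂ) {n : ℤ} {K : Ker β}
    (h : ∀ w, K.eval w 1 = g w * (w : ℂ) ^ (-n - 1)) : meanW K = fourierCoef g n := by
  rw [meanW_apply, fourierCoef]
  congr 1
  exact funext h

/-- `f' w̄ (w̄ - w) = f' w̄² - f'` has as mean the difference of the coefficients of `f'` of index
`1` and `-1`, both zero. -/
lemma meanW_kDw_mul (f : X β) : meanW (kDw f * varWInv * kQ : Ker β) = 0 := by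
  have e : (kDw f * varWInv * kQ : Ker β) = kDw f * (varWInv * varWInv) - kDw f := by
    refine ext' fun w τ => ?_
    have := Circle.coe_ne_zero w
    simp only [kQ, eval_mul, eval_sub, eval_varWInv, eval_varW, Circle.coe_inv]
    field_simp
  rw [e, map_sub, fourierCoef_meanW (circleDeriv f) (n := 1) fun w => ?_,
    fourierCoef_meanW (circleDeriv f) (n := -1) fun w => ?_,
    fourierCoef_deriv f Fact.out 1 (by norm_num), fourierCoef_deriv f Fact.out (-1) (by norm_num),
    sub_zero]
  · simp
  · simp only [eval_mul, eval_kDw, eval_varWInv, Circle.coe_inv]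
    rw [← mul_inv, ← pow_two, ← zpow_natCast, ← zpow_neg]
    norm_num

lemma mean_zpow {n : ℤ} (hn : n ≠ -1) : mean (fun w : Circle => (w : ℂ) ^ n) = 0 := by
  have h : (fun w : Circle => (w : ℂ) * (w : ℂ) ^ n) = fun w : Circle => (w : ℂ) ^ (n + 1) := by
    funext w
    rw [zpow_add_one₀ (Circle.coe_ne_zero w), mul_comm]
  rw [mean_eq_cint, h, cint_zpow (by omega), mul_zero]

lemma meanW_varWInv_mul_kQ : meanW (varWInv * kQ : Ker β) = 0 := by
  have e : (varWInv * kQ : Ker β) = varWInv * varWInv - 1 := by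
    refine ext' fun w τ => ?_
    have := Circle.coe_ne_zero w
    simp only [kQ, eval_mul, eval_sub, eval_varWInv, eval_varW, Circle.coe_inv, eval_one]
    field_simp
  have z1 : meanW (varWInv * varWInv : Ker β) = 0 := by
    rw [← mean_zpow (n := -2) (by norm_num), meanW_apply]
    congr 1
    funext w
    simp only [eval_mul, eval_varWInv, Circle.coe_inv]
    rw [← mul_inv, ← pow_two, ← zpow_natCast, ← zpow_neg]
    norm_num
  have z2 : meanW (1 : Ker β) = 0 := by
    rw [← mean_zpow (n := 0) (by norm_num), meanW_apply]
    congr 1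
  rw [e, map_sub, z1, z2, sub_zero]

lemma meanW_varWInv_mul (f : X β) : meanW (varWInv * kQ * (1 + ε • kDw f) : Ker β) = 0 := by
  have e : (varWInv * kQ * (1 + ε • kDw f) : Ker β) =
      varWInv * kQ + ε • (kDw f * varWInv * kQ) := by
    refine ext' fun w τ => ?_
    simp only [eval_mul, eval_add, eval_smul, eval_one]
    ring
  rw [e, map_add, map_smul, meanW_kDw_mul, meanW_varWInv_mul_kQ, smul_zero, add_zero]

/-- Two products survive: `w̄`, with mean `1`, and `f' w`, whose mean is the coefficient of `f'` of
index `-2`, that is `-∮ f`. -/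
lemma meanW_kQ_mul (f : X β) :
    meanW (kQ * (1 + ε • kDw f) : Ker β) = 1 + ε * meanW (kFw f : Ker β) := by
  have e : (kQ * (1 + ε • kDw f) : Ker β) =
      varWInv - varW + ε • (kDw f * varWInv - kDw f * varW) := by
    refine ext' fun w τ => ?_
    simp only [kQ, eval_mul, eval_add, eval_sub, eval_smul, eval_one]
    ring
  have z0 : meanW (varWInv : Ker β) = 1 := mean_inv
  have z1 : meanW (varW : Ker β) = 0 := by
    rw [← mean_zpow (n := 1) (by norm_num), meanW_apply]
    congr 1
    funext w
    simp
  have z2 : meanW (kDw f * varWInv : Ker β) = 0 := by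
    rw [fourierCoef_meanW (circleDeriv f) (n := 0) fun w => ?_,
      fourierCoef_deriv f Fact.out 0 (by norm_num)]
    simp
  have z3 : meanW (kDw f * varW : Ker β) = -meanW (kFw f : Ker β) := by
    rw [fourierCoef_meanW (circleDeriv f) (n := -2) fun w => ?_,
      fourierCoef_circleDeriv f.differentiable (f.continuous_deriv Fact.out),
      fourierCoef_meanW f (n := -1) fun w => ?_]
    · norm_num
    · simp
    · simp only [eval_mul, eval_kDw, eval_varW]
      norm_num
  rw [e, map_add, map_smul, map_sub, map_sub, z0, z1, z2, z3, Complex.real_smul]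
  ring

/-- Inversion reflects frequencies, so only the coefficients of `f` of index `0` and `2` enter. -/
lemma meanW_kFwInv_mul (f : X β) : meanW (kFwInv f * kQ : Ker β) = 0 := by
  have e : (kFwInv f * kQ : Ker β) = kFwInv f * varWInv - kFwInv f * varW := by
    rw [kQ, mul_sub]
  rw [e, map_sub, fourierCoef_meanW (fun w => f w⁻¹) (n := 0) fun w => ?_,
    fourierCoef_meanW (fun w => f w⁻¹) (n := -2) fun w => ?_, fourierCoef_comp_inv,
    fourierCoef_comp_inv]
  · have h1 := fourierCoef_nonneg f 0
    have h2 := fourierCoef_nonneg f 2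
    norm_num at h1 h2 ⊢
    rw [h1, h2, sub_zero]
  · simp only [eval_mul, eval_kFwInv, eval_varW]
    norm_num
  · simp

/-- The angular velocity is chosen so that the first sine coefficient vanishes. -/
lemma re_meanW_kGhat (hd : 2 < d) (hε : |ε| < 1 / 2) (hf : ‖f‖ < 1) :
    (meanW (kGhat d ε f * varWInv * kQ)).re = 0 := by
  set Ω := kΩ d ε f with hΩ
  set c := kC d ε f with hc
  set V : Ker β := kV d ε f with hV
  -- The weight `w̄ (w̄ - w)` extracts the first sine coefficient (`sinCoef_one_im`). In this
  -- expansion the terms in `f'`, `w̄` and `f(w̄)` alone have mean zero.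
  have e : kGhat d ε f * varWInv * kQ = -(kDw f * varWInv * kQ) +
      ε • ((2 * Ω) • (varWInv * kQ * (1 + ε • kDw f)) + (2 * Ω * ε) • (kFwInv f * kQ) +
        (2 * Ω * ε ^ 2) • (kFwInv f * kDw f * kQ) + c • (kQ * (1 + ε • kDw f)) +
        V * kQ * (1 + ε • kDw f)) := by
    refine ext' fun w τ => ?_
    have h := Circle.coe_ne_zero w
    simp only [kGhat, kW, ← hΩ, ← hc, ← hV, eval_mul, eval_add, eval_neg, eval_smul, eval_one,
      eval_varW, eval_varWInv, eval_kDw, eval_kFwInv, Circle.coe_inv]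
    have hw := mul_inv_cancel₀ h
    push_cast
    linear_combination ((ε : ℂ) * (2 * Ω * ((w : ℂ)⁻¹ + ε * f w⁻¹) + c + V.eval w τ) *
      (1 + ε * circleDeriv f w) * (kQ : Ker β).eval w τ) * hw
  have hm := mul_kC hd hε hf
  have hpos := one_sub_mul_kT₂_pos hd hε hf
  have hd0 : d ≠ 0 := by linarith
  have h1 := congrArg Complex.re (kT₁.eq_1 d ε f)
  have h2 := congrArg Complex.re (kT₂.eq_1 d ε f)
  have h3 : c * (1 - ε * (kT₂ d ε f).re) =
      -(1 / (2 * d)) * ((kT₁ d ε f).re + (kT₂ d ε f).re) := by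
    have : 1 - ε * (kT₂ d ε f).re ≠ 0 := by linarith
    rw [hc, kC, mul_assoc, div_mul_cancel₀ _ this]
  rw [e, map_add, map_neg, map_smul, map_add, map_add, map_add, map_add, map_smul, map_smul,
    map_smul, map_smul, meanW_kDw_mul, meanW_varWInv_mul, meanW_kFwInv_mul, meanW_kQ_mul]
  rw [← hV] at h1
  rw [← hΩ, ← hc] at hm
  simp only [Complex.add_re, Complex.neg_re, Complex.smul_re, smul_eq_mul, Complex.one_re,
    Complex.re_ofReal_mul, smul_zero, neg_zero, zero_add] at h1 h2 ⊢
  generalize (meanW (V * kQ * (1 + ε • kDw f))).re = mV at *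
  generalize (meanW (kFwInv f * kDw f * kQ : Ker β)).re = J at *
  generalize (meanW (kFw f : Ker β)).re = m at *
  generalize (kT₁ d ε f).re = t₁ at *
  generalize (kT₂ d ε f).re = t₂ at *
  have hJ : ε ^ 2 * J = d * (t₂ + m) := by rw [h2]; field_simp; ring
  have hV' : mV = (t₁ - m) / (2 * d) := by rw [h1]; field_simp; ring
  -- The solvability condition. Once `J` and `mV` are expressed through `T₂` and `T₁`, it is the
  -- linear equation of which the chosen `Ω` and `c` are the solution.
  have : 2 * Ω * (ε ^ 2 * J) + c * (1 + ε * m) + mV = 0 := by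
    rw [hJ, hV']
    have e3 : (2 * d) * (1 / (2 * d)) = 1 := by field_simp
    have e4 : (t₁ - m) / (2 * d) = (t₁ - m) * (1 / (2 * d)) := by ring
    rw [e4]
    linear_combination (t₂ + m) * hm + h3
  linear_combination ε * this

/-- Inversion preserves the angle measure and `Re (w ^ n)` but reverses `g`. -/
lemma cosCoef_eq_zero {g : Circle → ℝ} (hg : ∀ w, g w⁻¹ = -g w) (n : ℕ) : cosCoef g n = 0 := by
  have h : cint (fun w => g w * ((w : ℂ) ^ n).re) = -cint (fun w => g w * ((w : ℂ) ^ n).re) := by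
    have h1 : cint (fun w => (-1) * (g w * ((w : ℂ) ^ n).re)) =
        cint (fun w => g w * ((w : ℂ) ^ n).re) := by
      rw [← cint_inv (fun w => g w * ((w : ℂ) ^ n).re)]
      congr 1
      funext w
      rw [hg, Circle.coe_inv_eq_conj, ← map_pow, Complex.conj_re]
      ring
    rw [cint_const_mul_real] at h1
    linarith
  have h2 : cint (fun w => g w * ((w : ℂ) ^ n).re) = 0 := by linarith
  rw [cosCoef]
  exact mul_eq_zero_of_right _ h2

/-- `w · w̄ (w̄ - w) = -2i Im w`, and multiplying by `H w` gives the real part `2 Im w · Im (H w)`.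
-/
lemma sinCoef_one_im {H : Circle → ℂ} (hH : Continuous H) :
    sinCoef (fun w => (H w).im) 1 =
      (mean fun w => H w * (w⁻¹ : Circle) * ((w⁻¹ : Circle) - (w : ℂ))).re := by
  have h1 : (fun w : Circle => (w : ℂ) * (H w * (w⁻¹ : Circle) * ((w⁻¹ : Circle) - (w : ℂ)))) =
      fun w => H w * (-2 * (w : ℂ).im * I) := by
    funext w
    have h := Circle.coe_ne_zero w
    have h2 : ((w⁻¹ : Circle) : ℂ) - w = -2 * (w : ℂ).im * I := by
      rw [Circle.coe_inv_eq_conj]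
      apply Complex.ext <;> simp
      ring
    rw [h2, Circle.coe_inv]
    field_simp
  have hc : Continuous fun w : Circle => H w * (-2 * (w : ℂ).im * I) := by fun_prop
  have h2 : ((2 * Real.pi : ℂ)⁻¹) = (((2 * Real.pi)⁻¹ : ℝ) : ℂ) := by push_cast; rfl
  have h3 : (fun w : Circle => (H w * (-2 * (w : ℂ).im * I)).re) =
      fun w => 2 * ((H w).im * ((w : ℂ) ^ 1).im) := by
    funext w
    simp
    ring
  rw [mean_eq_cint, h1, h2, Complex.re_ofReal_mul, cint_re hc, h3, cint_const_mul_real, sinCoef]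
  change Real.pi⁻¹ * cint (fun w => (H w).im * ((w : ℂ) ^ 1).im) = _
  have := Real.pi_ne_zero
  field_simp

lemma continuous_eval_kGhat : Continuous fun w => (kGhat d ε f).eval w 1 :=
  continuous_swap_eval _

lemma sinCoef_Ghat (hd : 2 < d) (hε : |ε| < 1 / 2) (hf : ‖f‖ < 1) :
    sinCoef (Ghat d ε f) 1 = 0 := by
  have h : Ghat d ε f = fun w => ((kGhat d ε f).eval w 1).im :=
    funext fun w => Ghat_eq hd hε hf w 1
  rw [h, sinCoef_one_im continuous_eval_kGhat, ← re_meanW_kGhat hd hε hf, meanW_apply]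
  congr 2

end AngularVelocity

/-! ### The space `Ŷ` -/

namespace Yhat

variable {β : ℝ≥0}

/-- The element of `Ŷ` given by a function. -/
def mk (g : C(Circle, ℝ)) (h : g ∈ YhatSubmodule β) : Yhat β := ⟨g, h⟩

@[simp] lemma mk_apply (g : C(Circle, ℝ)) (h : g ∈ YhatSubmodule β) (w : Circle) :
    mk g h w = g w := rfl

lemma ext' {g h : Yhat β} (H : ∀ w, g w = h w) : g = h := DFunLike.ext _ _ H

lemma add_apply (g h : Yhat β) (w : Circle) : (g + h) w = g w + h w := rfl

lemma smul_apply (c : ℝ) (g : Yhat β) (w : Circle) : (c • g) w = c * g w := rfl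

lemma continuous (g : Yhat β) : Continuous g := (incl g).continuous

lemma norm_apply_le (g : Yhat β) (w : Circle) : ‖g w‖ ≤ ‖g‖ := by
  rw [norm_def]
  exact ((incl g).norm_coe_le_norm w).trans (le_add_of_nonneg_right (NNReal.coe_nonneg _))

lemma norm_sub_le (g : Yhat β) (p q : Circle) : ‖g p - g q‖ ≤ ‖g‖ * dist p q ^ (β : ℝ) := by
  have h := g.memHolder.holderWith.dist_le p q
  rw [dist_eq_norm] at h
  refine h.trans ?_
  have : (nnHolderNorm β g : ℝ) ≤ ‖g‖ := by
    rw [norm_def]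
    exact le_add_of_nonneg_left (norm_nonneg _)
  gcongr

lemma norm_le_of_bounds {g : Yhat β} {M C : ℝ} (hM : ∀ w, ‖g w‖ ≤ M) (hC : 0 ≤ C)
    (h : ∀ p q, ‖g p - g q‖ ≤ C * dist p q ^ (β : ℝ)) : ‖g‖ ≤ M + C := by
  have hM0 : 0 ≤ M := (norm_nonneg _).trans (hM 1)
  rw [norm_def]
  refine add_le_add ((ContinuousMap.norm_le _ hM0).2 hM) ?_
  have h1 : HolderWith ⟨C, hC⟩ β g := holderWith_of_dist_le fun p q => by
    rw [dist_eq_norm]; exact h p q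
  exact_mod_cast h1.nnholderNorm_le

lemma cosCoef_eq_zero (g : Yhat β) (n : ℕ) : cosCoef g n = 0 := (incl_mem g).1.2 n

lemma sinCoef_one_eq_zero (g : Yhat β) : sinCoef g 1 = 0 := (incl_mem g).2

end Yhat

/-! ### The projection onto `Ŷ` -/

section Projection

variable {β : ℝ≥0} [Fact (0 < β)] [Fact (β < 1)]

/-- The imaginary part of the average of a kernel with respect to `τ`. -/
def avgIm (K : Ker β) (w : Circle) : ℝ := (2 * Real.pi)⁻¹ * cint (fun τ => (K.eval w τ).im)

lemma continuous_im_eval (K : Ker β) (w : Circle) : Continuous fun τ => (K.eval w τ).im :=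
  Complex.continuous_im.comp (K.continuous_eval_right w)

lemma avgIm_add (K K' : Ker β) (w : Circle) : avgIm (K + K') w = avgIm K w + avgIm K' w := by
  simp only [avgIm, eval_add, Complex.add_im]
  rw [cint_add (continuous_im_eval K w) (continuous_im_eval K' w), mul_add]

lemma avgIm_smul (c : ℝ) (K : Ker β) (w : Circle) : avgIm (c • K) w = c * avgIm K w := by
  simp only [avgIm, eval_smul, Complex.im_ofReal_mul]
  rw [cint_const_mul_real]
  ring

lemma continuous_avgIm (K : Ker β) : Continuous (avgIm K) := by
  have h : avgIm K = fun w => (2 * Real.pi)⁻¹ * (cint (K.eval w)).im :=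
    funext fun w => by rw [avgIm, cint_im (K.continuous_eval_right w)]
  rw [h]
  exact continuous_const.mul
    (Complex.continuous_im.comp (continuous_cint_param K.continuous_eval))

lemma avgIm_of_const {K : Ker β} {w : Circle} {x : ℝ} (h : ∀ τ, (K.eval w τ).im = x) :
    avgIm K w = x := by
  simp only [avgIm, h]
  rw [cint_const, smul_eq_mul]
  have := Real.pi_ne_zero
  field_simp

lemma norm_avgIm_le (K : Ker β) (w : Circle) : ‖avgIm K w‖ ≤ ‖K‖ := by
  rw [avgIm, norm_mul, norm_inv, Real.norm_of_nonneg Real.two_pi_pos.le,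
    inv_mul_le_iff₀ Real.two_pi_pos]
  exact norm_cint_le_of_le fun τ => (Complex.abs_im_le_norm _).trans (K.norm_eval_le w τ)

lemma norm_avgIm_sub_le (K : Ker β) (w₁ w₂ : Circle) :
    ‖avgIm K w₁ - avgIm K w₂‖ ≤ ‖K‖ * dist w₁ w₂ ^ (β : ℝ) := by
  have hp := Real.two_pi_pos
  have h0 := K.cint_eval_sub_le w₁ w₂
  have hc : Continuous fun τ => K.eval w₁ τ - K.eval w₂ τ :=
    (K.continuous_eval_right w₁).sub (K.continuous_eval_right w₂)
  have h1 : ‖cint (fun τ => (K.eval w₁ τ).im - (K.eval w₂ τ).im)‖ ≤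
      cint (fun τ => ‖K.eval w₁ τ - K.eval w₂ τ‖) := by
    have h2 := cint_im hc
    simp only [Complex.sub_im] at h2
    rw [← h2]
    exact (Complex.abs_im_le_norm _).trans
      (intervalIntegral.norm_integral_le_integral_norm hp.le)
  rw [avgIm, avgIm, ← mul_sub, ← cint_sub (continuous_im_eval K w₁) (continuous_im_eval K w₂),
    norm_mul, norm_inv, Real.norm_of_nonneg hp.le, inv_mul_le_iff₀ hp]
  have h3 : 0 ≤ ‖K‖ * dist w₁ w₂ ^ (β : ℝ) := by positivity
  have h4 : (1 : ℝ) ≤ 2 * Real.pi := by linarith [Real.pi_gt_three]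
  nlinarith

lemma sinCoef_eq_cint (g : Circle → ℝ) :
    sinCoef g 1 = Real.pi⁻¹ * cint (fun w => g w * (w : ℂ).im) := by
  simp only [sinCoef, pow_one]
  rfl

lemma sinCoef_im : sinCoef (fun w => (w : ℂ).im) 1 = 1 := by
  rw [sinCoef]
  simp only [pow_one, Circle.coe_exp, Complex.exp_ofReal_mul_I_im]
  have h := integral_sin_sq (a := 0) (b := 2 * Real.pi)
  simp only [pow_two] at h
  rw [h]
  have := Real.pi_ne_zero
  simp

lemma norm_sinCoef_le {g : Circle → ℝ} {M : ℝ} (h : ∀ w, ‖g w‖ ≤ M) : ‖sinCoef g 1‖ ≤ 2 * M := by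
  have hM : 0 ≤ M := (norm_nonneg _).trans (h 1)
  rw [sinCoef_eq_cint, norm_mul, norm_inv, Real.norm_of_nonneg Real.pi_pos.le,
    inv_mul_le_iff₀ Real.pi_pos]
  have h1 := norm_cint_le_of_le (g := fun w : Circle => g w * (w : ℂ).im) (C := M) fun w => by
    rw [norm_mul]
    have : ‖(w : ℂ).im‖ ≤ 1 := (Complex.abs_im_le_norm _).trans (Circle.norm_coe w).le
    calc _ ≤ M * 1 := by gcongr; exact h w
      _ = M := mul_one M
  linarith

/-- The odd part of the averaged imaginary part, without its first sine mode. -/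
def projFun (K : Ker β) (w : Circle) : ℝ :=
  (avgIm K w - avgIm K w⁻¹) / 2 - sinCoef (avgIm K) 1 * (w : ℂ).im

lemma continuous_projFun (K : Ker β) : Continuous (projFun K) := by
  have h := continuous_avgIm K
  have h2 : Continuous fun w : Circle => avgIm K w⁻¹ := h.comp continuous_inv
  unfold projFun
  fun_prop

lemma norm_projFun_le (K : Ker β) (w : Circle) : ‖projFun K w‖ ≤ 3 * ‖K‖ := by
  have h1 := abs_le.1 (norm_avgIm_le K w)
  have h2 := abs_le.1 (norm_avgIm_le K w⁻¹)
  have h3 : ‖sinCoef (avgIm K) 1 * (w : ℂ).im‖ ≤ 2 * ‖K‖ * 1 := by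
    rw [norm_mul]
    gcongr
    · exact norm_sinCoef_le (norm_avgIm_le K)
    · exact (Complex.abs_im_le_norm _).trans (Circle.norm_coe w).le
  have h4 := abs_le.1 h3
  rw [Real.norm_eq_abs, abs_le, projFun]
  constructor <;> linarith

lemma norm_projFun_sub_le (K : Ker β) (p q : Circle) :
    ‖projFun K p - projFun K q‖ ≤ 5 * ‖K‖ * dist p q ^ (β : ℝ) := by
  have h1 := abs_le.1 (norm_avgIm_sub_le K p q)
  have h2 := norm_avgIm_sub_le K p⁻¹ q⁻¹
  rw [dist_inv_circle] at h2
  replace h2 := abs_le.1 h2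
  have h3 : ‖sinCoef (avgIm K) 1 * ((p : ℂ) - q).im‖ ≤
      2 * ‖K‖ * (2 * dist p q ^ (β : ℝ)) := by
    rw [norm_mul]
    gcongr
    · exact norm_sinCoef_le (norm_avgIm_le K)
    · refine (Complex.abs_im_le_norm _).trans ?_
      rw [← dist_eq_norm_coe]
      exact dist_le_two_mul_rpow Fact.out p q
  have h4 := abs_le.1 h3
  rw [Complex.sub_im] at h4
  rw [Real.norm_eq_abs, abs_le, projFun, projFun]
  constructor <;> nlinarith

/-- Oddness removes the cosines. Inversion flips the first sine coefficient, so passing to the odd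
part does not change it, and the multiple of `Im w` then cancels it. -/
lemma projFun_mem (K : Ker β) : (⟨projFun K, continuous_projFun K⟩ : C(Circle, ℝ)) ∈
    YhatSubmodule β := by
  refine ⟨⟨⟨⟨5 * ‖K‖, by positivity⟩, holderWith_of_dist_le fun p q => ?_⟩, fun n => ?_⟩, ?_⟩
  · rw [dist_eq_norm]
    exact norm_projFun_sub_le K p q
  · refine cosCoef_eq_zero (fun w => ?_) n
    simp only [ContinuousMap.coe_mk, projFun, inv_inv, Circle.coe_inv_eq_conj, Complex.conj_im]
    ring
  · have hc := continuous_avgIm K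
    have hci : Continuous fun w : Circle => avgIm K w⁻¹ := hc.comp continuous_inv
    have e : (projFun K : Circle → ℝ) = (1 / 2 : ℝ) • avgIm K +
        ((-1 / 2 : ℝ) • (fun w : Circle => avgIm K w⁻¹) +
        (-sinCoef (avgIm K) 1) • fun w : Circle => (w : ℂ).im) := by
      funext w
      simp only [projFun, Pi.add_apply, Pi.smul_apply, smul_eq_mul]
      ring
    have h1 : sinCoef (fun w => avgIm K w⁻¹) 1 = -sinCoef (avgIm K) 1 := by
      have h2 : (fun w : Circle => avgIm K w⁻¹ * (w : ℂ).im) =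
          fun w => (-1) * (fun w : Circle => avgIm K w * (w : ℂ).im) w⁻¹ := by
        funext w
        simp only [Circle.coe_inv_eq_conj, Complex.conj_im]
        ring
      have h3 := cint_inv fun w : Circle => avgIm K w * (w : ℂ).im
      have h4 := cint_const_mul_real (-1) fun w : Circle =>
        (fun w : Circle => avgIm K w * (w : ℂ).im) w⁻¹
      rw [sinCoef_eq_cint, sinCoef_eq_cint, h2, h4, h3]
      ring
    change sinCoef (projFun K) 1 = 0
    rw [e, sinCoef_add (hc.const_smul _) (by fun_prop), sinCoef_add (by fun_prop) (by fun_prop),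
      sinCoef_smul, sinCoef_smul, sinCoef_smul, h1, sinCoef_im]
    ring

lemma projFun_add (K K' : Ker β) (w : Circle) :
    projFun (K + K') w = projFun K w + projFun K' w := by
  have h : avgIm (K + K') = avgIm K + avgIm K' := funext (avgIm_add K K')
  rw [projFun, h, sinCoef_add (continuous_avgIm K) (continuous_avgIm K'), projFun, projFun]
  simp only [Pi.add_apply]
  ring

lemma projFun_smul (c : ℝ) (K : Ker β) (w : Circle) : projFun (c • K) w = c * projFun K w := by
  have h : avgIm (c • K) = c • avgIm K := funext (avgIm_smul c K)
  rw [projFun, h, sinCoef_smul, projFun]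
  simp only [Pi.smul_apply, smul_eq_mul]
  ring

/-- The projection of the kernels onto `Ŷ`. -/
def proj : Ker β →L[ℝ] Yhat β :=
  LinearMap.mkContinuous
    { toFun := fun K => Yhat.mk ⟨projFun K, continuous_projFun K⟩ (projFun_mem K)
      map_add' := fun K K' => Yhat.ext' fun w => projFun_add K K' w
      map_smul' := fun c K => Yhat.ext' fun w => projFun_smul c K w } (3 + 5) fun K => by
    rw [add_mul]
    exact Yhat.norm_le_of_bounds (norm_projFun_le K) (by positivity) (norm_projFun_sub_le K)

lemma proj_apply (K : Ker β) (w : Circle) : proj K w = projFun K w := rfl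

/-- The projection reproduces what already lies in `Ŷ`. Composing with it gives a map into `Ŷ` that
is defined for all parameters, inherits the smoothness of the kernels, and agrees with `Ĝ` in the
admissible range. -/
lemma proj_apply_of_odd {K : Ker β} {g : Circle → ℝ} (hK : ∀ w τ, (K.eval w τ).im = g w)
    (hg : ∀ w, g w⁻¹ = -g w) (h1 : sinCoef g 1 = 0) (w : Circle) : proj K w = g w := by
  have h : avgIm K = g := funext fun w => avgIm_of_const (hK w)
  rw [proj_apply, projFun, h, hg, h1]
  ring

variable {d ε : ℝ} {f : X β}

lemma proj_kGhat_apply (hd : 2 < d) (hε : |ε| < 1 / 2) (hf : ‖f‖ < 1) (w : Circle) :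
    proj (kGhat d ε f) w = Ghat d ε f w :=
  proj_apply_of_odd (fun w τ => (Ghat_eq hd hε hf w τ).symm) (Ghat_inv d ε f)
    (sinCoef_Ghat hd hε hf) w

lemma GhatMap_apply (hd : 2 < d) (hε : |ε| < 1 / 2) (hf : ‖f‖ < 1) (w : Circle) :
    GhatMap d β ε f w = Ghat d ε f w := by
  have h : ∃ g : Yhat β, ∀ w, g w = Ghat d ε f w := ⟨_, proj_kGhat_apply hd hε hf⟩
  rw [GhatMap, dif_pos h]
  exact h.choose_spec w

lemma GhatMap_eq (hd : 2 < d) (hε : |ε| < 1 / 2) (hf : ‖f‖ < 1) :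
    GhatMap d β ε f = proj (kGhat d ε f) :=
  Yhat.ext' fun w => by rw [GhatMap_apply hd hε hf, proj_kGhat_apply hd hε hf]

end Projection

/-! ### Hölder continuity of singular integrals on the circle -/

/-- Integrability on the circle with respect to the angle. -/
def CIntegrable {E : Type*} [NormedAddCommGroup E] (g : Circle → E) : Prop :=
  IntervalIntegrable (fun θ : ℝ => g (Circle.exp θ)) volume 0 (2 * Real.pi)

section CIntegrable

variable {E : Type*} [NormedAddCommGroup E] {g : Circle → E}

lemma periodic_comp_exp (g : Circle → E) :
    Function.Periodic (fun θ : ℝ => g (Circle.exp θ)) (2 * Real.pi) := fun θ => by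
  simp only [Circle.exp_add_two_pi]

lemma cintegrable_of_symm
    (h : IntervalIntegrable (fun θ : ℝ => g (Circle.exp θ)) volume (-Real.pi) Real.pi) :
    CIntegrable g := by
  refine (periodic_comp_exp g).intervalIntegrable Real.two_pi_pos.ne' (t := -Real.pi) ?_ _ _
  convert h using 1
  ring

lemma CIntegrable.intervalIntegrable (h : CIntegrable g) (a b : ℝ) :
    IntervalIntegrable (fun θ : ℝ => g (Circle.exp θ)) volume a b :=
  (periodic_comp_exp g).intervalIntegrable Real.two_pi_pos.ne' (t := 0)
    (by rw [zero_add]; exact h) a b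

lemma CIntegrable.mul_left (h : CIntegrable g) (σ : Circle) :
    CIntegrable fun τ => g (σ * τ) := by
  obtain ⟨a, rfl⟩ := Circle.exp_surjective σ
  have h1 := (h.intervalIntegrable (0 + a) (2 * Real.pi + a)).comp_add_right a
  simp only [add_sub_cancel_right] at h1
  refine IntervalIntegrable.congr (fun θ _ => ?_) h1
  simp only [Circle.exp_add, mul_comm]

lemma cintegrable_of_bound [MeasurableSpace E] [BorelSpace E] [SecondCountableTopology E]
    (w : Circle) (hg : Measurable fun s : ℝ => g (w * Circle.exp s)) {φ : ℝ → ℝ}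
    (hφ : IntervalIntegrable φ volume (-Real.pi) Real.pi)
    (h : ∀ s, |s| ≤ Real.pi → s ≠ 0 → ‖g (w * Circle.exp s)‖ ≤ φ s) : CIntegrable g := by
  have h1 : CIntegrable fun τ => g (w * τ) := by
    refine cintegrable_of_symm (hφ.mono_fun' hg.aestronglyMeasurable ?_)
    rw [Filter.EventuallyLE, ae_restrict_iff' measurableSet_uIoc]
    filter_upwards [compl_mem_ae_iff.2 (measure_singleton (0 : ℝ))] with s hs hs'
    rw [uIoc_of_le (by linarith [Real.pi_pos])] at hs'
    exact h s (abs_le.2 ⟨hs'.1.le, hs'.2⟩) hs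
  have h2 := h1.mul_left w⁻¹
  simpa using h2

lemma Continuous.cintegrable (hg : Continuous g) : CIntegrable g := intervalIntegrable_circle hg _ _

end CIntegrable

/-- The kernel which controls differences of singular integrals at distance `δ`. -/
def diffKernel (β δ : ℝ) (σ : Circle) : ℝ := dist σ 1 ^ (β - 1) * (δ / (dist σ 1 + δ))

section DiffKernel

variable {β δ : ℝ}

lemma diffKernel_nonneg (hδ : 0 < δ) (σ : Circle) : 0 ≤ diffKernel β δ σ := by
  unfold diffKernel
  positivity

lemma diffKernel_exp_le (hβ₁ : β < 1) (hδ : 0 < δ) {s : ℝ} (hs : |s| ≤ Real.pi) (hs0 : s ≠ 0) :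
    diffKernel β δ (Circle.exp s) ≤
      (2 / Real.pi) ^ (β - 2) * (|s| ^ (β - 1) * (δ / (|s| + δ))) := by
  have hp := Real.pi_pos
  have hs1 : 0 < |s| := abs_pos.2 hs0
  have h1 := dist_exp_rpow_le hs hs0 (by linarith : β - 1 ≤ 0)
  have h2 := two_div_pi_mul_le hs
  have h3 : δ / (dist (Circle.exp s) 1 + δ) ≤ (2 / Real.pi)⁻¹ * (δ / (|s| + δ)) := by
    have h4 : 2 / Real.pi ≤ 1 := by rw [div_le_one hp]; exact Real.two_le_pi
    have h5 : 2 / Real.pi * (|s| + δ) ≤ dist (Circle.exp s) 1 + δ := by nlinarith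
    calc _ ≤ δ / (2 / Real.pi * (|s| + δ)) := by gcongr
      _ = _ := by field_simp
  have h6 : (2 / Real.pi) ^ (β - 2) = (2 / Real.pi) ^ (β - 1) * (2 / Real.pi)⁻¹ := by
    rw [← div_eq_mul_inv, ← Real.rpow_sub_one (by positivity)]
    ring_nf
  calc diffKernel β δ (Circle.exp s) ≤ ((2 / Real.pi) ^ (β - 1) * |s| ^ (β - 1)) *
        ((2 / Real.pi)⁻¹ * (δ / (|s| + δ))) := by
        unfold diffKernel
        gcongr
    _ = _ := by rw [h6]; ring

lemma intervalIntegrable_abs_rpow_mul (hβ : 0 < β) (hδ : 0 < δ) (a b : ℝ) :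
    IntervalIntegrable (fun s : ℝ => |s| ^ (β - 1) * (δ / (|s| + δ))) volume a b := by
  refine (intervalIntegrable_abs_rpow (by linarith) a b).mul_continuousOn
    (Continuous.continuousOn ?_)
  refine continuous_const.div (by fun_prop) fun s => ?_
  positivity

lemma cintegrable_diffKernel (hβ : 0 < β) (hβ₁ : β < 1) (hδ : 0 < δ) :
    CIntegrable (diffKernel β δ) := by
  refine cintegrable_of_bound 1 ?_
    ((intervalIntegrable_abs_rpow_mul hβ hδ _ _).const_mul ((2 / Real.pi) ^ (β - 2)))
    fun s hs hs0 => ?_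
  · unfold diffKernel
    have : Measurable fun s : ℝ => dist (1 * Circle.exp s) 1 :=
      Continuous.measurable (by fun_prop)
    fun_prop
  · rw [one_mul, Real.norm_of_nonneg (diffKernel_nonneg hδ _)]
    exact diffKernel_exp_le hβ₁ hδ hs hs0

/-- Split at `s = δ`. Below, the fraction is at most `1`, and `s ^ (β - 1)` integrates to `δ ^ β /
β`. Above, it is at most `δ / s`, and `δ s ^ (β - 2)` integrates to at most `δ ^ β / (1 - β)`. -/
lemma integral_abs_rpow_mul_le (hβ : 0 < β) (hβ₁ : β < 1) (hδ : 0 < δ) (hδ₁ : δ ≤ Real.pi) :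
    ∫ s in (0 : ℝ)..Real.pi, |s| ^ (β - 1) * (δ / (|s| + δ)) ≤ (1 / β + 1 / (1 - β)) * δ ^ β := by
  have hi := intervalIntegrable_abs_rpow_mul hβ hδ
  rw [← intervalIntegral.integral_add_adjacent_intervals (hi 0 δ) (hi δ Real.pi), add_mul]
  have h0 : (0 : ℝ) ∉ Set.uIcc δ Real.pi := by
    rw [uIcc_of_le hδ₁]
    exact fun h => absurd h.1 (not_le.2 hδ)
  refine add_le_add ?_ ?_
  · have h1 : ∫ s in (0 : ℝ)..δ, s ^ (β - 1) = 1 / β * δ ^ β := by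
      rw [integral_rpow (Or.inl (by linarith)), sub_add_cancel, Real.zero_rpow hβ.ne']
      ring
    rw [← h1]
    refine intervalIntegral.integral_mono_on hδ.le (hi 0 δ)
      (intervalIntegral.intervalIntegrable_rpow' (by linarith)) fun s hs => ?_
    rw [abs_of_nonneg hs.1]
    have h2 : δ / (s + δ) ≤ 1 := by
      rw [div_le_one (by linarith [hs.1])]
      linarith [hs.1]
    have h3 : 0 ≤ s ^ (β - 1) := Real.rpow_nonneg hs.1 _
    nlinarith
  · have h1 : ∫ s in δ..Real.pi, δ * s ^ (β - 2) ≤ 1 / (1 - β) * δ ^ β := by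
      rw [intervalIntegral.integral_const_mul, integral_rpow (Or.inr ⟨by linarith, h0⟩)]
      have e1 : δ ^ (β - 2 + 1) = δ ^ β / δ := by
        rw [← Real.rpow_sub_one hδ.ne']
        ring_nf
      have e2 : 0 ≤ Real.pi ^ (β - 2 + 1) := by positivity
      have e3 : (Real.pi ^ (β - 2 + 1) - δ ^ (β - 2 + 1)) / (β - 2 + 1) =
          1 / (1 - β) * (δ ^ β / δ - Real.pi ^ (β - 2 + 1)) := by
        have : 1 - β ≠ 0 := by linarith
        have : β - 2 + 1 ≠ 0 := by intro h; exact absurd h (by linarith)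
        rw [e1]
        field_simp
        ring
      have e4 : 0 < 1 / (1 - β) := by
        have : 0 < 1 - β := by linarith
        positivity
      rw [e3]
      have e5 : δ * (δ ^ β / δ) = δ ^ β := by field_simp
      nlinarith [mul_nonneg (mul_nonneg hδ.le e4.le) e2]
    refine le_trans (intervalIntegral.integral_mono_on hδ₁ (hi δ Real.pi)
      ((intervalIntegral.intervalIntegrable_rpow (Or.inr h0)).const_mul δ) fun s hs => ?_) h1
    have hs0 : 0 < s := hδ.trans_le hs.1
    rw [abs_of_pos hs0]
    have e1 : s ^ (β - 2) = s ^ (β - 1) / s := by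
      rw [← Real.rpow_sub_one hs0.ne']
      ring_nf
    have e2 : δ / (s + δ) ≤ δ / s := by gcongr; linarith
    calc s ^ (β - 1) * (δ / (s + δ)) ≤ s ^ (β - 1) * (δ / s) := by gcongr
      _ = _ := by rw [e1]; ring

/-- The constant in the bound for the integral of `diffKernel`. -/
def diffConst (β : ℝ) : ℝ := 2 * (2 / Real.pi) ^ (β - 2) * (1 / β + 1 / (1 - β))

lemma diffConst_nonneg (hβ : 0 < β) (hβ₁ : β < 1) : 0 ≤ diffConst β := by
  have : 0 < 1 - β := by linarith
  unfold diffConst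
  have := Real.pi_pos
  positivity

lemma cint_diffKernel_le (hβ : 0 < β) (hβ₁ : β < 1) (hδ : 0 < δ) (hδ₁ : δ ≤ 2) :
    cint (diffKernel β δ) ≤ diffConst β * δ ^ β := by
  have hi := intervalIntegrable_abs_rpow_mul hβ hδ
  refine (Real.le_norm_self _).trans ((norm_cint_le_integral 1
    ((hi _ _).const_mul ((2 / Real.pi) ^ (β - 2))) fun s hs hs0 => ?_).trans ?_)
  · rw [one_mul, Real.norm_of_nonneg (diffKernel_nonneg hδ _)]
    exact diffKernel_exp_le hβ₁ hδ hs hs0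
  · have h := integral_abs_rpow_mul_le hβ hβ₁ hδ (hδ₁.trans Real.two_le_pi)
    have h2 := intervalIntegral.integral_comp_neg (a := 0) (b := Real.pi)
      fun s : ℝ => |s| ^ (β - 1) * (δ / (|s| + δ))
    simp only [abs_neg, neg_zero] at h2
    rw [intervalIntegral.integral_const_mul,
      ← intervalIntegral.integral_add_adjacent_intervals (hi (-Real.pi) 0) (hi 0 Real.pi), ← h2,
      diffConst]
    have : 0 ≤ (2 / Real.pi) ^ (β - 2) := by
      have := Real.pi_pos
      positivity
    nlinarith

end DiffKernel

section Privalov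

variable {β H : ℝ} {g : Circle → ℂ}

/-- The kernel of the singular integral at `w`. -/
def cauchyKernel (g : Circle → ℂ) (w τ : Circle) : ℂ := τ * ((g τ - g w) / ((τ : ℂ) - w))

lemma rotDiff_one_eq (g : Circle → ℂ) (w : Circle) : rotDiff 1 g w = cint (cauchyKernel g w) := by
  rw [rotDiff, ← cint_mul_right (cauchyKernel g w) w]
  congr 1
  funext σ
  have hw := Circle.coe_ne_zero w
  have h : ((σ * w : Circle) : ℂ) - w = (σ - 1) * w := by rw [Circle.coe_mul]; ring
  rw [cauchyKernel, h, zpow_one, Circle.coe_mul]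
  rcases eq_or_ne σ 1 with rfl | hσ
  · simp
  · have h1 : (σ : ℂ) - 1 ≠ 0 := by
      have := coe_sub_ne_zero hσ
      rwa [Circle.coe_one] at this
    field_simp

lemma norm_cauchyKernel_le (hg : ∀ p q, ‖g p - g q‖ ≤ H * dist p q ^ β) {w τ : Circle}
    (h : τ ≠ w) : ‖cauchyKernel g w τ‖ ≤ H * dist τ w ^ (β - 1) := by
  have hd : 0 < dist τ w := dist_pos.2 h
  rw [cauchyKernel, norm_mul, Circle.norm_coe, one_mul, norm_div, ← dist_eq_norm_coe,
    div_le_iff₀ hd, Real.rpow_sub_one hd.ne', mul_assoc, div_mul_cancel₀ _ hd.ne']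
  exact hg τ w

lemma cintegrable_cauchyKernel (hβ : 0 < β) (hβ₁ : β < 1) (hH : 0 ≤ H) (hgc : Continuous g)
    (hg : ∀ p q, ‖g p - g q‖ ≤ H * dist p q ^ β) (w : Circle) :
    CIntegrable (cauchyKernel g w) := by
  refine cintegrable_of_bound w ?_
    (((intervalIntegrable_abs_rpow (r := β - 1) (by linarith) _ _).const_mul
      ((2 / Real.pi) ^ (β - 1))).const_mul H) fun s hs hs0 => ?_
  · have hm1 : Measurable fun s : ℝ => g (w * Circle.exp s) - g w :=
      Continuous.measurable (by fun_prop)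
    have hm2 : Measurable fun s : ℝ => ((w * Circle.exp s : Circle) : ℂ) - w :=
      Continuous.measurable (by fun_prop)
    have hm3 : Measurable fun s : ℝ => ((w * Circle.exp s : Circle) : ℂ) :=
      Continuous.measurable (by fun_prop)
    exact hm3.mul (hm1.div hm2)
  · have hne : w * Circle.exp s ≠ w := fun h => exp_ne_one hs hs0 (by simpa using h)
    refine (norm_cauchyKernel_le hg hne).trans ?_
    rw [dist_mul_exp]
    exact mul_le_mul_of_nonneg_left (dist_exp_rpow_le hs hs0 (by linarith)) hH

lemma norm_rotDiff_one_le (hβ : 0 < β) (hβ₁ : β < 1) (hH : 0 ≤ H)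
    (hg : ∀ p q, ‖g p - g q‖ ≤ H * dist p q ^ β) (w : Circle) :
    ‖rotDiff 1 g w‖ ≤ H * singConst β := by
  rw [rotDiff_one_eq]
  exact norm_cint_le_of_singular hβ hβ₁ hH w fun τ hτ => norm_cauchyKernel_le hg hτ

/-- Cauchy's theorem: the pole lies outside the closed disc. -/
lemma cint_div_sub_eq_zero {z₀ : ℂ} (hz : 1 < ‖z₀‖) :
    cint (fun τ : Circle => (τ : ℂ) / (τ - z₀)) = 0 := by
  have h1 : ∮ z in C(0, 1), (z - z₀)⁻¹ = 0 := by
    refine DiffContOnCl.circleIntegral_eq_zero zero_le_one (DifferentiableOn.diffContOnCl ?_)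
    intro z hz1
    rw [closure_ball 0 one_ne_zero, mem_closedBall_zero_iff] at hz1
    refine DifferentiableAt.differentiableWithinAt (DifferentiableAt.inv (by fun_prop) ?_)
    intro h
    rw [sub_eq_zero.1 h] at hz1
    linarith
  have h2 : ∮ z in C(0, 1), (z - z₀)⁻¹ = I * cint (fun τ : Circle => (τ : ℂ) / (τ - z₀)) := by
    rw [circleIntegral, cint, ← intervalIntegral.integral_const_mul]
    refine intervalIntegral.integral_congr fun θ _ => ?_
    simp only [deriv_circleMap, smul_eq_mul, circleMap, Circle.coe_exp]
    simp only [ofReal_one, one_mul, zero_add]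
    ring
  rw [h1] at h2
  exact (mul_eq_zero.1 h2.symm).resolve_left I_ne_zero

/-- For `x ≤ δ` use `δ ≤ D` and `δ ^ (β - 1) ≤ x ^ (β - 1)`; for `δ ≤ x` use `δ ^ β ≤ x ^ β` and `x
/ D ≤ 3`. -/
lemma rpow_mul_div_le {x D δ : ℝ} (hβ : 0 < β) (hβ₁ : β < 1) (hx : 0 < x) (hδ : 0 < δ)
    (h1 : δ ≤ D) (h2 : x ≤ 3 * D) : δ ^ β * (x / D) ≤ 3 * x ^ β := by
  have hD : 0 < D := hδ.trans_le h1
  rcases le_total x δ with h | h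
  · have h3 : δ ^ β * (x / D) ≤ δ ^ β * (x / δ) := by gcongr
    have h4 : δ ^ β * (x / δ) = x * δ ^ (β - 1) := by rw [Real.rpow_sub_one hδ.ne']; ring
    have h5 : x * δ ^ (β - 1) ≤ x * x ^ (β - 1) := by
      gcongr ?_ * ?_
      exact Real.rpow_le_rpow_of_nonpos hx h (by linarith)
    have h6 : x * x ^ (β - 1) = x ^ β := by rw [Real.rpow_sub_one hx.ne']; field_simp
    have h7 : 0 ≤ x ^ β := by positivity
    linarith
  · have h3 : δ ^ β ≤ x ^ β := by gcongr
    have h4 : x / D ≤ 3 := by rwa [div_le_iff₀ hD]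
    calc δ ^ β * (x / D) ≤ x ^ β * 3 := by gcongr
      _ = _ := by ring

/-- As `t` is the longer side, `s + δ ≤ 2s + t ≤ 3t`, so `1/t` may be replaced by `3/(s + δ)`. -/
lemma rpow_mul_div_mul_le {s t δ A : ℝ} (hs : 0 < s) (ht : 0 < t) (hδ : 0 < δ)
    (h : δ ≤ s + t) (hst : s ≤ t) (hA : A ≤ 7 * (H * s ^ β)) (hH : 0 ≤ H) :
    A * (δ / (s * t)) ≤ 21 * H * (s ^ (β - 1) * (δ / (s + δ))) := by
  have h1 : 1 / t ≤ 3 * (1 / (s + δ)) := by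
    rw [div_le_iff₀ ht]
    rw [mul_one_div, div_mul_eq_mul_div, le_div_iff₀ (by positivity)]
    linarith
  have h2 : 0 ≤ s ^ (β - 1) := by positivity
  calc A * (δ / (s * t)) ≤ 7 * (H * s ^ β) * (δ / (s * t)) := by gcongr
    _ = 7 * H * s ^ (β - 1) * δ * (1 / t) := by rw [Real.rpow_sub_one hs.ne']; field_simp
    _ ≤ 7 * H * s ^ (β - 1) * δ * (3 * (1 / (s + δ))) := by gcongr
    _ = _ := by ring

/-- The pointwise estimate behind Privalov's theorem. -/
lemma norm_cauchyKernel_sub_sub_le (hβ : 0 < β) (hβ₁ : β < 1) (hH : 0 ≤ H)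
    (hg : ∀ p q, ‖g p - g q‖ ≤ H * dist p q ^ β) {w₁ w₂ τ : Circle} (hw : w₁ ≠ w₂)
    (h₁ : τ ≠ w₁) (h₂ : τ ≠ w₂) :
    ‖cauchyKernel g w₁ τ - cauchyKernel g w₂ τ -
        (g w₂ - g w₁) * ((τ : ℂ) / (τ - (1 + dist w₁ w₂ : ℝ) * w₁))‖ ≤
      21 * H * (diffKernel β (dist w₁ w₂) (w₁⁻¹ * τ) + diffKernel β (dist w₁ w₂) (w₂⁻¹ * τ)) := by
  set δ := dist w₁ w₂ with hδd
  have hδ : 0 < δ := dist_pos.2 hw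
  set z₀ : ℂ := (1 + δ : ℝ) * w₁ with hz₀
  set s := dist τ w₁ with hsd
  set t := dist τ w₂ with htd
  have hs : 0 < s := dist_pos.2 h₁
  have ht : 0 < t := dist_pos.2 h₂
  have hsn : ‖(τ : ℂ) - w₁‖ = s := (dist_eq_norm_coe _ _).symm
  have htn : ‖(τ : ℂ) - w₂‖ = t := (dist_eq_norm_coe _ _).symm
  have hδn : ‖(w₂ : ℂ) - w₁‖ = δ := by rw [norm_sub_rev, ← dist_eq_norm_coe]
  have hzw : ‖(w₁ : ℂ) - z₀‖ = δ := by
    have : (w₁ : ℂ) - z₀ = (-δ : ℝ) * w₁ := by rw [hz₀]; push_cast; ring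
    rw [this, norm_mul, Circle.norm_coe, mul_one, Complex.norm_real, norm_neg,
      Real.norm_of_nonneg hδ.le]
  set D := ‖(τ : ℂ) - z₀‖ with hD
  have hD1 : δ ≤ D := by
    have h := norm_sub_norm_le z₀ (τ : ℂ)
    rw [Circle.norm_coe, hz₀, norm_mul, Circle.norm_coe, Complex.norm_real,
      Real.norm_of_nonneg (by linarith), norm_sub_rev, ← hz₀] at h
    linarith
  have hD0 : 0 < D := hδ.trans_le hD1
  have hDs : s ≤ 3 * D := by
    have h := norm_sub_le ((τ : ℂ) - z₀) ((w₁ : ℂ) - z₀)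
    rw [sub_sub_sub_cancel_right, hsn, hzw] at h
    linarith
  have hc : ‖(w₂ : ℂ) - z₀‖ ≤ 2 * δ := by
    have h := norm_add_le ((w₂ : ℂ) - w₁) ((w₁ : ℂ) - z₀)
    rw [sub_add_sub_cancel, hδn, hzw] at h
    linarith
  have hDt : t ≤ 3 * D := by
    have h := norm_sub_le ((τ : ℂ) - z₀) ((w₂ : ℂ) - z₀)
    rw [sub_sub_sub_cancel_right, htn] at h
    linarith
  have hA1 := coe_sub_ne_zero h₁
  have hA2 := coe_sub_ne_zero h₂
  have hA3 : (w₂ : ℂ) - w₁ ≠ 0 := coe_sub_ne_zero hw.symm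
  have hA4 : (τ : ℂ) - z₀ ≠ 0 := norm_pos_iff.1 hD0
  -- As a function of `τ`, `m` is `0` at `w₁`, `1` at `w₂`, and has its only pole at `z₀`, at
  -- distance at least `δ` from the circle. The corrected increment `G` therefore vanishes at both
  -- points, which tames the two poles in `key`.
  set m : ℂ := ((w₂ : ℂ) - z₀) / (w₂ - w₁) * ((τ - w₁) / (τ - z₀)) with hm
  set G : ℂ := g τ - g w₁ - (g w₂ - g w₁) * m with hG
  have hm1 : m - 1 = ((w₁ : ℂ) - z₀) / (w₂ - w₁) * ((τ - w₂) / (τ - z₀)) := by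
    rw [hm]; field_simp; ring
  have key : cauchyKernel g w₁ τ - cauchyKernel g w₂ τ -
      (g w₂ - g w₁) * ((τ : ℂ) / (τ - z₀)) =
      τ * G * ((w₁ - w₂) / (((τ : ℂ) - w₁) * (τ - w₂))) := by
    rw [cauchyKernel, cauchyKernel, hG, hm]
    field_simp
    ring
  have hb : ‖g w₂ - g w₁‖ ≤ H * δ ^ β := by
    have := hg w₂ w₁
    rwa [dist_comm w₂ w₁] at this
  have hG1 : ‖G‖ ≤ 7 * (H * s ^ β) := by
    have h3 : ‖m‖ ≤ 2 * (s / D) := by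
      rw [hm, norm_mul, norm_div, norm_div, hδn, hsn]
      gcongr
      rwa [div_le_iff₀ hδ]
    have h4 := rpow_mul_div_le hβ hβ₁ hs hδ hD1 hDs
    calc ‖G‖ ≤ ‖g τ - g w₁‖ + ‖g w₂ - g w₁‖ * ‖m‖ := by
          rw [← norm_mul]; exact norm_sub_le _ _
      _ ≤ H * s ^ β + H * δ ^ β * (2 * (s / D)) := by
          gcongr
          exact hg τ w₁
      _ = H * s ^ β + 2 * H * (δ ^ β * (s / D)) := by ring
      _ ≤ H * s ^ β + 2 * H * (3 * s ^ β) := by gcongr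
      _ = _ := by ring
  have hG2 : ‖G‖ ≤ 7 * (H * t ^ β) := by
    have h3 : ‖m - 1‖ = t / D := by
      rw [hm1, norm_mul, norm_div, norm_div, hδn, htn, hzw, div_self hδ.ne', one_mul]
    have h4 := rpow_mul_div_le hβ hβ₁ ht hδ hD1 hDt
    have h5 : G = g τ - g w₂ - (g w₂ - g w₁) * (m - 1) := by rw [hG]; ring
    have h6 : 0 ≤ H * t ^ β := by positivity
    calc ‖G‖ ≤ ‖g τ - g w₂‖ + ‖g w₂ - g w₁‖ * ‖m - 1‖ := by
          rw [h5, ← norm_mul]; exact norm_sub_le _ _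
      _ ≤ H * t ^ β + H * δ ^ β * (t / D) := by
          rw [h3]
          gcongr
          exact hg τ w₂
      _ = H * t ^ β + H * (δ ^ β * (t / D)) := by ring
      _ ≤ H * t ^ β + H * (3 * t ^ β) := by gcongr
      _ ≤ _ := by linarith
  have hst : δ ≤ s + t := by
    have := dist_triangle_left w₁ w₂ τ
    linarith
  have e1 : diffKernel β δ (w₁⁻¹ * τ) = s ^ (β - 1) * (δ / (s + δ)) := by
    have : dist (w₁⁻¹ * τ) 1 = s := by
      rw [← dist_mul_left_circle w₁, mul_inv_cancel_left, mul_one]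
    rw [diffKernel, this]
  have e2 : diffKernel β δ (w₂⁻¹ * τ) = t ^ (β - 1) * (δ / (t + δ)) := by
    have : dist (w₂⁻¹ * τ) 1 = t := by
      rw [← dist_mul_left_circle w₂, mul_inv_cancel_left, mul_one]
    rw [diffKernel, this]
  have e3 : 0 ≤ diffKernel β δ (w₁⁻¹ * τ) := diffKernel_nonneg hδ _
  have e4 : 0 ≤ diffKernel β δ (w₂⁻¹ * τ) := diffKernel_nonneg hδ _
  rw [key, norm_mul, norm_mul, Circle.norm_coe, one_mul, norm_div, norm_mul, hsn, htn,
    norm_sub_rev (w₁ : ℂ) w₂, hδn, mul_add]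
  rcases le_total s t with h | h
  · have := rpow_mul_div_mul_le hs ht hδ hst h hG1 hH
    rw [e1]
    have : 0 ≤ 21 * H * diffKernel β δ (w₂⁻¹ * τ) := by positivity
    linarith
  · have := rpow_mul_div_mul_le ht hs hδ (by linarith) h hG2 hH
    rw [e2, mul_comm s t]
    have : 0 ≤ 21 * H * diffKernel β δ (w₁⁻¹ * τ) := by positivity
    linarith

/-- **Privalov's theorem**: the singular integral operator preserves Hölder continuity. -/
theorem norm_rotDiff_one_sub_le (hβ : 0 < β) (hβ₁ : β < 1) (hH : 0 ≤ H) (hgc : Continuous g)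
    (hg : ∀ p q, ‖g p - g q‖ ≤ H * dist p q ^ β) (w₁ w₂ : Circle) :
    ‖rotDiff 1 g w₁ - rotDiff 1 g w₂‖ ≤ 42 * diffConst β * H * dist w₁ w₂ ^ β := by
  rcases eq_or_ne w₁ w₂ with rfl | hw
  · have := diffConst_nonneg hβ hβ₁
    rw [sub_self, norm_zero]
    positivity
  have hδ : 0 < dist w₁ w₂ := dist_pos.2 hw
  set δ := dist w₁ w₂ with hδd
  set z₀ : ℂ := (1 + δ : ℝ) * w₁ with hz₀
  have hz : 1 < ‖z₀‖ := by
    rw [hz₀, norm_mul, Circle.norm_coe, mul_one, Complex.norm_real, Real.norm_of_nonneg (by linarith)]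
    linarith
  have i1 := cintegrable_cauchyKernel hβ hβ₁ hH hgc hg w₁
  have i2 := cintegrable_cauchyKernel hβ hβ₁ hH hgc hg w₂
  have hc : Continuous fun τ : Circle => (g w₂ - g w₁) * ((τ : ℂ) / (τ - z₀)) := by
    refine continuous_const.mul (Continuous.div (by fun_prop) (by fun_prop) fun τ h => ?_)
    rw [← sub_eq_zero.1 h, Circle.norm_coe] at hz
    exact lt_irrefl _ hz
  have e1 : rotDiff 1 g w₁ - rotDiff 1 g w₂ = cint (fun τ => cauchyKernel g w₁ τ -
      cauchyKernel g w₂ τ - (g w₂ - g w₁) * ((τ : ℂ) / (τ - z₀))) := by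
    -- Since `z₀` lies outside the disc, the correction integrates to zero and can be subtracted for
    -- free.
    have h1 : cint (fun τ : Circle => (g w₂ - g w₁) * ((τ : ℂ) / (τ - z₀))) = 0 := by
      rw [cint_const_mul, cint_div_sub_eq_zero hz, mul_zero]
    have h2 := intervalIntegral.integral_sub (IntervalIntegrable.sub i1 i2) (Continuous.cintegrable hc)
    have h3 := intervalIntegral.integral_sub i1 i2
    rw [rotDiff_one_eq, rotDiff_one_eq, ← sub_zero (cint _ - cint _), ← h1]
    exact (h2.trans (congrArg (· - _) h3)).symm
  have j := cintegrable_diffKernel hβ hβ₁ hδ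
  have j1 := j.mul_left w₁⁻¹
  have j2 := j.mul_left w₂⁻¹
  have e2 : ∫ θ in (0 : ℝ)..2 * Real.pi, 21 * H * (diffKernel β δ (w₁⁻¹ * Circle.exp θ) +
      diffKernel β δ (w₂⁻¹ * Circle.exp θ)) = 42 * H * cint (diffKernel β δ) := by
    rw [intervalIntegral.integral_const_mul, intervalIntegral.integral_add j1 j2]
    have k1 := cint_mul_left (diffKernel β δ) w₁⁻¹
    have k2 := cint_mul_left (diffKernel β δ) w₂⁻¹
    have k3 : cint (diffKernel β δ) + cint (diffKernel β δ) = 2 * cint (diffKernel β δ) := by ring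
    rw [show 42 * H * cint (diffKernel β δ) = 21 * H * (2 * cint (diffKernel β δ)) by ring, ← k3]
    exact congrArg (21 * H * ·) (congrArg₂ (· + ·) k1 k2)
  have e3 := cint_diffKernel_le hβ hβ₁ hδ (dist_le_two w₁ w₂)
  calc _ ≤ 42 * H * cint (diffKernel β δ) := by
        rw [e1, ← e2]
        refine intervalIntegral.norm_integral_le_of_norm_le Real.two_pi_pos.le ?_
          ((j1.add j2).const_mul _)
        filter_upwards [ae_exp_ne w₁, ae_exp_ne w₂] with θ h₁ h₂ _
        exact norm_cauchyKernel_sub_sub_le hβ hβ₁ hH hg hw h₁ h₂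
    _ ≤ 42 * H * (diffConst β * δ ^ β) := by gcongr
    _ = _ := by ring

end Privalov

/-! ### Primitives on the circle -/

section Primitive

variable {p : Circle → ℂ}

lemma fourierCoef_const_mul (c : ℂ) (g : Circle → ℂ) (n : ℤ) :
    fourierCoef (fun w => c * g w) n = c * fourierCoef g n := by
  simp only [fourierCoef, mul_assoc]
  exact mean_const_mul c _

lemma fourierCoef_const_zero (c : ℂ) : fourierCoef (fun _ => c) 0 = c := by
  have h := fourierCoef_const_mul c (fun _ => 1) 0
  have h1 : fourierCoef (fun _ => 1) 0 = 1 := by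
    have : (Real.pi : ℂ) ≠ 0 := by exact_mod_cast Real.pi_ne_zero
    rw [fourierCoef_eq_cint]
    simp only [neg_zero, zpow_zero, mul_one, cint_one]
    field_simp
  rw [h1, mul_one] at h
  simpa using h

/-- The coefficient of index `-1` is `∮ p dτ`; its vanishing makes the primitive in the angle
periodic, so that it descends to the circle. -/
lemma exists_primitive_comp_exp (hp : Continuous p) (h0 : fourierCoef p (-1) = 0) :
    ∃ h : Circle → ℂ, ∀ θ : ℝ,
      h (Circle.exp θ) = ∫ s in (0 : ℝ)..θ, I * (Circle.exp s : ℂ) * p (Circle.exp s) := by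
  have hc : Continuous fun s : ℝ => I * (Circle.exp s : ℂ) * p (Circle.exp s) := by fun_prop
  have hper : Function.Periodic (fun s : ℝ => I * (Circle.exp s : ℂ) * p (Circle.exp s))
      (2 * Real.pi) := fun θ => by simp only [Circle.exp_add_two_pi]
  have h1 : ∫ s in (0 : ℝ)..2 * Real.pi, I * (Circle.exp s : ℂ) * p (Circle.exp s) = 0 := by
    rw [fourierCoef] at h0
    simp only [neg_neg, sub_self, zpow_zero, mul_one, mean] at h0
    have h2 := (mul_eq_zero.1 h0).resolve_left (inv_ne_zero Complex.two_pi_I_ne_zero)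
    rw [← h2]
    congr 1
    funext θ
    ring
  have hper2 : Function.Periodic
      (fun θ : ℝ => ∫ s in (0 : ℝ)..θ, I * (Circle.exp s : ℂ) * p (Circle.exp s))
      (2 * Real.pi) := fun θ => by
    have h2 := hper.intervalIntegral_add_eq θ 0
    rw [zero_add, h1] at h2
    change ∫ s in (0 : ℝ)..(θ + 2 * Real.pi), I * (Circle.exp s : ℂ) * p (Circle.exp s) = _
    rw [← intervalIntegral.integral_add_adjacent_intervals (hc.intervalIntegrable 0 θ)
      (hc.intervalIntegrable θ _), h2, add_zero]
  refine ⟨fun w => ∫ s in (0 : ℝ)..(w : ℂ).arg, I * (Circle.exp s : ℂ) * p (Circle.exp s),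
    fun θ => ?_⟩
  obtain ⟨m, hm⟩ := Circle.exp_eq_exp.1 (Circle.exp_arg (Circle.exp θ))
  change (fun θ : ℝ => ∫ s in (0 : ℝ)..θ, I * (Circle.exp s : ℂ) * p (Circle.exp s)) _ = _
  rw [hm]
  exact hper2.int_mul m θ

lemma exists_primitive (hp : Continuous p) (h0 : fourierCoef p (-1) = 0) :
    ∃ h : Circle → ℂ, CircleDifferentiable h ∧ circleDeriv h = p ∧ fourierCoef h 0 = 0 := by
  obtain ⟨h, hh⟩ := exists_primitive_comp_exp hp h0
  have hc : Continuous fun s : ℝ => I * (Circle.exp s : ℂ) * p (Circle.exp s) := by fun_prop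
  have key : ∀ (c : ℂ) (w : Circle),
      HasDerivAt (fun t : ℝ => h (w * Circle.exp t) - c) (I * w * p w) 0 := fun c w => by
    obtain ⟨a, rfl⟩ := Circle.exp_surjective w
    have h1 := intervalIntegral.integral_hasDerivAt_right (hc.intervalIntegrable 0 (a + 0))
      (hc.stronglyMeasurableAtFilter _ _) hc.continuousAt
    have h2 := (h1.comp_const_add a 0).sub_const c
    simp only [← hh, add_zero] at h2
    simpa only [← Circle.exp_add] using h2
  have hd : CircleDifferentiable h := fun w => by
    have := (key 0 w).differentiableAt
    simpa using this
  refine ⟨fun w => h w - fourierCoef h 0, fun w => (key _ w).differentiableAt,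
    funext fun w => circleDeriv_eq_of_hasDerivAt (key _ w), ?_⟩
  rw [fourierCoef_sub hd.continuous continuous_const, fourierCoef_const_zero, sub_self]

/-- If `h` has mean zero, then `h w` is the average over `τ` of `h w - h τ`. -/
lemma norm_le_of_fourierCoef_zero {h : Circle → ℂ} (hd : CircleDifferentiable h) {M : ℝ}
    (hM : ∀ w, ‖circleDeriv h w‖ ≤ M) (h0 : fourierCoef h 0 = 0) (w : Circle) :
    ‖h w‖ ≤ Real.pi * M := by
  have h1 : h w = fourierCoef (fun τ => h w - h τ) 0 := by
    rw [fourierCoef_sub continuous_const hd.continuous, fourierCoef_const_zero, h0, sub_zero]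
  have hM0 : 0 ≤ M := (norm_nonneg _).trans (hM 1)
  rw [h1, fourierCoef]
  refine norm_mean_le_of_le fun τ => ?_
  rw [norm_mul, norm_zpow, Circle.norm_coe, one_zpow, mul_one]
  have h2 := norm_sub_le_of_deriv_le hd hM w τ
  have h3 := dist_le_two w τ
  have h4 := Real.pi_pos
  calc _ ≤ M * (Real.pi / 2) * dist w τ := h2
    _ ≤ M * (Real.pi / 2) * 2 := by gcongr
    _ = _ := by ring

end Primitive

/-! ### The linearized operator -/

section Linearization

variable {β : ℝ≥0} [Fact (0 < β)] [Fact (β < 1)]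

/-- The operator `h ↦ -Im h'`. -/
def linOp : X β →L[ℝ] Yhat β := -(proj.comp kDw)

lemma linOp_apply (h : X β) (w : Circle) : linOp h w = -(circleDeriv h w).im := by
  have hc : Continuous (circleDeriv h) := h.continuous_deriv Fact.out
  have h1 : proj (kDw h) w = (circleDeriv h w).im := by
    refine proj_apply_of_odd (g := fun w => (circleDeriv h w).im) (fun w τ => rfl) (fun w => ?_) ?_ w
    · rw [deriv_inv, Complex.conj_im]
    · rw [sinCoef_one_im hc]
      have := meanW_kDw_mul h
      rw [meanW_apply] at this
      have h2 : (mean fun w => circleDeriv h w * (w⁻¹ : Circle) * ((w⁻¹ : Circle) - (w : ℂ))) = 0 :=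
        this
      rw [h2, Complex.zero_re]
  rw [← h1]
  rfl

/-- If `Im h' = 0`, the coefficients of the real function `h'` at `n` and `-n` are conjugate. As
`h'` has only frequencies at most `-2`, it has none at all. -/
lemma linOp_injective : Function.Injective (linOp (β := β)) := by
  rw [injective_iff_map_eq_zero]
  intro h hh
  have hc : Continuous (circleDeriv h) := h.continuous_deriv Fact.out
  have h1 : ∀ w, conj (circleDeriv h w) = circleDeriv h w := fun w => by
    rw [Complex.conj_eq_iff_im]
    have := linOp_apply h w
    rw [hh] at this
    have h2 : (0 : Yhat β) w = 0 := rfl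
    linarith
  have h2 : ∀ n, fourierCoef (circleDeriv h) n = 0 := fun n => by
    rcases le_or_gt (-1) n with hn | hn
    · exact fourierCoef_deriv h Fact.out n hn
    · have h3 := fourierCoef_conj (circleDeriv h) n
      rw [fourierCoef_deriv h Fact.out (-n) (by omega), map_zero] at h3
      simpa only [h1] using h3
  have h3 : ∀ n, fourierCoef h n = 0 := fun n => by
    rcases eq_or_ne n 0 with rfl | hn
    · exact fourierCoef_nonneg h 0
    · have h4 := fourierCoef_circleDeriv h.differentiable hc (n - 1)
      rw [h2, sub_add_cancel] at h4
      refine (mul_eq_zero.1 h4.symm).resolve_left ?_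
      push_cast
      simpa using hn
  exact DFunLike.ext _ _ fun w => eq_zero_of_fourierCoef h.continuous h3 w

/-! ### Surjectivity: completing a sine series to negative frequencies. -/

lemma re_div_sub {w τ : Circle} (h : τ ≠ w) : ((τ : ℂ) / (τ - w)).re = 1 / 2 := by
  have h1 := coe_sub_ne_zero h
  have h2 := Circle.coe_ne_zero τ
  have h3 := Circle.coe_ne_zero w
  have h4 : conj ((τ : ℂ) / (τ - w)) = 1 - (τ : ℂ) / (τ - w) := by
    rw [map_div₀, conj_sub_coe, ← Circle.coe_inv_eq_conj, Circle.coe_inv]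
    field_simp
    ring
  have h5 := congrArg Complex.re h4
  rw [Complex.conj_re, Complex.sub_re, Complex.one_re] at h5
  linarith

lemma norm_ofReal_sub_le (g : Yhat β) (p q : Circle) :
    ‖((g p : ℝ) : ℂ) - (g q : ℝ)‖ ≤ ‖g‖ * dist p q ^ (β : ℝ) := by
  rw [← Complex.ofReal_sub, Complex.norm_real]
  exact g.norm_sub_le p q

lemma cint_eq_zero (g : Yhat β) : cint g = 0 := by
  have h := g.cosCoef_eq_zero 0
  rw [cosCoef] at h
  simp only [pow_zero, Complex.one_re, mul_one] at h
  exact (mul_eq_zero.1 h).resolve_left (inv_ne_zero Real.pi_ne_zero)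

/-- The Cauchy kernel `τ/(τ - w)` has constant real part `1/2` on the circle. For real `g` only the
mean of `(g τ - g w)/2` remains, and `g` itself has mean zero. -/
lemma re_rotDiff_one (g : Yhat β) (w : Circle) :
    (rotDiff 1 (fun w => ((g w : ℝ) : ℂ)) w).re = -(Real.pi * g w) := by
  have hβ₀ : (0 : ℝ) < β := Fact.out (p := 0 < β)
  have hβ₁ : (β : ℝ) < 1 := Fact.out (p := β < 1)
  have hc : Continuous fun w => ((g w : ℝ) : ℂ) := Complex.continuous_ofReal.comp g.continuous
  have hi := cintegrable_cauchyKernel hβ₀ hβ₁ (norm_nonneg g) hc (norm_ofReal_sub_le g) w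
  have h1 : (cint (cauchyKernel (fun w => ((g w : ℝ) : ℂ)) w)).re =
      cint (fun τ => (cauchyKernel (fun w => ((g w : ℝ) : ℂ)) w τ).re) :=
    (ContinuousLinearMap.intervalIntegral_comp_comm Complex.reCLM hi).symm
  have h2 : cint (fun τ => (cauchyKernel (fun w => ((g w : ℝ) : ℂ)) w τ).re) =
      cint (fun τ => (1 / 2) * (g τ - g w)) := by
    refine cint_congr_ne w fun τ hτ => ?_
    have h3 : cauchyKernel (fun w => ((g w : ℝ) : ℂ)) w τ =
        ((g τ - g w : ℝ) : ℂ) * ((τ : ℂ) / (τ - w)) := by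
      rw [cauchyKernel]
      push_cast
      ring
    rw [h3, Complex.re_ofReal_mul, re_div_sub hτ]
    ring
  rw [rotDiff_one_eq, h1, h2, cint_const_mul_real, cint_sub g.continuous continuous_const,
    cint_eq_zero, cint_const, smul_eq_mul]
  ring

lemma fourierCoef_ofReal_re (g : Yhat β) (m : ℕ) :
    (fourierCoef (fun w => ((g w : ℝ) : ℂ)) (-m)).re = 0 := by
  have hc : Continuous fun w => ((g w : ℝ) : ℂ) := Complex.continuous_ofReal.comp g.continuous
  have h2 : ((2 * Real.pi : ℂ)⁻¹) = (((2 * Real.pi)⁻¹ : ℝ) : ℂ) := by push_cast; rfl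
  rw [fourierCoef_eq_cint, h2, Complex.re_ofReal_mul, cint_re (continuous_mul_zpow hc _)]
  simp only [neg_neg, zpow_natCast, Complex.re_ofReal_mul]
  have h := g.cosCoef_eq_zero m
  rw [cosCoef] at h
  exact mul_eq_zero_of_right _ ((mul_eq_zero.1 h).resolve_left (inv_ne_zero Real.pi_ne_zero))

/-- The real part vanishes with the cosine coefficients, the imaginary part with the first sine
coefficient. This condition gives the completion a single-valued primitive. -/
lemma fourierCoef_ofReal_neg_one (g : Yhat β) :
    fourierCoef (fun w => ((g w : ℝ) : ℂ)) (-1) = 0 := by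
  have hc : Continuous fun w => ((g w : ℝ) : ℂ) := Complex.continuous_ofReal.comp g.continuous
  have h2 : ((2 * Real.pi : ℂ)⁻¹) = (((2 * Real.pi)⁻¹ : ℝ) : ℂ) := by push_cast; rfl
  refine Complex.ext (fourierCoef_ofReal_re g 1) ?_
  rw [fourierCoef_eq_cint, h2, Complex.im_ofReal_mul, cint_im (continuous_mul_zpow hc _)]
  simp only [neg_neg, zpow_one, Complex.im_ofReal_mul]
  have h := g.sinCoef_one_eq_zero
  rw [sinCoef_eq_cint] at h
  exact mul_eq_zero_of_right _ ((mul_eq_zero.1 h).resolve_left (inv_ne_zero Real.pi_ne_zero))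

/-- The holomorphic completion of a function in `Ŷ`. -/
def completion (g : Yhat β) (w : Circle) : ℂ :=
  I / Real.pi * rotDiff 1 (fun w => ((g w : ℝ) : ℂ)) w

lemma im_completion (g : Yhat β) (w : Circle) : -(completion g w).im = g w := by
  have h : completion g w = ((Real.pi⁻¹ : ℝ) : ℂ) *
      (I * rotDiff 1 (fun w => ((g w : ℝ) : ℂ)) w) := by
    rw [completion]
    push_cast
    ring
  have := Real.pi_ne_zero
  rw [h, Complex.im_ofReal_mul, Complex.I_mul_im, re_rotDiff_one]
  field_simp

lemma fourierCoef_completion (g : Yhat β) (n : ℤ) : fourierCoef (completion g) n = I / Real.pi *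
    (fourierCoef (fun w => ((g w : ℝ) : ℂ)) n *
      cint (fun σ => (σ : ℂ) ^ (1 : ℤ) * (((σ : ℂ) ^ n - 1) / ((σ : ℂ) - 1)))) := by
  have hβ₀ : (0 : ℝ) < β := Fact.out (p := 0 < β)
  have hβ₁ : (β : ℝ) < 1 := Fact.out (p := β < 1)
  have hc : Continuous fun w => ((g w : ℝ) : ℂ) := Complex.continuous_ofReal.comp g.continuous
  unfold completion
  rw [fourierCoef_const_mul, fourierCoef_rotDiff hc hβ₀ hβ₁ (norm_nonneg g) (norm_ofReal_sub_le g)]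

/-- The multiplier of `rotDiff 1` annihilates nonnegative frequencies. -/
lemma fourierCoef_completion_nonneg (g : Yhat β) (n : ℕ) : fourierCoef (completion g) n = 0 := by
  rw [fourierCoef_completion, cint_geom_one_nonneg, mul_zero, mul_zero]

/-- On frequency `-m` the multiplier is `-2π`, and `(i/π)(-2π) = -2i`. -/
lemma fourierCoef_completion_neg (g : Yhat β) {m : ℕ} (hm : m ≠ 0) :
    fourierCoef (completion g) (-m) = -2 * I * fourierCoef (fun w => ((g w : ℝ) : ℂ)) (-m) := by
  have : (Real.pi : ℂ) ≠ 0 := by exact_mod_cast Real.pi_ne_zero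
  rw [fourierCoef_completion, cint_geom_one_neg hm]
  field_simp

lemma fourierCoef_completion_neg_one (g : Yhat β) : fourierCoef (completion g) (-1) = 0 := by
  have h := fourierCoef_completion_neg g one_ne_zero
  rw [Nat.cast_one, fourierCoef_ofReal_neg_one, mul_zero] at h
  exact h

lemma norm_completion_le (g : Yhat β) (w : Circle) : ‖completion g w‖ ≤ ‖g‖ * singConst β := by
  have hβ₀ : (0 : ℝ) < β := Fact.out (p := 0 < β)
  have hβ₁ : (β : ℝ) < 1 := Fact.out (p := β < 1)
  have h := norm_rotDiff_one_le hβ₀ hβ₁ (norm_nonneg g) (norm_ofReal_sub_le g) w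
  have h1 : ‖I / (Real.pi : ℂ)‖ ≤ 1 := by
    rw [norm_div, Complex.norm_I, Complex.norm_real, Real.norm_of_nonneg Real.pi_pos.le,
      div_le_one Real.pi_pos]
    linarith [Real.pi_gt_three]
  rw [completion, norm_mul]
  nlinarith [norm_nonneg (rotDiff 1 (fun w => ((g w : ℝ) : ℂ)) w)]

lemma norm_completion_sub_le (g : Yhat β) (p q : Circle) :
    ‖completion g p - completion g q‖ ≤ 42 * diffConst β * ‖g‖ * dist p q ^ (β : ℝ) := by
  have hβ₀ : (0 : ℝ) < β := Fact.out (p := 0 < β)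
  have hβ₁ : (β : ℝ) < 1 := Fact.out (p := β < 1)
  have hc : Continuous fun w => ((g w : ℝ) : ℂ) := Complex.continuous_ofReal.comp g.continuous
  have h := norm_rotDiff_one_sub_le hβ₀ hβ₁ (norm_nonneg g) hc (norm_ofReal_sub_le g) p q
  have h1 : ‖I / (Real.pi : ℂ)‖ ≤ 1 := by
    rw [norm_div, Complex.norm_I, Complex.norm_real, Real.norm_of_nonneg Real.pi_pos.le,
      div_le_one Real.pi_pos]
    linarith [Real.pi_gt_three]
  rw [completion, completion, ← mul_sub, norm_mul]
  nlinarith [norm_nonneg (rotDiff 1 (fun w => ((g w : ℝ) : ℂ)) p -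
    rotDiff 1 (fun w => ((g w : ℝ) : ℂ)) q)]

lemma X.norm_le_of_bounds {h : X β} {M₀ M₁ C : ℝ} (h0 : ∀ w, ‖h w‖ ≤ M₀)
    (h1 : ∀ w, ‖circleDeriv h w‖ ≤ M₁) (hC : 0 ≤ C)
    (h2 : ∀ p q, ‖circleDeriv h p - circleDeriv h q‖ ≤ C * dist p q ^ (β : ℝ)) :
    ‖h‖ ≤ M₀ + (M₁ + C) := by
  rw [norm_def]
  refine add_le_add ?_ (add_le_add (ciSup_le h1) ?_)
  · exact (ContinuousMap.norm_le _ ((norm_nonneg _).trans (h0 1))).2 h0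
  · have h3 : HolderWith ⟨C, hC⟩ β (circleDeriv h) := holderWith_of_dist_le fun p q => by
      rw [dist_eq_norm]; exact h2 p q
    exact_mod_cast h3.nnholderNorm_le

/-- The completion has imaginary part `-g`, frequencies at most `-2` and real coefficients, so it is
`h'` for some `h ∈ X`. Privalov's theorem controls its Hölder seminorm. -/
lemma exists_linOp_eq (g : Yhat β) : ∃ h : X β, linOp h = g ∧
    ‖h‖ ≤ (Real.pi * singConst β + (singConst β + 42 * diffConst β)) * ‖g‖ := by
  have hβ₀ : (0 : ℝ) < β := Fact.out (p := 0 < β)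
  have hβ₁ : (β : ℝ) < 1 := Fact.out (p := β < 1)
  have hC : 0 ≤ 42 * diffConst β * ‖g‖ := by
    have := diffConst_nonneg hβ₀ hβ₁
    positivity
  have hH : HolderWith ⟨_, hC⟩ β (completion g) := holderWith_of_dist_le fun p q => by
    rw [dist_eq_norm]; exact norm_completion_sub_le g p q
  have hp : Continuous (completion g) := hH.continuous Fact.out
  obtain ⟨h, hd, hh, h0⟩ := exists_primitive hp (fourierCoef_completion_neg_one g)
  have hcoef : ∀ n : ℤ, fourierCoef (completion g) n = (n + 1) * fourierCoef h (n + 1) := fun n => by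
    have := fourierCoef_circleDeriv hd (by rw [hh]; exact hp) n
    rwa [hh] at this
  have hmem : (⟨h, hd.continuous⟩ : C(Circle, ℂ)) ∈ XSubmodule β := by
    refine ⟨hd, ⟨⟨_, hC⟩, ?_⟩, fun n => ?_, fun n => ?_⟩
    · change HolderWith _ β (circleDeriv h)
      rw [hh]
      exact hH
    · rcases n with - | n
      · exact h0
      · have h1 := hcoef n
        rw [fourierCoef_completion_nonneg] at h1
        have h2 : ((n : ℤ) : ℂ) + 1 ≠ 0 := by exact_mod_cast n.succ_ne_zero
        have h3 := (mul_eq_zero.1 h1.symm).resolve_left h2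
        exact_mod_cast h3
    · rcases n with - | n
      · change (fourierCoef h _).im = 0
        norm_num
        rw [h0, Complex.zero_im]
      -- Index `-(n + 1)` of `h` corresponds to index `-(n + 2)` of `h'`, where the coefficient is
      -- `-2i` times a purely imaginary number.
      · have h1 := hcoef (-((n + 2 : ℕ) : ℤ))
        rw [fourierCoef_completion_neg g (by omega)] at h1
        have h2 : -((n + 2 : ℕ) : ℤ) + 1 = -((n + 1 : ℕ) : ℤ) := by push_cast; ring
        have h3 : ((-((n + 2 : ℕ) : ℤ) : ℤ) : ℂ) + 1 = ((-((n + 1 : ℕ) : ℝ) : ℝ) : ℂ) := by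
          push_cast; ring
        have h4 := congrArg Complex.im h1
        rw [h2, h3, Complex.im_ofReal_mul, mul_assoc, ← Complex.ofReal_ofNat, ← Complex.ofReal_neg,
          Complex.im_ofReal_mul, Complex.I_mul_im, fourierCoef_ofReal_re, mul_zero] at h4
        refine (mul_eq_zero.1 h4.symm).resolve_left ?_
        have : (0 : ℝ) < ((n + 1 : ℕ) : ℝ) := by positivity
        linarith
  let hX : X β := ⟨_, hmem⟩
  have hX1 : circleDeriv hX = completion g := hh
  refine ⟨hX, Yhat.ext' fun w => ?_, ?_⟩
  · rw [linOp_apply, hX1, im_completion]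
  · have hb := X.norm_le_of_bounds (h := hX)
      (norm_le_of_fourierCoef_zero hd (by rw [hh]; exact norm_completion_le g) h0)
      (by rw [hX1]; exact norm_completion_le g) hC (by rw [hX1]; exact norm_completion_sub_le g)
    refine hb.trans (le_of_eq ?_)
    ring

/-- The operator `h ↦ -Im h'` is an isomorphism from `X` onto `Ŷ`. -/
def linEquiv : X β ≃L[ℝ] Yhat β :=
  (LinearEquiv.ofBijective (linOp (β := β)).toLinearMap
    ⟨linOp_injective, fun g => (exists_linOp_eq g).imp fun _ h => h.1⟩).toContinuousLinearEquivOfBounds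
    ‖linOp (β := β)‖ (Real.pi * singConst β + (singConst β + 42 * diffConst β))
    (fun h => linOp.le_opNorm h) fun g => by
      obtain ⟨h, rfl, h2⟩ := exists_linOp_eq g
      have : (LinearEquiv.ofBijective (linOp (β := β)).toLinearMap
          ⟨linOp_injective, fun g => (exists_linOp_eq g).imp fun _ h => h.1⟩).symm (linOp h) = h :=
        LinearEquiv.ofBijective_symm_apply_apply _ h
      rw [this]
      exact h2

lemma linEquiv_apply (h : X β) : linEquiv h = linOp h := rfl

lemma coe_linEquiv : ((linEquiv : X β ≃L[ℝ] Yhat β) : X β →L[ℝ] Yhat β) = linOp := rfl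

/-! ### Completeness -/

/-- The functions in `Ŷ` as kernels. -/
def embYhat : Yhat β →L[ℝ] Ker β :=
  mkCLM (fun g w _ => I * (g w : ℝ)) (fun g h w _ => by rw [Yhat.add_apply]; push_cast; ring)
    (fun c g w _ => by rw [Yhat.smul_apply]; push_cast; ring)
    (fun g => continuous_const.mul
      (Complex.continuous_ofReal.comp (g.continuous.comp continuous_fst)))
    1 (2 * Real.pi) Real.two_pi_pos.le
    (fun g w _ => by
      rw [norm_mul, Complex.norm_I, one_mul, one_mul, Complex.norm_real]
      exact g.norm_apply_le w)
    (fun g w₁ w₂ => cint_norm_sub_le_of_le (F := fun w _ => I * (g w : ℝ)) fun _ => by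
      rw [← mul_sub, norm_mul, Complex.norm_I, one_mul]
      exact norm_ofReal_sub_le g w₁ w₂)

/-- Surjectivity makes this immediate: `g = -Im h'`, and `h'` commutes with conjugation. -/
lemma odd_Yhat (g : Yhat β) (w : Circle) : g w⁻¹ = -g w := by
  obtain ⟨h, rfl, -⟩ := exists_linOp_eq g
  rw [linOp_apply, linOp_apply, deriv_inv, Complex.conj_im]

lemma proj_embYhat (g : Yhat β) : proj (embYhat g) = g :=
  Yhat.ext' fun w => proj_apply_of_odd
    (fun w τ => by
      change (I * ((g w : ℝ) : ℂ)).im = g w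
      rw [Complex.I_mul_im, Complex.ofReal_re])
    (odd_Yhat g) g.sinCoef_one_eq_zero w

/-- `Ŷ` is a continuous linear retract of the complete space `Ker β`: embed the Cauchy sequence,
take the limit, project back. -/
instance : CompleteSpace (Yhat β) := by
  refine Metric.complete_of_cauchySeq_tendsto fun u hu => ?_
  obtain ⟨K, hK⟩ := cauchySeq_tendsto_of_complete
    ((embYhat (β := β)).uniformContinuous.comp_cauchySeq hu)
  refine ⟨proj K, ?_⟩
  have := (proj.continuous.tendsto K).comp hK
  simpa [Function.comp_def, proj_embYhat] using this

instance : CompleteSpace (X β) :=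
  (completeSpace_congr (e := (linEquiv (β := β)).toEquiv)
    (linEquiv (β := β)).isUniformEmbedding).2 inferInstance

end Linearization

/-! ### Smoothness of the functional -/

section Smoothness

variable {α β : ℝ≥0} [Fact (α ≤ 1)] [Fact (0 < β)] [Fact (β < 1)]

/-- Inversion is smooth near a unit of a Banach algebra; it is the only operation on kernels here
that is not polynomial or bounded linear. -/
lemma contDiffAt_inverse_of_isUnit {V : Type*} [NormedAddCommGroup V] [NormedSpace ℝ V]
    {G : V → Ker α} {p : V} (hG : ContDiffAt ℝ 1 G p) (h : IsUnit (G p)) :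
    ContDiffAt ℝ 1 (fun q => Ring.inverse (G q)) p := by
  obtain ⟨u, hu⟩ := h
  have h1 := contDiffAt_ringInverse ℝ (n := 1) u
  rw [hu] at h1
  exact h1.comp p hG

lemma contDiff_kN : ContDiff ℝ 1 fun p : ℝ × X β => (kN p.1 p.2 : Ker α) := by
  unfold kN
  fun_prop

lemma contDiff_kE (d : ℝ) : ContDiff ℝ 1 fun p : ℝ × X β => (kE d p.1 p.2 : Ker α) := by
  unfold kE
  fun_prop

lemma contDiffAt_inverse_kN :
    ContDiffAt ℝ 1 (fun p : ℝ × X β => Ring.inverse (kN p.1 p.2 : Ker α)) (0, 0) :=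
  contDiffAt_inverse_of_isUnit contDiff_kN.contDiffAt (isUnit_kN (by norm_num) (by norm_num))

variable {d : ℝ}

lemma contDiffAt_inverse_kE (hd : 2 < d) :
    ContDiffAt ℝ 1 (fun p : ℝ × X β => Ring.inverse (kE d p.1 p.2 : Ker α)) (0, 0) :=
  contDiffAt_inverse_of_isUnit (contDiff_kE d).contDiffAt
    (isUnit_kE hd (by norm_num) (by norm_num))

lemma contDiffAt_kG2 :
    ContDiffAt ℝ 1 (fun p : ℝ × X β => (kG2 p.1 p.2 : Ker α)) (0, 0) := by
  have h := contDiffAt_inverse_kN (α := α) (β := β)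
  unfold kG2
  fun_prop

lemma contDiffAt_kG3 (hd : 2 < d) :
    ContDiffAt ℝ 1 (fun p : ℝ × X β => (kG3 d p.1 p.2 : Ker α)) (0, 0) := by
  have h := contDiffAt_inverse_kE (α := α) (β := β) hd
  unfold kG3
  fun_prop

lemma contDiffAt_kV (hd : 2 < d) :
    ContDiffAt ℝ 1 (fun p : ℝ × X β => (kV d p.1 p.2 : Ker α)) (0, 0) := by
  have h := contDiffAt_kG2 (α := α) (β := β)
  have h' := contDiffAt_kG3 (α := α) (β := β) hd
  unfold kV
  fun_prop

lemma contDiffAt_re {V : Type*} [NormedAddCommGroup V] [NormedSpace ℝ V] {G : V → ℂ} {p : V}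
    (h : ContDiffAt ℝ 1 G p) : ContDiffAt ℝ 1 (fun q => (G q).re) p :=
  Complex.reCLM.contDiff.contDiffAt.comp p h

lemma contDiffAt_kT₁ (hd : 2 < d) :
    ContDiffAt ℝ 1 (fun p : ℝ × X β => (kT₁ d p.1 p.2).re) (0, 0) := by
  have h := contDiffAt_kV (α := β) (β := β) hd
  refine contDiffAt_re ?_
  unfold kT₁
  fun_prop

lemma contDiffAt_kT₂ : ContDiffAt ℝ 1 (fun p : ℝ × X β => (kT₂ d p.1 p.2).re) (0, 0) := by
  refine contDiffAt_re ?_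
  unfold kT₂
  fun_prop

lemma contDiffAt_kΩ (hd : 2 < d) : ContDiffAt ℝ 1 (fun p : ℝ × X β => kΩ d p.1 p.2) (0, 0) := by
  have h₁ := contDiffAt_kT₁ (β := β) hd
  have h₂ := contDiffAt_kT₂ (β := β) (d := d)
  have h : ContDiffAt ℝ 1 (fun p : ℝ × X β => 1 - p.1 * (kT₂ d p.1 p.2).re) (0, 0) := by fun_prop
  have h' : ContDiffAt ℝ 1 (fun p : ℝ × X β => 1 + p.1 * (kT₁ d p.1 p.2).re) (0, 0) := by fun_prop
  exact contDiffAt_const.mul (h'.div h (by simp))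

lemma contDiffAt_kC (hd : 2 < d) : ContDiffAt ℝ 1 (fun p : ℝ × X β => kC d p.1 p.2) (0, 0) := by
  have h₁ := contDiffAt_kT₁ (β := β) hd
  have h₂ := contDiffAt_kT₂ (β := β) (d := d)
  have h : ContDiffAt ℝ 1 (fun p : ℝ × X β => 1 - p.1 * (kT₂ d p.1 p.2).re) (0, 0) := by fun_prop
  exact contDiffAt_const.mul ((h₁.add h₂).div h (by simp))

lemma contDiffAt_kGhat (hd : 2 < d) :
    ContDiffAt ℝ 1 (fun p : ℝ × X β => kGhat d p.1 p.2) (0, 0) := by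
  have h := contDiffAt_kV (α := β) (β := β) hd
  have h₁ := contDiffAt_kΩ (β := β) hd
  have h₂ := contDiffAt_kC (β := β) hd
  unfold kGhat kW
  fun_prop

lemma contDiffAt_proj_kGhat (hd : 2 < d) :
    ContDiffAt ℝ 1 (fun p : ℝ × X β => proj (kGhat d p.1 p.2)) (0, 0) :=
  proj.contDiff.contDiffAt.comp _ (contDiffAt_kGhat hd)

/-- At `ε = 0` the nonlinearity disappears for every `f`, so `Ĝ(0, ·)` is linear and is its own
derivative. -/
lemma proj_kGhat_zero (f : X β) : proj (kGhat d 0 f) = linOp f := by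
  rw [kGhat, zero_smul, add_zero, map_neg]
  rfl

lemma fderiv_comp_inr (hd : 2 < d) :
    (fderiv ℝ (fun p : ℝ × X β => proj (kGhat d p.1 p.2)) (0, 0)).comp
      (ContinuousLinearMap.inr ℝ ℝ (X β)) = linOp := by
  have h1 := ((contDiffAt_proj_kGhat (β := β) hd).differentiableAt one_ne_zero).hasFDerivAt
  have h2 := HasFDerivAt.comp (0 : X β) h1
    (ContinuousLinearMap.inr ℝ ℝ (X β)).hasFDerivAt
  have h3 : HasFDerivAt (fun f : X β => linOp f) linOp (0 : X β) := linOp.hasFDerivAt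
  refine h2.unique (h3.congr_of_eventuallyEq (Eventually.of_forall fun f => ?_))
  simp [proj_kGhat_zero]

end Smoothness

/-! ### Uniform bounds -/

section Bounds

variable {α β : ℝ≥0} [Fact (α ≤ 1)] [Fact (0 < β)] [Fact (β < 1)]

/-- The filter of the parameters `ε → 0`, uniformly for `f` in the unit ball. -/
def smallFilter (β : ℝ≥0) : Filter (ℝ × X β) := 𝓝 0 ×ˢ 𝓟 (Metric.ball 0 1)

/-- Boundedness for small `ε`, uniformly for `f` in the unit ball. -/
def UBdd {V : Type*} [NormedAddCommGroup V] (G : ℝ × X β → V) : Prop :=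
  G =O[smallFilter β] (fun _ => (1 : ℝ))

variable {V : Type*} [NormedAddCommGroup V] [NormedSpace ℝ V] {G G' : ℝ × X β → V}

lemma UBdd.add (h : UBdd G) (h' : UBdd G') : UBdd fun p => G p + G' p := Asymptotics.IsBigO.add h h'

lemma UBdd.sub (h : UBdd G) (h' : UBdd G') : UBdd fun p => G p - G' p := Asymptotics.IsBigO.sub h h'

lemma UBdd.neg (h : UBdd G) : UBdd fun p => -G p := Asymptotics.IsBigO.neg_left h

lemma ubdd_const (v : V) : UBdd fun _ : ℝ × X β => v :=
  Asymptotics.isBigO_const_const v one_ne_zero _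

lemma UBdd.smul {r : ℝ × X β → ℝ} (hr : UBdd r) (h : UBdd G) : UBdd fun p => r p • G p := by
  have := Asymptotics.IsBigO.smul hr h
  simpa only [UBdd, smul_eq_mul, mul_one] using this

lemma UBdd.mul {R : Type*} [NormedRing R] {G G' : ℝ × X β → R}
    (h : UBdd G) (h' : UBdd G') : UBdd fun p => G p * G' p := by
  have := Asymptotics.IsBigO.mul h h'
  simpa only [UBdd, mul_one] using this

lemma UBdd.clm {V' : Type*} [NormedAddCommGroup V'] [NormedSpace ℝ V'] (L : V →L[ℝ] V')
    (h : UBdd G) : UBdd fun p => L (G p) :=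
  (L.isBigO_comp G _).trans h

lemma ubdd_of_tendsto {v : V} (h : Tendsto G (smallFilter β) (𝓝 v)) : UBdd G := h.isBigO_one ℝ

lemma tendsto_fst : Tendsto (fun p : ℝ × X β => p.1) (smallFilter β) (𝓝 0) := Filter.tendsto_fst

lemma ubdd_fst : UBdd fun p : ℝ × X β => p.1 := ubdd_of_tendsto tendsto_fst

lemma ubdd_snd : UBdd fun p : ℝ × X β => p.2 := by
  refine Asymptotics.IsBigO.of_bound 1 ?_
  rw [smallFilter, eventually_prod_principal_iff]
  refine Eventually.of_forall fun ε f hf => ?_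
  rw [mem_ball_zero_iff] at hf
  simpa using hf.le

lemma UBdd.tendsto_smul {r : ℝ × X β → ℝ} (hr : Tendsto r (smallFilter β) (𝓝 0)) (h : UBdd G) :
    Tendsto (fun p => r p • G p) (smallFilter β) (𝓝 0) := by
  have h1 : r =o[smallFilter β] (fun _ => (1 : ℝ)) := (Asymptotics.isLittleO_one_iff ℝ).2 hr
  have h2 := h1.smul_isBigO h
  simpa only [smul_eq_mul, mul_one, Asymptotics.isLittleO_one_iff] using h2

lemma ubdd_inverse {K : ℝ × X β → Ker α} {K₀ : Ker α} (h : Tendsto K (smallFilter β) (𝓝 K₀))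
    (h₀ : IsUnit K₀) : UBdd fun p => Ring.inverse (K p) := by
  obtain ⟨u, rfl⟩ := h₀
  exact ubdd_of_tendsto ((NormedRing.inverse_continuousAt u).tendsto.comp h)

/-- `1 + ε B/A` tends to `1` uniformly on the unit ball, and inversion is continuous at `1`. -/
lemma ubdd_inverse_kN : UBdd fun p : ℝ × X β => Ring.inverse (kN p.1 p.2 : Ker α) := by
  refine ubdd_inverse (K₀ := 1) ?_ isUnit_one
  have h := UBdd.tendsto_smul tendsto_fst (ubdd_snd.clm (kB (α := α) (β := β)))
  simpa only [kN, add_zero] using h.const_add (1 : Ker α)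

variable {d : ℝ}

lemma ubdd_inverse_kE (hd : 2 < d) :
    UBdd fun p : ℝ × X β => Ring.inverse (kE d p.1 p.2 : Ker α) := by
  have hu : IsUnit ((-(2 * d)) • (1 : Ker α)) := isUnit_of_ne_zero fun w τ => by
    simp only [eval_smul, eval_one, mul_one]
    have : -(2 * d) ≠ 0 := by linarith
    exact_mod_cast this
  refine ubdd_inverse ?_ hu
  have h1 := UBdd.tendsto_smul (β := β) tendsto_fst (ubdd_const (varT + varW : Ker α))
  have h3 : Tendsto (fun p : ℝ × X β => p.1 ^ 2) (smallFilter β) (𝓝 0) := by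
    simpa using (tendsto_fst (β := β)).pow 2
  have h2 := UBdd.tendsto_smul h3
    ((ubdd_snd.clm (kFt (α := α) (β := β))).add (ubdd_snd.clm (kFw (α := α) (β := β))))
  simpa only [kE, add_zero, zero_sub, neg_smul] using (h1.add h2).sub_const ((2 * d) • (1 : Ker α))

lemma ubdd_kG2 : UBdd fun p : ℝ × X β => (kG2 p.1 p.2 : Ker α) := by
  have hB := (ubdd_snd (β := β)).clm (kB (α := α) (β := β))
  have hI := ubdd_inverse_kN (α := α) (β := β)
  have hD := (ubdd_snd (β := β)).clm (kDt (α := α) (β := β))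
  have hz := ubdd_const (β := β) (zeta : Ker α)
  exact (((hz.mul ((hB.clm conjK).sub hB)).mul hI).mul hD |>.clm meanK).add
    ((((hz.mul (hB.sub (hB.clm conjK))).mul hB).mul hI).clm meanK)

lemma ubdd_kG3 (hd : 2 < d) : UBdd fun p : ℝ × X β => (kG3 d p.1 p.2 : Ker α) := by
  have hI := ubdd_inverse_kE (α := α) (β := β) hd
  have h1 := (ubdd_snd (β := β)).clm (kFtInv (α := α) (β := β))
  have h2 := (ubdd_snd (β := β)).clm (kFt (α := α) (β := β))
  have h3 := (ubdd_snd (β := β)).clm (kFw (α := α) (β := β))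
  exact (h1.mul hI).add ((ubdd_const (1 / (2 * d))).smul
    ((((ubdd_const (varT + varW : Ker α)).add (ubdd_fst.smul (h2.add h3))).mul hI).mul
      (ubdd_const varTInv)))

lemma ubdd_kV (hd : 2 < d) : UBdd fun p : ℝ × X β => (kV d p.1 p.2 : Ker α) := by
  have hD := (ubdd_snd (β := β)).clm (kDt (α := α) (β := β))
  exact ubdd_kG2.sub
    (((ubdd_kG3 hd).mul ((ubdd_const 1).add (ubdd_fst.smul hD))).clm meanK)

lemma UBdd.re {G : ℝ × X β → ℂ} (h : UBdd G) : UBdd fun p => (G p).re := h.clm Complex.reCLM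

lemma ubdd_kT₁ (hd : 2 < d) : UBdd fun p : ℝ × X β => (kT₁ d p.1 p.2).re := by
  have hD := (ubdd_snd (β := β)).clm (kDw (β := β))
  have h := ubdd_kV (α := β) (β := β) hd
  exact (((ubdd_snd.clm (kFw (α := β) (β := β))).clm meanW).add ((ubdd_const (2 * d)).smul
    (((h.mul (ubdd_const kQ)).mul ((ubdd_const 1).add (ubdd_fst.smul hD))).clm meanW))).re

lemma ubdd_kT₂ : UBdd fun p : ℝ × X β => (kT₂ d p.1 p.2).re := by
  have hD := (ubdd_snd (β := β)).clm (kDw (β := β))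
  have h : UBdd fun p : ℝ × X β => p.1 ^ 2 / d := by
    have := (ubdd_fst (β := β)).mul (ubdd_fst.mul (ubdd_const (1 / d)))
    refine this.congr_left fun p => ?_
    ring
  exact (((ubdd_snd.clm (kFw (α := β) (β := β))).clm meanW).neg.add (h.smul
    ((((ubdd_snd.clm (kFwInv (α := β) (β := β))).mul hD).mul (ubdd_const kQ)).clm meanW))).re

lemma ubdd_inv_one_sub : UBdd fun p : ℝ × X β => (1 - p.1 * (kT₂ d p.1 p.2).re)⁻¹ := by
  have h := UBdd.tendsto_smul (β := β) tendsto_fst (ubdd_kT₂ (d := d))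
  have h2 := (h.const_sub 1).inv₀ (by simp)
  exact ubdd_of_tendsto h2

lemma ubdd_kΩ (hd : 2 < d) : UBdd fun p : ℝ × X β => kΩ d p.1 p.2 :=
  (ubdd_const _).mul (((ubdd_const 1).add (ubdd_fst.mul (ubdd_kT₁ hd))).mul ubdd_inv_one_sub)

lemma ubdd_kC (hd : 2 < d) : UBdd fun p : ℝ × X β => kC d p.1 p.2 :=
  (ubdd_const _).mul (((ubdd_kT₁ hd).add ubdd_kT₂).mul ubdd_inv_one_sub)

lemma ubdd_kW (hd : 2 < d) :
    UBdd fun p : ℝ × X β => (kW d (kΩ d p.1 p.2) (kC d p.1 p.2) p.1 p.2 : Ker α) :=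
  ((((ubdd_const 2).mul (ubdd_kΩ hd)).smul ((ubdd_const varWInv).add
    (ubdd_fst.smul (ubdd_snd.clm (kFwInv (α := α) (β := β)))))).add
    ((ubdd_kC hd).smul (ubdd_const 1))).add (ubdd_kV hd)

lemma UBdd.exists_bound (h : UBdd G) : ∃ C δ : ℝ, 0 < C ∧ 0 < δ ∧
    ∀ ε, |ε| < δ → ∀ f : X β, ‖f‖ < 1 → ‖G (ε, f)‖ ≤ C := by
  obtain ⟨C, hC, h1⟩ := Asymptotics.IsBigO.exists_pos h
  have h2 := h1.bound
  rw [smallFilter, eventually_prod_principal_iff, Metric.eventually_nhds_iff] at h2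
  obtain ⟨δ, hδ, h3⟩ := h2
  refine ⟨C, δ, hC, hδ, fun ε hε f hf => ?_⟩
  have := h3 (y := ε) (by simpa using hε) f (by simpa using hf)
  simpa using this

/-- Solutions are of size `O(ε)`. -/
lemma exists_bound_of_Ghat_eq_zero (hd : 2 < d) : ∃ C δ : ℝ, 0 < C ∧ 0 < δ ∧
    ∀ ε, |ε| < δ → ∀ f : X β, ‖f‖ < 1 → proj (kGhat d ε f) = 0 → ‖f‖ ≤ C * |ε| := by
  have hD := (ubdd_snd (β := β)).clm (kDw (β := β))
  have h := (((((ubdd_kW (α := β) (β := β) hd).mul (ubdd_const varW)).mul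
    ((ubdd_const 1).add (ubdd_fst.smul hD))).clm proj).clm
      ((linEquiv (β := β)).symm : Yhat β →L[ℝ] X β)).neg
  obtain ⟨C, δ, hC, hδ, hb⟩ := h.exists_bound
  refine ⟨C, δ, hC, hδ, fun ε hε f hf h0 => ?_⟩
  have h1 := hb ε hε f hf
  -- The equation reads `L f = -ε P(W w (1 + ε f'))` with `L` the linearization and `P` the
  -- projection. The right side is `ε` times a quantity bounded uniformly on the unit ball, and
  -- `L⁻¹` is bounded.
  have h2 : linEquiv f = ε • -proj (kW d (kΩ d ε f) (kC d ε f) ε f * varW * (1 + ε • kDw f)) := by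
    rw [kGhat, map_add, map_smul, map_neg] at h0
    rw [linEquiv_apply, smul_neg]
    exact eq_neg_of_add_eq_zero_left h0
  have h3 : f = ε • -((linEquiv (β := β)).symm
      (proj (kW d (kΩ d ε f) (kC d ε f) ε f * varW * (1 + ε • kDw f)))) := by
    rw [← map_neg, ← map_smul, ← h2, ContinuousLinearEquiv.symm_apply_apply]
  calc ‖f‖ = |ε| * ‖-((linEquiv (β := β)).symm
      (proj (kW d (kΩ d ε f) (kC d ε f) ε f * varW * (1 + ε • kDw f))))‖ := by
        conv_lhs => rw [h3]
        rw [norm_smul, Real.norm_eq_abs]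
    _ ≤ |ε| * C := by gcongr; exact h1
    _ = _ := mul_comm _ _

end Bounds

/-! ### The curve of solutions -/

section Curve

variable {β : ℝ≥0} [Fact (0 < β)] [Fact (β < 1)] {d : ℝ}

lemma Ghat_eq_zero_iff (hd : 2 < d) {ε : ℝ} (hε : |ε| < 1 / 2) {f : X β} (hf : ‖f‖ < 1) :
    (∀ w, Ghat d ε f w = 0) ↔ proj (kGhat d ε f) = 0 := by
  simp only [← proj_kGhat_apply hd hε hf]
  exact ⟨fun h => Yhat.ext' h, fun h w => by rw [h]; rfl⟩

/-- The implicit function theorem gives uniqueness only near the origin of `ℝ × X`. The a priori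
bound `‖f‖ ≤ C |ε|` brings every solution of the unit ball into that neighbourhood once `ε` is
small. -/
lemma exists_curve (hd : 2 < d) : ∃ u : ℝ → X β, ∃ ρ : ℝ, 0 < ρ ∧ ρ < 1 / 2 ∧ u 0 = 0 ∧
    ContDiffOn ℝ 1 u (Icc (-ρ) ρ) ∧ ∀ ε, |ε| ≤ ρ → ‖u ε‖ < 1 ∧
      ∀ f : X β, ‖f‖ < 1 → (proj (kGhat d ε f) = 0 ↔ f = u ε) := by
  have cdf := contDiffAt_proj_kGhat (β := β) hd
  have hinv : ((fderiv ℝ (fun p : ℝ × X β => proj (kGhat d p.1 p.2)) (0, 0)).comp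
      (ContinuousLinearMap.inr ℝ ℝ (X β))).IsInvertible := by
    rw [fderiv_comp_inr hd]
    exact ⟨linEquiv, coe_linEquiv⟩
  have hΦ0 : proj (kGhat d 0 (0 : X β)) = 0 := by rw [proj_kGhat_zero, map_zero]
  set u := cdf.implicitFunction one_ne_zero hinv with hu
  have hu0 : u 0 = 0 := cdf.implicitFunction_apply_self one_ne_zero hinv
  have hsol := cdf.eventually_apply_eq_iff_implicitFunction one_ne_zero hinv
  rw [hΦ0] at hsol
  have hsm : ContDiffAt ℝ 1 u 0 := cdf.contDiffAt_implicitFunction one_ne_zero hinv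
  have hsm' : ∀ᶠ ε in 𝓝 (0 : ℝ), ContDiffAt ℝ 1 u ε := hsm.eventually (by simp)
  have hcont : Tendsto u (𝓝 0) (𝓝 0) := by
    have := hsm.continuousAt.tendsto
    rwa [hu0] at this
  have h1 : ∀ᶠ ε in 𝓝 (0 : ℝ), ‖u ε‖ < 1 := by
    have := hcont.eventually (Metric.ball_mem_nhds (0 : X β) one_pos)
    simpa using this
  have h2 : ∀ᶠ ε in 𝓝 (0 : ℝ), proj (kGhat d ε (u ε)) = 0 := by
    have := cdf.eventually_apply_implicitFunction one_ne_zero hinv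
    rwa [hΦ0] at this
  obtain ⟨C, δ, hC, hδ, hb⟩ := exists_bound_of_Ghat_eq_zero (β := β) hd
  obtain ⟨r, hr, hsol'⟩ := Metric.eventually_nhds_iff.1 hsol
  obtain ⟨r₁, hr₁, hall⟩ := Metric.eventually_nhds_iff.1 (hsm'.and (h1.and h2))
  -- `r₁` is the range where `u` is smooth, small and a solution, `δ` that of the a priori bound,
  -- and `r` the radius of local uniqueness. The choice `ρ ≤ r/(2C)` forces `C |ε| < r`.
  set ρ := min (min (r₁ / 2) (δ / 2)) (min (min (r / 2) (r / (2 * C))) (1 / 4)) with hρ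
  have hρ0 : 0 < ρ := by positivity
  have k1 : ρ < r₁ := by
    have : ρ ≤ r₁ / 2 := (min_le_left _ _).trans (min_le_left _ _)
    linarith
  have k2 : ρ < δ := by
    have : ρ ≤ δ / 2 := (min_le_left _ _).trans (min_le_right _ _)
    linarith
  have k3 : ρ < r := by
    have : ρ ≤ r / 2 := (min_le_right _ _).trans ((min_le_left _ _).trans (min_le_left _ _))
    linarith
  have k4 : C * ρ < r := by
    have : ρ ≤ r / (2 * C) := (min_le_right _ _).trans ((min_le_left _ _).trans (min_le_right _ _))
    rw [le_div_iff₀ (by positivity)] at this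
    nlinarith
  have k5 : ρ < 1 / 2 := by
    have : ρ ≤ 1 / 4 := (min_le_right _ _).trans (min_le_right _ _)
    linarith
  have hd0 : ∀ ε : ℝ, |ε| ≤ ρ → dist ε 0 < r₁ := fun ε hε => by
    rw [dist_zero_right, Real.norm_eq_abs]
    linarith
  refine ⟨u, ρ, hρ0, k5, hu0, fun ε hε => ?_, fun ε hε => ?_⟩
  · exact (hall (hd0 ε (abs_le.2 hε))).1.contDiffWithinAt
  · obtain ⟨-, a1, a2⟩ := hall (hd0 ε hε)
    refine ⟨a1, fun f hf => ⟨fun h0 => ?_, fun h => by rw [h]; exact a2⟩⟩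
    have a3 := hb ε (by linarith) f hf h0
    have a4 : dist ((ε, f) : ℝ × X β) (0, 0) < r := by
      rw [Prod.dist_eq, dist_zero_right, dist_zero_right, Real.norm_eq_abs]
      refine max_lt (by linarith) ?_
      nlinarith
    exact ((hsol' a4).1 h0).symm

end Curve

/-! ### The trivial deformation is not a solution -/

section Nontrivial

variable {d ε : ℝ}

lemma circleDeriv_zero_apply (w : Circle) : circleDeriv (0 : Circle → ℂ) w = 0 := by
  rw [circleDeriv_zero]; rfl

/-- For `f = 0` only `∮ τ̄/(ετ + c) dτ` with `c = εw - 2d` is left. Partial fractions isolate the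
pole `-c/ε`, which lies outside the disc and contributes nothing. -/
lemma F_zero (hd : 2 < d) (hε : |ε| < 1 / 2) (hε0 : ε ≠ 0) (Ω : ℝ) (w : Circle) :
    F d Ω ε 0 w = 2 * Ω * (ε * (w⁻¹ : Circle) - d) * w + w / (2 * d - ε * w) := by
  have hεC : (ε : ℂ) ≠ 0 := by exact_mod_cast hε0
  have hcn : ‖(ε * w : ℂ)‖ = |ε| := by
    rw [norm_mul, Circle.norm_coe, mul_one, Complex.norm_real, Real.norm_eq_abs]
  have hn : 2 < ‖(ε * w - 2 * d : ℂ)‖ := by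
    have h1 := norm_sub_norm_le (2 * d : ℂ) (ε * w)
    rw [norm_sub_rev, hcn, norm_mul, Complex.norm_real, Real.norm_of_nonneg (by linarith)] at h1
    norm_num at h1
    linarith
  set c : ℂ := ε * w - 2 * d with hc
  have hc0 : c ≠ 0 := norm_pos_iff.1 (by linarith)
  have hz : 1 < ‖-c / ε‖ := by
    rw [norm_div, norm_neg, Complex.norm_real, Real.norm_eq_abs, lt_div_iff₀ (abs_pos.2 hε0)]
    linarith
  have hne : ∀ τ : Circle, (ε * τ + c : ℂ) ≠ 0 := fun τ h => by
    have h1 : (τ : ℂ) = -c / ε := by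
      field_simp
      linear_combination h
    rw [← h1, Circle.norm_coe] at hz
    exact lt_irrefl _ hz
  have hm : mean (fun τ : Circle => ((τ⁻¹ : Circle) : ℂ) / (ε * ((τ : ℂ) + w) - 2 * d)) = c⁻¹ := by
    have h1 : (fun τ : Circle => (τ : ℂ) * (((τ⁻¹ : Circle) : ℂ) / (ε * ((τ : ℂ) + w) - 2 * d))) =
        fun τ : Circle => c⁻¹ - c⁻¹ * ((τ : ℂ) / (τ - -c / ε)) := by
      funext τ
      have h2 := Circle.coe_ne_zero τ
      have h3 := hne τ
      have h4 : (ε * ((τ : ℂ) + w) - 2 * d : ℂ) = ε * τ + c := by rw [hc]; ring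
      have h5 : (τ : ℂ) - -c / ε = (ε * τ + c) / ε := by field_simp; ring
      rw [h4, h5, Circle.coe_inv]
      obtain ⟨x, hx⟩ : ∃ x : ℂ, x = ε * τ + c := ⟨_, rfl⟩
      rw [← hx] at h3 ⊢
      field_simp
      rw [hx]
      ring
    have hcont : Continuous fun τ : Circle => c⁻¹ * ((τ : ℂ) / (τ - -c / ε)) := by
      refine continuous_const.mul (Continuous.div (by fun_prop) (by fun_prop) fun τ h => ?_)
      rw [← sub_eq_zero.1 h, Circle.norm_coe] at hz
      exact lt_irrefl _ hz
    rw [mean_eq_cint, h1, cint_sub continuous_const hcont, cint_const_mul,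
      cint_div_sub_eq_zero hz, mul_zero, sub_zero, cint_const, Complex.real_smul]
    have : (Real.pi : ℂ) ≠ 0 := by exact_mod_cast Real.pi_ne_zero
    push_cast
    field_simp
  have h2 : F₂ ε 0 w = 0 := by
    simp [F₂, circleDeriv_zero_apply, mean]
  have h3 : F₃ d ε 0 w = w / (2 * d - ε * w) := by
    simp only [F₃, circleDeriv_zero_apply, Pi.zero_apply, mul_zero, add_zero, mul_one]
    rw [hm, show (2 * d - ε * w : ℂ) = -c by rw [hc]; ring]
    field_simp
  rw [F, h2, h3, F₁]
  simp [circleDeriv_zero_apply]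

lemma normSq_sub_mul_coe (w : Circle) :
    Complex.normSq (2 * (d : ℂ) - (ε : ℂ) * (w : ℂ)) = 4 * d ^ 2 + ε ^ 2 - 4 * d * ε * (w : ℂ).re := by
  have h := Circle.normSq_coe w
  rw [Complex.normSq_apply] at h ⊢
  simp only [Complex.sub_re, Complex.sub_im, Complex.mul_re, Complex.mul_im, Complex.ofReal_re,
    Complex.ofReal_im, Complex.re_ofNat, Complex.im_ofNat]
  linear_combination ε ^ 2 * h

lemma im_F_zero (hd : 2 < d) (hε : |ε| < 1 / 2) (hε0 : ε ≠ 0) (Ω : ℝ) (w : Circle) :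
    (F d Ω ε 0 w).im = (w : ℂ).im * (-2 * Ω * d + 2 * d /
      Complex.normSq (2 * (d : ℂ) - (ε : ℂ) * (w : ℂ))) := by
  have h1 : (2 * Ω * (ε * (w⁻¹ : Circle) - d) * w : ℂ) =
      ((2 * Ω * ε : ℝ) : ℂ) + ((-2 * Ω * d : ℝ) : ℂ) * w := by
    have := Circle.coe_ne_zero w
    rw [Circle.coe_inv]
    push_cast
    field_simp
    ring
  have h := Circle.normSq_coe w
  rw [Complex.normSq_apply] at h
  rw [F_zero hd hε hε0, h1, Complex.add_im, Complex.add_im, Complex.ofReal_im, Complex.im_ofReal_mul,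
    Complex.div_im]
  simp only [Complex.sub_re, Complex.sub_im, Complex.mul_re, Complex.mul_im, Complex.ofReal_re,
    Complex.ofReal_im, Complex.re_ofNat, Complex.im_ofNat]
  ring

/-- If `Ĝ(ε, 0)` vanished, `|2d - εw|²` would agree at `w = e^i` and `w = -e^i`, as `Im w ≠ 0`
there; but the two values differ by `8dε cos 1`. -/
lemma exists_Ghat_zero_ne_zero (hd : 2 < d) (hε : |ε| < 1 / 2) (hε0 : ε ≠ 0) :
    ∃ w, Ghat d ε 0 w ≠ 0 := by
  by_contra! h
  have h1 := h (Circle.exp 1)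
  have h2 := h (-Circle.exp 1)
  rw [Ghat, im_F_zero hd hε hε0] at h1 h2
  have hs : (Circle.exp 1 : ℂ).im = Real.sin 1 := by
    rw [Circle.coe_exp, Complex.exp_ofReal_mul_I_im]
  have hcs : (Circle.exp 1 : ℂ).re = Real.cos 1 := by
    rw [Circle.coe_exp, Complex.exp_ofReal_mul_I_re]
  have s1 : 0 < Real.sin 1 := Real.sin_pos_of_pos_of_lt_pi one_pos (by linarith [Real.pi_gt_three])
  have c1 : 0 < Real.cos 1 := Real.cos_one_pos
  have hneg : ((-Circle.exp 1 : Circle) : ℂ) = -(Circle.exp 1 : ℂ) := by simp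
  rw [hs] at h1
  rw [hneg, Complex.neg_im, hs] at h2
  have e1 := (mul_eq_zero.1 h1).resolve_left s1.ne'
  have e2 := (mul_eq_zero.1 h2).resolve_left (neg_ne_zero.2 s1.ne')
  rw [normSq_sub_mul_coe, hcs] at e1
  rw [← hneg, normSq_sub_mul_coe, hneg, Complex.neg_re, hcs] at e2
  have hb : |4 * d * ε * Real.cos 1| < 4 * d ^ 2 := by
    rw [abs_mul, abs_mul, abs_mul, abs_of_pos (by norm_num : (0 : ℝ) < 4),
      abs_of_pos (by linarith : 0 < d), abs_of_pos c1]
    have := Real.cos_le_one 1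
    have h3 : |ε| * Real.cos 1 ≤ 1 / 2 := by nlinarith [abs_nonneg ε]
    nlinarith
  have hb' := abs_lt.1 hb
  have p1 : 0 < 4 * d ^ 2 + ε ^ 2 - 4 * d * ε * Real.cos 1 := by nlinarith
  have p2 : 0 < 4 * d ^ 2 + ε ^ 2 - 4 * d * ε * -Real.cos 1 := by nlinarith
  have e3 : 2 * d / (4 * d ^ 2 + ε ^ 2 - 4 * d * ε * Real.cos 1) =
      2 * d / (4 * d ^ 2 + ε ^ 2 - 4 * d * ε * -Real.cos 1) := by linarith
  rw [div_eq_div_iff p1.ne' p2.ne'] at e3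
  have e4 : 2 * d * (8 * d * ε * Real.cos 1) = 0 := by linarith
  have : d ≠ 0 := by linarith
  simp [this, hε0, c1.ne'] at e4

end Nontrivial

/-! ### The reflection `f(w) ↦ f(-w)` -/

section Reflection

variable {β : ℝ≥0} {f : Circle → ℂ} {d ε : ℝ}

lemma circleDeriv_comp_neg (f : Circle → ℂ) (w : Circle) :
    circleDeriv (fun w => f (-w)) w = -circleDeriv f (-w) := by
  simp only [circleDeriv, ← neg_mul, Circle.coe_neg, inv_neg]
  ring

lemma circleDifferentiable_comp_neg (hf : CircleDifferentiable f) :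
    CircleDifferentiable fun w => f (-w) := fun w => by
  have := hf (-w)
  simpa only [neg_mul] using this

lemma fourierCoef_comp_neg (f : Circle → ℂ) (n : ℤ) :
    fourierCoef (fun w => f (-w)) n = (-1 : ℂ) ^ n * fourierCoef f n := by
  have h : (fun w : Circle => f (-w) * (w : ℂ) ^ (-n - 1)) = fun w : Circle =>
      (-1 : ℂ) ^ (-n - 1) * (fun w : Circle => f w * (w : ℂ) ^ (-n - 1)) (-w) := by
    funext w
    have h1 : ((-1 : ℂ) ^ (-n - 1)) * ((-1 : ℂ) ^ (-n - 1)) = 1 := by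
      rw [← mul_zpow]
      norm_num
    simp only [Circle.coe_neg]
    rw [← neg_one_mul (w : ℂ), mul_zpow]
    linear_combination (-f (-w) * (w : ℂ) ^ (-n - 1)) * h1
  have h2 : (-1 : ℂ) ^ (-n - 1) = -(-1 : ℂ) ^ n := by
    rw [zpow_sub₀ (by norm_num), zpow_neg, ← inv_zpow]
    norm_num [div_neg]
  have h3 := mean_neg_arg fun w : Circle => f w * (w : ℂ) ^ (-n - 1)
  have h4 : fourierCoef (fun w => f (-w)) n = (-1 : ℂ) ^ (-n - 1) * -fourierCoef f n := by
    rw [fourierCoef, h, mean_const_mul]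
    exact congrArg _ h3
  rw [h4, h2]
  ring

lemma dist_neg_circle (p q : Circle) : dist (-p) (-q) = dist p q := by
  rw [dist_eq_norm_coe, dist_eq_norm_coe, Circle.coe_neg, Circle.coe_neg, neg_sub_neg, norm_sub_rev]

/-- The reflection of an element of `X`. -/
lemma exists_reflection [Fact (0 < β)] [Fact (β < 1)] (f : X β) : ∃ g : X β, ‖g‖ ≤ ‖f‖ ∧ ∀ w, g w = f (-w) := by
  have hc : Continuous fun w : Circle => f (-w) := f.continuous.comp continuous_neg
  have hd : circleDeriv (fun w => f (-w)) = fun w => -circleDeriv f (-w) :=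
    funext (circleDeriv_comp_neg f)
  have hH : ∀ p q, ‖-circleDeriv f (-p) - -circleDeriv f (-q)‖ ≤
      nnHolderNorm β (circleDeriv f) * dist p q ^ (β : ℝ) := fun p q => by
    have h := f.memHolder_deriv.holderWith.dist_le (-q) (-p)
    rwa [dist_eq_norm, dist_neg_circle, dist_comm, ← neg_sub_neg] at h
  have hmem : (⟨fun w => f (-w), hc⟩ : C(Circle, ℂ)) ∈ XSubmodule β := by
    refine ⟨circleDifferentiable_comp_neg f.differentiable,
      ⟨nnHolderNorm β (circleDeriv f), ?_⟩, fun n => ?_, fun n => ?_⟩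
    · change HolderWith _ β (circleDeriv fun w => f (-w))
      rw [hd]
      exact holderWith_of_dist_le fun p q => by rw [dist_eq_norm]; exact hH p q
    · change fourierCoef (fun w => f (-w)) n = 0
      rw [fourierCoef_comp_neg, fourierCoef_nonneg, mul_zero]
    · change (fourierCoef (fun w => f (-w)) _).im = 0
      rw [fourierCoef_comp_neg, Complex.mul_im, fourierCoef_im, mul_zero, zero_add]
      rcases Int.even_or_odd (-(n : ℤ)) with h | h
      · rw [h.neg_one_zpow, Complex.one_im, zero_mul]
      · rw [h.neg_one_zpow, Complex.neg_im, Complex.one_im, neg_zero, zero_mul]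
  let g : X β := ⟨_, hmem⟩
  have hg : circleDeriv g = fun w => -circleDeriv f (-w) := hd
  refine ⟨g, ?_, fun w => rfl⟩
  rw [norm_def f]
  refine X.norm_le_of_bounds (h := g) (fun w => (incl f).norm_coe_le_norm (-w)) (fun w => ?_)
    (NNReal.coe_nonneg _) (fun p q => ?_)
  · rw [hg, norm_neg]
    exact le_ciSup (bddAbove_of_memHolder f.memHolder_deriv) (-w)
  · rw [hg]
    exact hH p q

/-- The substitution `τ ↦ -τ` reverses `dτ`, so the sign of the integrand and that of `dτ` cancel.
-/
lemma mean_eq_of_comp_neg {g h : Circle → ℂ} (H : ∀ τ, g τ = -h (-τ)) : mean g = mean h := by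
  have : g = fun τ => -h (-τ) := funext H
  rw [this, mean_neg, mean_neg_arg, neg_neg]

lemma mean_eq_neg_of_comp_neg {g h : Circle → ℂ} (H : ∀ τ, g τ = h (-τ)) : mean g = -mean h := by
  have : g = fun τ => h (-τ) := funext H
  rw [this, mean_neg_arg]

variable (f d ε)

lemma circleDeriv_reflection :
    circleDeriv (fun w => f (-w)) = fun w => -circleDeriv f (-w) :=
  funext (circleDeriv_comp_neg f)

lemma F₁_reflection (Ω : ℝ) (w : Circle) :
    F₁ d (-ε) Ω (fun w => f (-w)) w = -F₁ d ε Ω f (-w) := by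
  simp only [F₁, circleDeriv_reflection, Circle.coe_neg, inv_neg, Circle.coe_inv, Complex.ofReal_neg]
  ring

lemma F₂_reflection (w : Circle) : F₂ (-ε) (fun w => f (-w)) w = -F₂ ε f (-w) := by
  have h1 : (mean fun τ : Circle => (conj ((τ : ℂ) - w) + ((-ε : ℝ) : ℂ) * conj (f (-τ) - f (-w))) /
      ((τ : ℂ) - w + ((-ε : ℝ) : ℂ) * (f (-τ) - f (-w))) * -circleDeriv f (-τ)) =
      mean fun τ : Circle => (conj ((τ : ℂ) - (-w : Circle)) + ε * conj (f τ - f (-w))) /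
      ((τ : ℂ) - (-w : Circle) + ε * (f τ - f (-w))) * circleDeriv f τ :=
    mean_eq_of_comp_neg fun τ => by
      rw [mul_neg, ← neg_div_neg_eq]
      simp only [map_sub, map_neg, Circle.coe_neg, Complex.ofReal_neg]
      congr 3 <;> ring
  have h2 : (mean fun τ : Circle => (((τ : ℂ) - w) * conj (f (-τ) - f (-w)) -
        conj ((τ : ℂ) - w) * (f (-τ) - f (-w))) /
        (((τ : ℂ) - w) * ((τ : ℂ) - w + ((-ε : ℝ) : ℂ) * (f (-τ) - f (-w))))) =
      mean fun τ : Circle => (((τ : ℂ) - (-w : Circle)) * conj (f τ - f (-w)) -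
        conj ((τ : ℂ) - (-w : Circle)) * (f τ - f (-w))) /
        (((τ : ℂ) - (-w : Circle)) * ((τ : ℂ) - (-w : Circle) + ε * (f τ - f (-w)))) :=
    mean_eq_of_comp_neg fun τ => by
      rw [← neg_div]
      simp only [map_sub, map_neg, Circle.coe_neg, Complex.ofReal_neg]
      congr 1 <;> ring
  simp only [F₂, circleDeriv_reflection]
  rw [h1, h2, Circle.coe_neg, Complex.ofReal_neg]
  ring

lemma F₃_reflection (w : Circle) : F₃ d (-ε) (fun w => f (-w)) w = -F₃ d ε f (-w) := by
  have h1 : (mean fun τ : Circle => (((τ⁻¹ : Circle) : ℂ) + ((-ε : ℝ) : ℂ) * f (-τ⁻¹)) *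
        (1 + ((-ε : ℝ) : ℂ) * -circleDeriv f (-τ)) /
        (((-ε : ℝ) : ℂ) * ((τ : ℂ) + w) + ((-ε : ℝ) : ℂ) ^ 2 * (f (-τ) + f (-w)) - 2 * d)) =
      mean fun τ : Circle => (((τ⁻¹ : Circle) : ℂ) + ε * f τ⁻¹) * (1 + ε * circleDeriv f τ) /
        (ε * ((τ : ℂ) + (-w : Circle)) + ε ^ 2 * (f τ + f (-w)) - 2 * d) :=
    mean_eq_of_comp_neg fun τ => by
      rw [← neg_div]
      simp only [Circle.coe_neg, Circle.coe_inv, inv_neg, Complex.ofReal_neg]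
      congr 1 <;> ring
  simp only [F₃, circleDeriv_reflection]
  rw [h1, Circle.coe_neg, Complex.ofReal_neg]
  ring

lemma g₂_reflection (w : Circle) : g₂ (-ε) (fun w => f (-w)) w = -g₂ ε f (-w) := by
  have h1 : (mean fun τ : Circle => (((τ : ℂ) - w) * conj (f (-τ) - f (-w)) -
        conj ((τ : ℂ) - w) * (f (-τ) - f (-w))) /
        (((τ : ℂ) - w) * ((τ : ℂ) - w + ((-ε : ℝ) : ℂ) * (f (-τ) - f (-w)))) *
        -circleDeriv f (-τ)) =
      -mean fun τ : Circle => (((τ : ℂ) - (-w : Circle)) * conj (f τ - f (-w)) -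
        conj ((τ : ℂ) - (-w : Circle)) * (f τ - f (-w))) /
        (((τ : ℂ) - (-w : Circle)) * ((τ : ℂ) - (-w : Circle) + ε * (f τ - f (-w)))) *
        circleDeriv f τ :=
    mean_eq_neg_of_comp_neg fun τ => by
      rw [mul_neg, ← neg_mul, ← neg_div]
      simp only [map_sub, map_neg, Circle.coe_neg, Complex.ofReal_neg]
      congr 2 <;> ring
  have h2 : (mean fun τ : Circle => (conj ((τ : ℂ) - w) * (f (-τ) - f (-w)) -
        ((τ : ℂ) - w) * conj (f (-τ) - f (-w))) * (f (-τ) - f (-w)) /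
        (((τ : ℂ) - w) ^ 2 * ((τ : ℂ) - w + ((-ε : ℝ) : ℂ) * (f (-τ) - f (-w))))) =
      -mean fun τ : Circle => (conj ((τ : ℂ) - (-w : Circle)) * (f τ - f (-w)) -
        ((τ : ℂ) - (-w : Circle)) * conj (f τ - f (-w))) * (f τ - f (-w)) /
        (((τ : ℂ) - (-w : Circle)) ^ 2 * ((τ : ℂ) - (-w : Circle) + ε * (f τ - f (-w)))) :=
    mean_eq_neg_of_comp_neg fun τ => by
      rw [← neg_div_neg_eq]
      simp only [map_sub, map_neg, Circle.coe_neg, Complex.ofReal_neg]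
      congr 1 <;> ring
  simp only [g₂, circleDeriv_reflection]
  rw [h1, h2]
  ring

lemma g₃_reflection (τ w : Circle) :
    g₃ d (-ε) (fun w => f (-w)) τ w = g₃ d ε f (-τ) (-w) := by
  have h : ((-ε : ℝ) : ℂ) * ((τ : ℂ) + w) + ((-ε : ℝ) : ℂ) ^ 2 * (f (-τ) + f (-w)) - 2 * d =
      ε * (((-τ : Circle) : ℂ) + (-w : Circle)) + ε ^ 2 * (f (-τ) + f (-w)) - 2 * d := by
    simp only [Circle.coe_neg, Complex.ofReal_neg]
    ring
  simp only [g₃]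
  rw [h]
  simp only [Circle.coe_neg, Circle.coe_inv, inv_neg, Complex.ofReal_neg]
  ring

lemma T₁_reflection : T₁ d (-ε) (fun w => f (-w)) = -T₁ d ε f := by
  have h1 : (mean fun w : Circle => -g₂ ε f (-w) * (((w⁻¹ : Circle) : ℂ) - (w : ℂ)) *
        (1 + ((-ε : ℝ) : ℂ) * -circleDeriv f (-w))) =
      -mean fun w : Circle => g₂ ε f w * (((w⁻¹ : Circle) : ℂ) - (w : ℂ)) *
        (1 + ε * circleDeriv f w) :=
    mean_eq_neg_of_comp_neg fun w => by
      simp only [Circle.coe_neg, Circle.coe_inv, inv_neg, Complex.ofReal_neg]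
      ring
  have h2 : ∀ w : Circle, (mean fun τ : Circle => g₃ d ε f (-τ) (-w) *
        (1 + ((-ε : ℝ) : ℂ) * -circleDeriv f (-τ)) * ((w : ℂ) - (w⁻¹ : Circle)) *
        (1 + ((-ε : ℝ) : ℂ) * -circleDeriv f (-w))) =
      mean fun τ : Circle => g₃ d ε f τ (-w) * (1 + ε * circleDeriv f τ) *
        (((-w : Circle) : ℂ) - ((-w)⁻¹ : Circle)) * (1 + ε * circleDeriv f (-w)) := fun w =>
    mean_eq_of_comp_neg fun τ => by
      simp only [Circle.coe_neg, Circle.coe_inv, inv_neg, Complex.ofReal_neg]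
      ring
  have h3 : (mean fun w : Circle => mean fun τ : Circle => g₃ d ε f τ (-w) *
        (1 + ε * circleDeriv f τ) * (((-w : Circle) : ℂ) - ((-w)⁻¹ : Circle)) *
        (1 + ε * circleDeriv f (-w))) =
      -mean fun w : Circle => mean fun τ : Circle => g₃ d ε f τ w *
        (1 + ε * circleDeriv f τ) * ((w : ℂ) - (w⁻¹ : Circle)) * (1 + ε * circleDeriv f w) :=
    mean_eq_neg_of_comp_neg fun w => rfl
  simp only [T₁, circleDeriv_reflection, g₂_reflection, g₃_reflection]
  simp only [h2]
  rw [h1, h3, mean_neg_arg]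
  ring

lemma T₂_reflection : T₂ d (-ε) (fun w => f (-w)) = -T₂ d ε f := by
  have h1 : (mean fun w : Circle => f (-w⁻¹) * -circleDeriv f (-w) *
        (((w⁻¹ : Circle) : ℂ) - (w : ℂ))) =
      -mean fun w : Circle => f w⁻¹ * circleDeriv f w * (((w⁻¹ : Circle) : ℂ) - (w : ℂ)) :=
    mean_eq_neg_of_comp_neg fun w => by
      simp only [Circle.coe_neg, Circle.coe_inv, inv_neg]
      ring
  simp only [T₂, circleDeriv_reflection]
  rw [h1, mean_neg_arg, Complex.ofReal_neg]
  ring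

/-- The functional is equivariant with respect to the reflection. -/
lemma Ghat_reflection (w : Circle) :
    Ghat d (-ε) (fun w => f (-w)) w = -Ghat d ε f (-w) := by
  -- `T₁` and `T₂` change sign together with `ε`, and `Ω` sees only `ε T₁` and `ε T₂`.
  have h : angularVelocity d (-ε) (fun w => f (-w)) = angularVelocity d ε f := by
    simp only [angularVelocity, T₁_reflection, T₂_reflection, Complex.neg_re, neg_mul_neg]
  rw [Ghat, h, Ghat, F, F, F₁_reflection, F₂_reflection, F₃_reflection]
  simp only [Complex.add_im, Complex.neg_im]
  ring

end Reflection

/-! ### Convexity of curves close to the circle -/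

/-- The closed curve `γ` is close to the unit circle, with outward normal `n` which is close to the
one of the circle in the Lipschitz norm. -/
structure NearCircle (κ : ℝ) (γ n : Circle → ℂ) (r : Circle → ℝ) : Prop where
  small : κ ≤ 1 / 20
  diff : CircleDifferentiable γ
  pos : ∀ w, 0 < r w
  tangent : ∀ w, w * circleDeriv γ w = r w * n w
  near : ∀ w, ‖γ w - w‖ ≤ κ
  normal_near : ∀ w, ‖n w - w‖ ≤ κ
  normal_lipschitz : ∀ w w', ‖(n w - w) - (n w' - w')‖ ≤ κ * dist w w'

/-- The signed distance (up to normalization) of `z` from the tangent at `γ w`. -/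
def supportFun (γ n : Circle → ℂ) (z : ℂ) (w : Circle) : ℝ := (conj (n w) * (z - γ w)).re

/-- The intersection of the open half planes bounded by the tangents. -/
def tangentInterior (γ n : Circle → ℂ) : Set ℂ := {z | ∀ w, supportFun γ n z w < 0}

/-- The intersection of the closed half planes bounded by the tangents. -/
def tangentHull (γ n : Circle → ℂ) : Set ℂ := {z | ∀ w, supportFun γ n z w ≤ 0}

lemma supportFun_combo (γ n : Circle → ℂ) (x y : ℂ) (w : Circle) {a b : ℝ} (hab : a + b = 1) :
    supportFun γ n (a • x + b • y) w = a * supportFun γ n x w + b * supportFun γ n y w := by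
  have h : (a : ℂ) + b = 1 := by exact_mod_cast hab
  have h1 : conj (n w) * (a • x + b • y - γ w) =
      a * (conj (n w) * (x - γ w)) + b * (conj (n w) * (y - γ w)) := by
    rw [Complex.real_smul, Complex.real_smul]
    linear_combination (conj (n w) * γ w) * h
  rw [supportFun, h1, Complex.add_re, Complex.re_ofReal_mul, Complex.re_ofReal_mul]
  rfl

lemma supportFun_self (γ n : Circle → ℂ) (w : Circle) : supportFun γ n (γ w) w = 0 := by simp [supportFun]

lemma tangentInterior_subset (γ n : Circle → ℂ) : tangentInterior γ n ⊆ tangentHull γ n := fun _ hz w => (hz w).le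

lemma convex_tangentInterior (γ n : Circle → ℂ) : Convex ℝ (tangentInterior γ n) := by
  intro x hx y hy a b ha hb hab w
  rw [supportFun_combo γ n x y w hab]
  have h1 := hx w
  have h2 := hy w
  rcases ha.eq_or_lt with rfl | ha'
  · have : b = 1 := by linarith
    subst this
    linarith
  · nlinarith

namespace NearCircle

variable {κ : ℝ} {γ n : Circle → ℂ} {r : Circle → ℝ}

lemma nonneg (h : NearCircle κ γ n r) : 0 ≤ κ := (norm_nonneg _).trans (h.near 1)

lemma continuous_curve (h : NearCircle κ γ n r) : Continuous γ := h.diff.continuous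

lemma continuous_normal (h : NearCircle κ γ n r) : Continuous n := by
  have h1 : LipschitzWith ⟨κ, h.nonneg⟩ fun w => n w - w :=
    LipschitzWith.of_dist_le_mul fun w w' => by
      rw [dist_eq_norm]
      exact h.normal_lipschitz w w'
  have h2 := h1.continuous.add (by fun_prop : Continuous fun w : Circle => (w : ℂ))
  have h3 : n = (fun w => n w - w) + fun w : Circle => (w : ℂ) := by
    funext w
    rw [Pi.add_apply]
    ring
  rw [h3]
  exact h2

lemma continuous_supportFun (h : NearCircle κ γ n r) :
    Continuous fun p : ℂ × Circle => supportFun γ n p.1 p.2 := by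
  have h1 := h.continuous_curve
  have h2 := h.continuous_normal
  unfold supportFun
  exact Complex.continuous_re.comp ((continuous_conj.comp (h2.comp continuous_snd)).mul
    (continuous_fst.sub (h1.comp continuous_snd)))

lemma normal_ne_zero (h : NearCircle κ γ n r) (w : Circle) : n w ≠ 0 := fun h0 => by
  have h1 := h.normal_near w
  rw [h0, zero_sub, norm_neg, Circle.norm_coe] at h1
  linarith [h.small]

lemma hasDerivAt (h : NearCircle κ γ n r) (w : Circle) (t : ℝ) :
    HasDerivAt (fun t : ℝ => γ (w * Circle.exp t))
      (I * (r (w * Circle.exp t) * n (w * Circle.exp t))) t := by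
  rw [← h.tangent, ← mul_assoc]
  exact h.diff.hasDerivAt w t

/-- On the unit circle the right side is `t sin t ≥ (2/π) t² ≥ t²/2`. The deviation of the normal
costs at most `4κ t² ≤ t²/5`, and `1/2 - 1/5 > 1/4`. The Lipschitz bound on `n w - w` is essential:
a sup bound alone would not give an error proportional to `|t|`. -/
lemma sq_div_four_le (h : NearCircle κ γ n r) (w : Circle) {t : ℝ} (ht : |t| ≤ Real.pi / 2) :
    t ^ 2 / 4 ≤ t * (conj (n w) * n (w * Circle.exp t)).im := by
  have hκ := h.small
  have hκ0 := h.nonneg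
  have e1 : (conj (n w) * n (w * Circle.exp t)).im = Real.sin t +
      (conj (n w - w) * (w * Circle.exp t - w : ℂ) + conj (n w) *
        ((n (w * Circle.exp t) - (w * Circle.exp t : Circle)) - (n w - w))).im := by
    have h1 : conj (w : ℂ) * w = 1 := by
      rw [← Circle.coe_inv_eq_conj, Circle.coe_inv, inv_mul_cancel₀ (Circle.coe_ne_zero w)]
    have h2 : conj (n w) * n (w * Circle.exp t) = conj (n w) * n w + ((Circle.exp t : ℂ) - 1) +
      (conj (n w - w) * (w * Circle.exp t - w : ℂ) + conj (n w) *
        ((n (w * Circle.exp t) - (w * Circle.exp t : Circle)) - (n w - w))) := by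
      rw [map_sub, Circle.coe_mul]
      linear_combination (Circle.exp t - 1 : ℂ) * h1
    have h3 : (conj (n w) * n w).im = 0 := by
      rw [mul_comm, Complex.mul_conj, Complex.ofReal_im]
    rw [h2, Complex.add_im, Complex.add_im, h3, Complex.sub_im, Complex.one_im, Circle.coe_exp,
      Complex.exp_ofReal_mul_I_im]
    ring
  set err := (conj (n w - w) * (w * Circle.exp t - w : ℂ) + conj (n w) *
        ((n (w * Circle.exp t) - (w * Circle.exp t : Circle)) - (n w - w))).im with herr
  have hdist : dist (w * Circle.exp t) w ≤ |t| := by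
    rw [dist_mul_exp]
    exact dist_exp_le t
  have hnn : ‖n w‖ ≤ 1 + κ := by
    have := norm_add_le (n w - w) (w : ℂ)
    rw [sub_add_cancel, Circle.norm_coe] at this
    linarith [h.normal_near w]
  have e2 : |err| ≤ 4 * κ * |t| := by
    refine (Complex.abs_im_le_norm _).trans ((norm_add_le _ _).trans ?_)
    rw [norm_mul, norm_mul, RCLike.norm_conj, RCLike.norm_conj]
    have a1 : ‖(w * Circle.exp t - w : ℂ)‖ ≤ |t| := by
      have := dist_eq_norm_coe (w * Circle.exp t) w
      rw [Circle.coe_mul] at this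
      rw [← this]
      exact hdist
    have a2 := h.normal_lipschitz (w * Circle.exp t) w
    have a3 := h.normal_near w
    calc _ ≤ κ * |t| + (1 + κ) * (κ * |t|) := by
          gcongr
          exact a2.trans (by gcongr)
      _ ≤ 4 * κ * |t| := by nlinarith [abs_nonneg t, mul_nonneg hκ0 (abs_nonneg t)]
  have e3 : 2 / Real.pi * t ^ 2 ≤ t * Real.sin t := by
    have h1 := Real.mul_le_sin (abs_nonneg t) ht
    have h2 : |t| * Real.sin |t| = t * Real.sin t := by
      rcases abs_cases t with ⟨h3, -⟩ | ⟨h3, -⟩ <;> rw [h3]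
      rw [Real.sin_neg]
      ring
    rw [← h2, ← sq_abs]
    nlinarith [abs_nonneg t]
  have e4 : (1 / 2 : ℝ) ≤ 2 / Real.pi := by
    rw [div_le_div_iff₀ two_pos Real.pi_pos]
    linarith [Real.pi_le_four]
  have e5 : |t * err| ≤ 1 / 5 * t ^ 2 := by
    rw [abs_mul, ← sq_abs t]
    nlinarith [abs_nonneg t, mul_nonneg (abs_nonneg t) (abs_nonneg t)]
  have e6 := (abs_le.1 e5).1
  rw [e1, mul_add]
  nlinarith [sq_nonneg t]

/-- The curve lies strictly on one side of each of its tangents. -/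
lemma supportFun_curve_neg (h : NearCircle κ γ n r) {w w₀ : Circle} (hw : w ≠ w₀) : supportFun γ n (γ w) w₀ < 0 := by
  have hκ := h.small
  have hκ0 := h.nonneg
  obtain ⟨s, hs, rfl, -⟩ := exists_arc w w₀
  have hs0 : s ≠ 0 := by
    rintro rfl
    simp at hw
  -- Far points, with `cos s ≤ 0`, have margin `1` on the circle itself, so closeness suffices. Near
  -- points are reached along an arc on which the turning normal makes the support function
  -- monotone.
  rcases le_or_gt (Real.cos s) 0 with hc | hc
  · have h1 : conj (w₀ : ℂ) * w₀ = 1 := by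
      rw [← Circle.coe_inv_eq_conj, Circle.coe_inv, inv_mul_cancel₀ (Circle.coe_ne_zero w₀)]
    have h2 : conj (n w₀) * (γ (w₀ * Circle.exp s) - γ w₀) = ((Circle.exp s : ℂ) - 1) +
        (conj (n w₀) * ((γ (w₀ * Circle.exp s) - (w₀ * Circle.exp s : Circle)) - (γ w₀ - w₀)) +
          conj (n w₀ - w₀) * ((w₀ * Circle.exp s : Circle) - w₀)) := by
      rw [map_sub, Circle.coe_mul]
      linear_combination (Circle.exp s - 1 : ℂ) * h1
    have hnn : ‖n w₀‖ ≤ 1 + κ := by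
      have := norm_add_le (n w₀ - w₀) (w₀ : ℂ)
      rw [sub_add_cancel, Circle.norm_coe] at this
      linarith [h.normal_near w₀]
    have h3 : ‖conj (n w₀) * ((γ (w₀ * Circle.exp s) - (w₀ * Circle.exp s : Circle)) - (γ w₀ - w₀)) +
          conj (n w₀ - w₀) * ((w₀ * Circle.exp s : Circle) - w₀)‖ ≤ (1 + κ) * (κ + κ) + κ * 2 := by
      refine (norm_add_le _ _).trans ?_
      rw [norm_mul, norm_mul, RCLike.norm_conj, RCLike.norm_conj, ← dist_eq_norm_coe]
      gcongr
      · exact (norm_sub_le _ _).trans (add_le_add (h.near _) (h.near _))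
      · exact h.normal_near w₀
      · exact dist_le_two _ _
    have h4 := (le_abs_self _).trans ((Complex.abs_re_le_norm _).trans h3)
    rw [supportFun, h2, Complex.add_re, Complex.sub_re, Complex.one_re, Circle.coe_exp,
      Complex.exp_ofReal_mul_I_re]
    nlinarith
  · have hs2 : |s| ≤ Real.pi / 2 := by
      by_contra! hlt
      have := Real.cos_nonpos_of_pi_div_two_le_of_le hlt.le (by linarith [Real.pi_pos])
      rw [Real.cos_abs] at this
      linarith
    have hd : ∀ t : ℝ, HasDerivAt (fun t : ℝ => supportFun γ n (γ (w₀ * Circle.exp t)) w₀)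
        (-(r (w₀ * Circle.exp t) * (conj (n w₀) * n (w₀ * Circle.exp t)).im)) t := fun t => by
      have h1 := ((h.hasDerivAt w₀ t).sub_const (γ w₀)).const_mul (conj (n w₀))
      have h2 : HasDerivAt (fun t : ℝ => (conj (n w₀) * (γ (w₀ * Circle.exp t) - γ w₀)).re)
        (conj (n w₀) * (I * (r (w₀ * Circle.exp t) * n (w₀ * Circle.exp t)))).re t :=
        (Complex.reCLM.hasFDerivAt.comp_hasDerivAt t h1)
      have h3 : conj (n w₀) * (I * (r (w₀ * Circle.exp t) * n (w₀ * Circle.exp t))) =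
          ((r (w₀ * Circle.exp t) : ℝ) : ℂ) * (I * (conj (n w₀) * n (w₀ * Circle.exp t))) := by ring
      rw [h3, Complex.re_ofReal_mul, Complex.I_mul_re, mul_neg] at h2
      exact h2
    have hcont : Continuous fun t : ℝ => supportFun γ n (γ (w₀ * Circle.exp t)) w₀ :=
      continuous_iff_continuousAt.2 fun t => (hd t).continuousAt
    have h0 : supportFun γ n (γ (w₀ * Circle.exp 0)) w₀ = 0 := by simp [supportFun]
    rcases lt_or_gt_of_ne hs0 with hneg | hpos
    · have hmono : StrictMonoOn (fun t : ℝ => supportFun γ n (γ (w₀ * Circle.exp t)) w₀)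
          (Icc s 0) := by
        refine strictMonoOn_of_deriv_pos (convex_Icc s 0) hcont.continuousOn fun t ht => ?_
        rw [interior_Icc] at ht
        rw [(hd t).deriv]
        have h1 : |t| ≤ Real.pi / 2 := by
          rw [abs_of_neg ht.2]
          rw [abs_of_neg hneg] at hs2
          linarith [ht.1]
        have h2 := h.sq_div_four_le w₀ h1
        have h3 := h.pos (w₀ * Circle.exp t)
        have h4 : (conj (n w₀) * n (w₀ * Circle.exp t)).im < 0 := by nlinarith [ht.2]
        nlinarith
      have := hmono ⟨le_rfl, hneg.le⟩ ⟨hneg.le, le_rfl⟩ hneg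
      exact this.trans_eq h0
    · have hanti : StrictAntiOn (fun t : ℝ => supportFun γ n (γ (w₀ * Circle.exp t)) w₀)
          (Icc 0 s) := by
        refine strictAntiOn_of_deriv_neg (convex_Icc 0 s) hcont.continuousOn fun t ht => ?_
        rw [interior_Icc] at ht
        rw [(hd t).deriv]
        have h1 : |t| ≤ Real.pi / 2 := by
          rw [abs_of_pos ht.1]
          rw [abs_of_pos hpos] at hs2
          linarith [ht.2]
        have h2 := h.sq_div_four_le w₀ h1
        have h3 := h.pos (w₀ * Circle.exp t)
        have h4 : 0 < (conj (n w₀) * n (w₀ * Circle.exp t)).im := by nlinarith [ht.1]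
        nlinarith
      have := hanti ⟨le_rfl, hpos.le⟩ ⟨hpos.le, le_rfl⟩ hpos
      exact this.trans_eq h0

lemma injective (h : NearCircle κ γ n r) : Function.Injective γ := fun w w' hw => by
  by_contra hne
  have h1 := h.supportFun_curve_neg hne
  rw [hw, supportFun_self γ n] at h1
  exact lt_irrefl _ h1

lemma range_subset_tangentHull (h : NearCircle κ γ n r) : range γ ⊆ tangentHull γ n := by
  rintro _ ⟨w, rfl⟩ w₀
  rcases eq_or_ne w w₀ with rfl | hw
  · rw [supportFun_self γ n]
  · exact (h.supportFun_curve_neg hw).le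

/-- A point of the hull on a tangent is the point of contact. -/
lemma eq_of_supportFun_eq_zero (h : NearCircle κ γ n r) {z : ℂ} (hz : z ∈ tangentHull γ n) {w : Circle}
    (hw : supportFun γ n z w = 0) : z = γ w := by
  have hn0 := h.normal_ne_zero w
  -- On the tangent, `z - γ w = i a n(w)`. If `a ≠ 0`, moving the contact point slightly towards `z`
  -- yields a tangent with `z` on its wrong side.
  set a : ℝ := (conj (n w) * (z - γ w)).im / Complex.normSq (n w) with ha
  have hN : 0 < Complex.normSq (n w) := Complex.normSq_pos.2 hn0
  have hza : z - γ w = I * a * n w := by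
    have h1 : conj (n w) * (z - γ w) = I * (a * Complex.normSq (n w) : ℝ) := by
      rw [ha, div_mul_cancel₀ _ hN.ne']
      apply Complex.ext
      · rw [Complex.I_mul_re, Complex.ofReal_im, neg_zero]; exact hw
      · rw [Complex.I_mul_im, Complex.ofReal_re]
    have h2 : conj (n w) ≠ 0 := (map_ne_zero _).2 hn0
    refine mul_left_cancel₀ h2 ?_
    rw [h1]
    push_cast
    rw [Complex.normSq_eq_conj_mul_self]
    ring
  by_contra hne
  have ha0 : a ≠ 0 := by
    intro h0
    rw [h0, Complex.ofReal_zero, mul_zero, zero_mul] at hza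
    exact hne (sub_eq_zero.1 hza)
  -- To first order the curve moves along its tangent, so its displacement in the direction of the
  -- moved normal is `o(t)`.
  have hq : Tendsto (fun t : ℝ => (conj (n (w * Circle.exp t)) *
      (t⁻¹ • (γ (w * Circle.exp t) - γ w))).re) (𝓝[≠] 0) (𝓝 0) := by
    have h1 := (h.hasDerivAt w 0)
    rw [hasDerivAt_iff_tendsto_slope_zero] at h1
    simp only [zero_add, Circle.exp_zero, mul_one] at h1
    have h2 : Tendsto (fun t : ℝ => conj (n (w * Circle.exp t))) (𝓝[≠] 0) (𝓝 (conj (n w))) := by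
      have hc : Continuous fun t : ℝ => conj (n (w * Circle.exp t)) :=
        continuous_conj.comp (h.continuous_normal.comp (by fun_prop))
      have := hc.tendsto 0
      rw [Circle.exp_zero, mul_one] at this
      exact this.mono_left nhdsWithin_le_nhds
    have h3 := (Complex.continuous_re.tendsto _).comp (h2.mul h1)
    have h4 : (conj (n w) * (I * (r w * n w))).re = 0 := by
      have : conj (n w) * (I * (r w * n w)) = ((r w : ℝ) : ℂ) * (I * (n w * conj (n w))) := by ring
      rw [this, Complex.re_ofReal_mul, Complex.I_mul_re, Complex.mul_conj, Complex.ofReal_im,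
        neg_zero, mul_zero]
    rw [h4] at h3
    exact h3
  have hev : ∀ᶠ t : ℝ in 𝓝[≠] 0, |(conj (n (w * Circle.exp t)) *
      (t⁻¹ • (γ (w * Circle.exp t) - γ w))).re| < |a| / 4 := by
    have := hq.eventually (Metric.ball_mem_nhds 0 (by positivity : 0 < |a| / 4))
    simpa using this
  rw [eventually_nhdsWithin_iff, Metric.eventually_nhds_iff] at hev
  obtain ⟨δ, hδ, hev⟩ := hev
  -- `t` has the sign of `a`. Then `sq_div_four_le` makes the gain `a J` at least `|a||t|/4`, which
  -- exceeds the loss `t q` because `|q| < |a|/4`.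
  set t : ℝ := a / |a| * min (δ / 2) 1 with ht
  have hm : 0 < min (δ / 2) 1 := by positivity
  have haa : 0 < |a| := abs_pos.2 ha0
  have htabs : |t| = min (δ / 2) 1 := by
    rw [ht, abs_mul, abs_div, abs_abs, div_self haa.ne', one_mul, abs_of_pos hm]
  have hat : 0 < a * t := by
    have : a * t = |a| * min (δ / 2) 1 := by
      rw [ht, ← mul_assoc, mul_div_assoc', ← abs_mul_abs_self a]
      field_simp
    rw [this]
    positivity
  have ht0 : t ≠ 0 := fun h0 => by rw [h0, mul_zero] at hat; exact lt_irrefl _ hat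
  have ht1 : |t| ≤ Real.pi / 2 := by
    rw [htabs]
    exact (min_le_right _ _).trans (by linarith [Real.two_le_pi])
  have hb := hev (y := t) (by
    rw [dist_zero_right, Real.norm_eq_abs, htabs]
    exact (min_le_left _ _).trans_lt (by linarith)) ht0
  have hI := h.sq_div_four_le w ht1
  have hz' := hz (w * Circle.exp t)
  set q := (conj (n (w * Circle.exp t)) * (t⁻¹ • (γ (w * Circle.exp t) - γ w))).re with hqd
  set J := (conj (n w) * n (w * Circle.exp t)).im with hJ
  clear_value t
  have hψ : supportFun γ n z (w * Circle.exp t) = a * J - t * q := by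
    have h1 : conj (n (w * Circle.exp t)) * (z - γ (w * Circle.exp t)) =
        ((a : ℝ) : ℂ) * (I * conj (conj (n w) * n (w * Circle.exp t))) -
        (t : ℝ) * (conj (n (w * Circle.exp t)) * (t⁻¹ • (γ (w * Circle.exp t) - γ w))) := by
      have h2 : (t : ℂ) * (t : ℂ)⁻¹ = 1 := mul_inv_cancel₀ (by exact_mod_cast ht0)
      rw [Complex.real_smul, map_mul (starRingEnd ℂ), Complex.conj_conj]
      push_cast
      linear_combination conj (n (w * Circle.exp t)) * hza +
        (conj (n (w * Circle.exp t)) * (γ (w * Circle.exp t) - γ w)) * h2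
    rw [supportFun, h1, Complex.sub_re, Complex.re_ofReal_mul, Complex.re_ofReal_mul,
      Complex.I_mul_re, Complex.conj_im, neg_neg]
  rw [hψ] at hz'
  have h5 : |a| * |q| < a ^ 2 / 4 := by
    rw [← sq_abs a]
    nlinarith
  have h6 : a * q ≤ |a| * |q| := by rw [← abs_mul]; exact le_abs_self _
  have h7 : a * (a * J - t * q) * t = a ^ 2 * (t * J) - t ^ 2 * (a * q) := by ring
  have h8 : 0 < t ^ 2 := by positivity
  have h9 : 0 < a * (a * J - t * q) * t := by
    rw [h7]
    nlinarith [sq_nonneg a]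
  nlinarith

lemma zero_mem (h : NearCircle κ γ n r) : (0 : ℂ) ∈ tangentInterior γ n := fun w => by
  have hκ := h.small
  have hκ0 := h.nonneg
  have h1 : conj (w : ℂ) * w = 1 := by
    rw [← Circle.coe_inv_eq_conj, Circle.coe_inv, inv_mul_cancel₀ (Circle.coe_ne_zero w)]
  have h2 : conj (n w) * (0 - γ w) =
      -1 + (-(conj (n w - w) * w) - conj (n w) * (γ w - w)) := by
    rw [map_sub]
    linear_combination (-1 : ℂ) * h1
  have hnn : ‖n w‖ ≤ 1 + κ := by
    have := norm_add_le (n w - w) (w : ℂ)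
    rw [sub_add_cancel, Circle.norm_coe] at this
    linarith [h.normal_near w]
  have h3 : ‖-(conj (n w - w) * w) - conj (n w) * (γ w - w)‖ ≤ κ + (1 + κ) * κ := by
    refine (norm_sub_le _ _).trans ?_
    rw [norm_neg, norm_mul, norm_mul, RCLike.norm_conj, RCLike.norm_conj, Circle.norm_coe, mul_one]
    gcongr
    · exact h.normal_near w
    · exact h.near w
  have h4 := (le_abs_self _).trans ((Complex.abs_re_le_norm _).trans h3)
  rw [supportFun, h2, Complex.add_re, Complex.neg_re, Complex.one_re]
  nlinarith

/-- The complement is the projection of a closed set along the compact circle. -/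
lemma isOpen_tangentInterior (h : NearCircle κ γ n r) : IsOpen (tangentInterior γ n) := by
  rw [← isClosed_compl_iff]
  have h1 : (tangentInterior γ n)ᶜ =
      Prod.fst '' {p : ℂ × Circle | 0 ≤ supportFun γ n p.1 p.2} := by
    ext z
    simp [tangentInterior]
  rw [h1]
  exact isClosedMap_fst_of_compactSpace _ (isClosed_le continuous_const h.continuous_supportFun)

lemma isClosed_tangentHull (h : NearCircle κ γ n r) : IsClosed (tangentHull γ n) := by
  have h1 : tangentHull γ n = ⋂ w, {z | supportFun γ n z w ≤ 0} := by
    ext z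
    simp [tangentHull]
  rw [h1]
  refine isClosed_iInter fun w => isClosed_le ?_ continuous_const
  exact h.continuous_supportFun.comp (Continuous.prodMk_left w)

/-- Contracting a point of the hull towards the interior point `0` makes all inequalities strict. -/
lemma closure_tangentInterior (h : NearCircle κ γ n r) : closure (tangentInterior γ n) = tangentHull γ n := by
  refine Subset.antisymm (closure_minimal (tangentInterior_subset γ n) h.isClosed_tangentHull) ?_
  intro z hz
  have h0 := h.zero_mem
  have hlim : Tendsto (fun t : ℝ => (1 - t) • z + t • (0 : ℂ)) (𝓝[>] 0) (𝓝 z) := by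
    have hc : Continuous fun t : ℝ => (1 - t) • z + t • (0 : ℂ) := by fun_prop
    have := hc.tendsto 0
    simp only [sub_zero, one_smul, zero_smul, add_zero] at this
    exact this.mono_left nhdsWithin_le_nhds
  refine mem_closure_of_tendsto hlim ?_
  have : ∀ᶠ t : ℝ in 𝓝[>] 0, t ∈ Ioo (0 : ℝ) 1 := Ioo_mem_nhdsGT one_pos
  filter_upwards [this] with t ht w
  rw [supportFun_combo γ n z 0 w (by ring)]
  have h1 := hz w
  have h2 := h0 w
  nlinarith [ht.1, ht.2]

lemma tangentHull_diff (h : NearCircle κ γ n r) : tangentHull γ n \ tangentInterior γ n = range γ := by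
  ext z
  constructor
  · rintro ⟨hz, hz'⟩
    simp only [tangentInterior, mem_ofPred_eq, not_forall, not_lt] at hz'
    obtain ⟨w, hw⟩ := hz'
    exact ⟨w, (h.eq_of_supportFun_eq_zero hz (le_antisymm (hz w) hw)).symm⟩
  · intro hz
    refine ⟨h.range_subset_tangentHull hz, fun hz' => ?_⟩
    obtain ⟨w, rfl⟩ := hz
    have := hz' w
    rw [supportFun_self γ n] at this
    exact lt_irrefl _ this

/-- If a proper convex combination lies on a tangent, so do both end points, and the hull meets that
tangent only at the point of contact. -/
lemma strictConvex_tangentHull (h : NearCircle κ γ n r) : StrictConvex ℝ (tangentHull γ n) := by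
  intro x hx y hy hxy a b ha hb hab
  refine interior_maximal (tangentInterior_subset γ n) h.isOpen_tangentInterior fun w => ?_
  rw [supportFun_combo γ n x y w hab]
  have h1 := hx w
  have h2 := hy w
  by_contra! h3
  have h4 : supportFun γ n x w = 0 := by nlinarith
  have h5 : supportFun γ n y w = 0 := by nlinarith
  exact hxy ((h.eq_of_supportFun_eq_zero hx h4).trans (h.eq_of_supportFun_eq_zero hy h5).symm)

lemma frontier_tangentInterior (h : NearCircle κ γ n r) : frontier (tangentInterior γ n) = range γ := by
  rw [frontier, h.closure_tangentInterior, h.isOpen_tangentInterior.interior_eq,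
    h.tangentHull_diff]

/-- A point with `|z| > 2` violates the tangent at the parameter `z/|z|`. -/
lemma isBounded_tangentHull (h : NearCircle κ γ n r) : Bornology.IsBounded (tangentHull γ n) := by
  have hκ := h.small
  have hκ0 := h.nonneg
  refine (Metric.isBounded_iff_subset_closedBall 0).2 ⟨2, fun z hz => ?_⟩
  rw [mem_closedBall_zero_iff]
  by_contra! hlt
  have hz0 : z ≠ 0 := norm_pos_iff.1 (by linarith)
  obtain ⟨w, hw⟩ : ∃ w : Circle, z = ‖z‖ * (w : ℂ) := by
    refine ⟨Circle.exp z.arg, ?_⟩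
    rw [Circle.coe_exp, Complex.norm_mul_exp_arg_mul_I]
  have h1 : conj (w : ℂ) * w = 1 := by
    rw [← Circle.coe_inv_eq_conj, Circle.coe_inv, inv_mul_cancel₀ (Circle.coe_ne_zero w)]
  have h2 : conj (n w) * (z - γ w) =
      ((‖z‖ - 1 : ℝ) : ℂ) + (conj (n w - w) * (z - w) - conj (n w) * (γ w - w)) := by
    rw [map_sub]
    push_cast
    linear_combination ((‖z‖ : ℂ) - 1) * h1 + conj (w : ℂ) * hw
  have hnn : ‖n w‖ ≤ 1 + κ := by
    have := norm_add_le (n w - w) (w : ℂ)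
    rw [sub_add_cancel, Circle.norm_coe] at this
    linarith [h.normal_near w]
  have h3 : ‖conj (n w - w) * (z - w) - conj (n w) * (γ w - w)‖ ≤
      κ * (‖z‖ + 1) + (1 + κ) * κ := by
    refine (norm_sub_le _ _).trans ?_
    rw [norm_mul, norm_mul, RCLike.norm_conj, RCLike.norm_conj]
    gcongr
    · exact h.normal_near w
    · exact (norm_sub_le _ _).trans (by rw [Circle.norm_coe])
    · exact h.near w
  have h4 := (neg_le_abs _).trans ((Complex.abs_re_le_norm _).trans h3)
  have h5 := hz w
  rw [supportFun, h2, Complex.add_re, Complex.ofReal_re] at h5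
  nlinarith

/-- The region enclosed by the curve. -/
lemma enclosedRegion_eq (h : NearCircle κ γ n r) : enclosedRegion (range γ) = tangentInterior γ n := by
  have hdisj : tangentInterior γ n ∩ (tangentHull γ n)ᶜ = ∅ := by
    ext z
    simp only [mem_inter_iff, mem_compl_iff, mem_empty_iff_false, iff_false, not_and, not_not]
    exact fun hz => tangentInterior_subset γ n hz
  have hcover : (range γ)ᶜ ⊆ tangentInterior γ n ∪ (tangentHull γ n)ᶜ := by
    intro z hz
    by_contra hz'
    simp only [mem_union, mem_compl_iff, not_or, not_not] at hz'
    exact hz (h.tangentHull_diff ▸ ⟨hz'.2, hz'.1⟩)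
  ext z
  constructor
  · rintro ⟨hz, hb⟩
    by_contra hz'
    have hzK : z ∉ tangentHull γ n := by
      rcases hcover hz with h1 | h1
      · exact absurd h1 hz'
      · exact h1
    simp only [tangentHull, mem_ofPred_eq, not_forall, not_le] at hzK
    obtain ⟨w, hw⟩ := hzK
    have hn0 := h.normal_ne_zero w
    -- Moving outwards along the normal of a violated tangent can only increase the support
    -- function, so the ray misses the curve and its component is unbounded.
    have hray : (fun t : ℝ => z + t * n w) '' Ici 0 ⊆ connectedComponentIn (range γ)ᶜ z := by
      have hc : Continuous fun t : ℝ => z + t * n w := by fun_prop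
      refine IsPreconnected.subset_connectedComponentIn
        (isPreconnected_Ici.image _ hc.continuousOn) ⟨0, self_mem_Ici, by simp⟩ ?_
      rintro _ ⟨t, ht, rfl⟩ hmem
      have h1 := h.range_subset_tangentHull hmem w
      have h2 : conj (n w) * (z + t * n w - γ w) =
          conj (n w) * (z - γ w) + ((t * Complex.normSq (n w) : ℝ) : ℂ) := by
        push_cast
        rw [Complex.normSq_eq_conj_mul_self]
        ring
      rw [supportFun, h2, Complex.add_re, Complex.ofReal_re] at h1
      have h3 : 0 ≤ t * Complex.normSq (n w) := mul_nonneg ht (Complex.normSq_nonneg _)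
      rw [supportFun] at hw
      linarith
    obtain ⟨R, hR⟩ := (Metric.isBounded_iff_subset_closedBall 0).1 (hb.subset hray)
    have hnn : 0 < ‖n w‖ := norm_pos_iff.2 hn0
    have hR0 : 0 ≤ R := by
      have := hR ⟨0, self_mem_Ici, rfl⟩
      rw [mem_closedBall_zero_iff] at this
      exact (norm_nonneg _).trans this
    set t : ℝ := (R + ‖z‖ + 1) / ‖n w‖ with ht
    have ht0 : 0 ≤ t := by positivity
    have h1 := hR ⟨t, ht0, rfl⟩
    rw [mem_closedBall_zero_iff] at h1
    have h2 := norm_sub_norm_le (t * n w) (-z)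
    rw [norm_neg, sub_neg_eq_add, norm_mul, Complex.norm_real, Real.norm_of_nonneg ht0, ht,
      div_mul_cancel₀ _ hnn.ne', ← ht, add_comm (_ * n w) z] at h2
    linarith
  · intro hz
    have hzΓ : z ∈ (range γ)ᶜ := fun hm => by
      rw [← h.tangentHull_diff] at hm
      exact hm.2 hz
    -- The interior and the complement of the hull are disjoint open sets covering the complement of
    -- the curve, so a component that meets the interior stays in it.
    refine ⟨hzΓ, h.isBounded_tangentHull.subset (Subset.trans ?_ (tangentInterior_subset γ n))⟩
    refine IsPreconnected.subset_left_of_subset_union h.isOpen_tangentInterior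
      h.isClosed_tangentHull.isOpen_compl (disjoint_iff_inter_eq_empty.2 hdisj)
      ((connectedComponentIn_subset _ _).trans hcover) ⟨z, mem_connectedComponentIn hzΓ, hz⟩
      isPreconnected_connectedComponentIn

end NearCircle

/-! ### Convexity of the patches -/

section Patch

variable {β : ℝ≥0} [Fact (0 < β)] [Fact (β < 1)] {d ε : ℝ} {f : X β}

lemma hasDerivAt_boundaryCurve (ε : ℝ) (f : X β) (w : Circle) :
    HasDerivAt (fun t : ℝ => boundaryCurve ε f (w * Circle.exp t))
      (I * w * (1 + ε * circleDeriv f w)) 0 := by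
  have h1 := (hasDerivAt_coe_exp w 0).add ((f.differentiable.hasDerivAt w 0).const_mul (ε : ℂ))
  rw [Circle.exp_zero, mul_one] at h1
  have h2 : I * (w : ℂ) * (1 + ε * circleDeriv f w) =
      I * w + ε * (I * w * circleDeriv f w) := by ring
  rw [h2]
  exact h1

/-- Without dependence on `τ` the `L^1` increment is `2π` times the pointwise one, and exponent `1`
means Lipschitz. -/
lemma norm_eval_sub_le_of_eval_const {K : Ker 1} (hK : ∀ w τ, K.eval w τ = K.eval w 1)
    (w₁ w₂ : Circle) : ‖K.eval w₁ 1 - K.eval w₂ 1‖ ≤ ‖K‖ * dist w₁ w₂ := by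
  have h := K.cint_eval_sub_le w₁ w₂
  have h1 : (fun τ => ‖K.eval w₁ τ - K.eval w₂ τ‖) = fun _ => ‖K.eval w₁ 1 - K.eval w₂ 1‖ := by
    funext τ
    rw [hK, hK w₂ τ]
  rw [h1, cint_const, NNReal.coe_one, Real.rpow_one, smul_eq_mul] at h
  nlinarith [Real.two_le_pi, norm_nonneg (K.eval w₁ 1 - K.eval w₂ 1)]

/-- The boundary of a solution has an outward normal which is Lipschitz close to the one of the
unit circle. -/
lemma exists_nearCircle (hd : 2 < d) : ∃ δ : ℝ, 0 < δ ∧ ∀ ε, |ε| ≤ δ → ∀ f : X β, ‖f‖ < 1 →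
    (∀ w, Ghat d ε f w = 0) → ∃ n r, NearCircle (1 / 20) (boundaryCurve ε f) n r := by
  -- Exponent `1` is available although `f'` is only `β`-Hölder, because `f'(w)` does not occur in
  -- the velocity kernel.
  obtain ⟨C, δ₀, hC, hδ₀, hb⟩ := (ubdd_kW (α := 1) (β := β) hd).exists_bound
  -- The first entry bounds `εf`, the second makes the bound `C` on the velocity valid, and the
  -- third yields `ε² C ≤ 1/20`.
  refine ⟨min (1 / 20) (min (δ₀ / 2) (1 / (20 * C))), by positivity, fun ε hε f hf hG => ?_⟩
  have hε1 : |ε| ≤ 1 / 20 := hε.trans (min_le_left _ _)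
  have hε2 : |ε| ≤ δ₀ / 2 := hε.trans ((min_le_right _ _).trans (min_le_left _ _))
  have hε3 : |ε| ≤ 1 / (20 * C) := hε.trans ((min_le_right _ _).trans (min_le_right _ _))
  have hε' : |ε| < 1 / 2 := by linarith
  have hKC := hb ε (by linarith) f hf
  set K : Ker 1 := kW d (kΩ d ε f) (kC d ε f) ε f with hK
  have hKconst : ∀ w τ, K.eval w τ = K.eval w 1 := fun w τ => by
    rw [hK, eval_kW hd hε' hf, eval_kW hd hε' hf]
  have hεC : ε ^ 2 * C ≤ 1 / 20 := by
    rw [le_div_iff₀ (by positivity)] at hε3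
    rw [← sq_abs]
    nlinarith [abs_nonneg ε]
  have hKle : ∀ w, ‖(ε ^ 2 * K.eval w 1 : ℂ)‖ ≤ 1 / 20 := fun w => by
    rw [norm_mul, norm_pow, Complex.norm_real, Real.norm_eq_abs, sq_abs]
    exact (mul_le_mul_of_nonneg_left ((K.norm_eval_le w 1).trans hKC) (sq_nonneg ε)).trans hεC
  -- At a solution `Im F = 0`, so the product is real, and by smallness positive. Hence `1 + ε f'`
  -- is a positive multiple of the conjugate of `1 - ε² W w`. The normal may be taken as `w` times
  -- that conjugate, that is `w - ε² W̄`, which is as regular as `W`.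
  have hprod : ∀ w, (1 - ε ^ 2 * K.eval w 1 * w : ℂ) * (1 + ε * circleDeriv f w) =
      1 - ε * F d (angularVelocity d ε f) ε f w := fun w => by
    rw [angularVelocity_eq hd hε' hf, F_eq (α := 1) hd hε' hf (mul_kC hd hε' hf) w 1, ← hK]
    ring
  set ρ : Circle → ℝ := fun w =>
    ((1 - ε ^ 2 * K.eval w 1 * w : ℂ) * (1 + ε * circleDeriv f w)).re with hρ
  have hρeq : ∀ w, (1 - ε ^ 2 * K.eval w 1 * w : ℂ) * (1 + ε * circleDeriv f w) = ρ w := fun w => by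
    refine Complex.ext (by rw [Complex.ofReal_re]) ?_
    rw [hprod, Complex.ofReal_im, Complex.sub_im, Complex.one_im, Complex.im_ofReal_mul]
    have := hG w
    rw [Ghat] at this
    rw [this]
    ring
  have hqle : ∀ w : Circle, ‖(ε ^ 2 * K.eval w 1 * w : ℂ)‖ ≤ 1 / 20 := fun w => by
    rw [norm_mul, Circle.norm_coe, mul_one]
    exact hKle w
  have hρpos : ∀ w, 0 < ρ w := fun w => by
    have h1 := hqle w
    have h2 := norm_mul_deriv_lt hε' hf w
    set a : ℂ := ε ^ 2 * K.eval w 1 * w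
    set b : ℂ := ε * circleDeriv f w
    have h3 : (1 - a) * (1 + b) = 1 + (b - a - a * b) := by ring
    have h4 : ‖b - a - a * b‖ ≤ 1 / 2 + 1 / 20 + 1 / 20 * (1 / 2) := by
      refine (norm_sub_le _ _).trans (add_le_add ((norm_sub_le _ _).trans
        (add_le_add h2.le h1)) ?_)
      rw [norm_mul]
      gcongr
    have h5 := (neg_le_abs _).trans ((Complex.abs_re_le_norm _).trans h4)
    change 0 < ((1 - a) * (1 + b)).re
    rw [h3, Complex.add_re, Complex.one_re]
    linarith
  have hq0 : ∀ w : Circle, (1 - ε ^ 2 * K.eval w 1 * w : ℂ) ≠ 0 := fun w h0 => by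
    have h1 := hqle w
    rw [← sub_eq_zero.1 h0, norm_one] at h1
    norm_num at h1
  refine ⟨fun w => w - ε ^ 2 * conj (K.eval w 1),
    fun w => ρ w / Complex.normSq (1 - ε ^ 2 * K.eval w 1 * w), le_rfl, fun w =>
      (hasDerivAt_boundaryCurve ε f w).differentiableAt, fun w =>
      div_pos (hρpos w) (Complex.normSq_pos.2 (hq0 w)), fun w => ?_, fun w => ?_, fun w => ?_,
      fun w w' => ?_⟩
  · rw [circleDeriv_eq_of_hasDerivAt (hasDerivAt_boundaryCurve ε f w)]
    have h1 : (w : ℂ) - ε ^ 2 * conj (K.eval w 1) = w * conj (1 - ε ^ 2 * K.eval w 1 * w : ℂ) := by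
      have h2 : (w : ℂ) * conj (w : ℂ) = 1 := by
        rw [← Circle.coe_inv_eq_conj, Circle.coe_inv, mul_inv_cancel₀ (Circle.coe_ne_zero w)]
      rw [map_sub, map_one, map_mul, map_mul, map_pow, Complex.conj_ofReal]
      linear_combination (ε ^ 2 * conj (K.eval w 1) : ℂ) * h2
    have h3 := hq0 w
    have h4 := (map_ne_zero (starRingEnd ℂ)).2 h3
    rw [h1, Complex.ofReal_div, ← hρeq w, ← Complex.mul_conj, div_mul_eq_mul_div,
      eq_div_iff (mul_ne_zero h3 h4)]
    ring
  · rw [boundaryCurve, add_sub_cancel_left, norm_mul, Complex.norm_real, Real.norm_eq_abs]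
    have := (norm_apply_le f w).trans hf.le
    nlinarith [abs_nonneg ε]
  · rw [sub_sub_cancel_left, norm_neg, norm_mul, RCLike.norm_conj, ← norm_mul]
    exact hKle w
  · have h1 : (w : ℂ) - ε ^ 2 * conj (K.eval w 1) - w - (w' - ε ^ 2 * conj (K.eval w' 1) - w') =
        -(ε ^ 2 * conj (K.eval w 1 - K.eval w' 1)) := by
      rw [map_sub]
      ring
    rw [h1, norm_neg, norm_mul, RCLike.norm_conj, norm_pow, Complex.norm_real, Real.norm_eq_abs,
      sq_abs]
    calc ε ^ 2 * ‖K.eval w 1 - K.eval w' 1‖ ≤ ε ^ 2 * (C * dist w w') := by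
          gcongr
          exact (norm_eval_sub_le_of_eval_const hKconst w w').trans (by gcongr)
      _ = ε ^ 2 * C * dist w w' := by ring
      _ ≤ 1 / 20 * dist w w' := by gcongr

end Patch

/-! ### Dilation of the enclosed region to the patch. -/

section Dilation

variable {κ ε : ℝ} {f n : Circle → ℂ} {r : Circle → ℝ}

/-- The dilation by `ε`, as a homeomorphism. -/
def dilation {ε : ℝ} (hε : ε ≠ 0) : ℂ ≃ₜ ℂ := Homeomorph.mulLeft₀ (ε : ℂ) (by exact_mod_cast hε)

lemma patch_eq (h : NearCircle κ (boundaryCurve ε f) n r) (hε : ε ≠ 0) :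
    patch ε f = dilation hε '' tangentInterior (boundaryCurve ε f) n := by
  rw [patch, h.enclosedRegion_eq]
  rfl

lemma frontier_patch (h : NearCircle κ (boundaryCurve ε f) n r) (hε : ε ≠ 0) :
    frontier (patch ε f) = range fun w : Circle => (ε : ℂ) * boundaryCurve ε f w := by
  rw [patch_eq h hε, ← (dilation hε).image_frontier, h.frontier_tangentInterior, ← range_comp]
  rfl

lemma isStrictlyConvexDomain_patch (h : NearCircle κ (boundaryCurve ε f) n r) (hε : ε ≠ 0) :
    IsStrictlyConvexDomain (patch ε f) := by
  have hsmul : ∀ s : Set ℂ, dilation hε '' s = (fun z : ℂ => ε • z) '' s := fun s => by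
    refine image_congr fun z _ => ?_
    rw [Complex.real_smul]
    rfl
  refine ⟨?_, ?_, ?_, ?_⟩
  · rw [patch_eq h hε]
    exact ⟨_, mem_image_of_mem _ h.zero_mem⟩
  · rw [patch_eq h hε]
    exact (dilation hε).isOpenMap _ h.isOpen_tangentInterior
  · rw [patch_eq h hε, hsmul]
    exact (convex_tangentInterior _ n).smul ε
  · rw [patch_eq h hε, ← (dilation hε).image_closure, h.closure_tangentInterior, hsmul]
    exact h.strictConvex_tangentHull.smul ε

end Dilation

end VortexPair

end

/-! ### Proof of the four assertions. -/

theorem mainTheorem2 (d : ℝ) (hd : 2 < d) (β : ℝ≥0) (hβ₀ : 0 < β) (hβ₁ : β < 1) :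
    -- `Ĝ` takes its values in `Ŷ`
    (∀ ε ∈ Ioo (-1 / 2 : ℝ) (1 / 2), ∀ f : VortexPair.X β, ‖f‖ < 1 →
      ∀ w, VortexPair.GhatMap d β ε f w = VortexPair.Ghat d ε f w) ∧
    -- the linearization at `(0, 0)` is an isomorphism
    (∃ L : VortexPair.X β ≃L[ℝ] VortexPair.Yhat β,
      (∀ (h : VortexPair.X β) (w : Circle), L h w = -(VortexPair.circleDeriv h w).im) ∧
      HasFDerivAt (fun f : VortexPair.X β => VortexPair.GhatMap d β 0 f)
        (L : VortexPair.X β →L[ℝ] VortexPair.Yhat β) 0) ∧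
    -- the reflection symmetry of the set of solutions
    (∀ ε ∈ Ioo (-1 / 2 : ℝ) (1 / 2), ∀ f : VortexPair.X β, ‖f‖ < 1 →
      (∀ w, VortexPair.Ghat d ε f w = 0) →
      ∃ g : VortexPair.X β, ‖g‖ < 1 ∧ (∀ w, g w = f (-w)) ∧
        ∀ w, VortexPair.Ghat d (-ε) g w = 0) ∧
    -- the curve of solutions and the strict convexity of the patches
    ∃ ε₀ : ℝ, 0 < ε₀ ∧ ε₀ < 1 / 2 ∧ ∃ u : ℝ → VortexPair.X β,
      ContDiffOn ℝ 1 u (Icc (-ε₀) ε₀) ∧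
      u 0 = 0 ∧
      {p : ℝ × VortexPair.X β | p.1 ∈ Icc (-ε₀) ε₀ ∧ ‖p.2‖ < 1 ∧
          ∀ w, VortexPair.Ghat d p.1 p.2 w = 0} =
        (fun ε => (ε, u ε)) '' Icc (-ε₀) ε₀ ∧
      ∀ ε ∈ Icc (-ε₀) ε₀, ε ≠ 0 →
        u ε ≠ 0 ∧
        Function.Injective (VortexPair.boundaryCurve ε (u ε)) ∧
        frontier (VortexPair.patch ε (u ε)) =
          range (fun w : Circle => (ε : ℂ) * VortexPair.boundaryCurve ε (u ε) w) ∧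
        VortexPair.IsStrictlyConvexDomain (VortexPair.patch ε (u ε)) := by
  have : Fact (0 < β) := ⟨hβ₀⟩
  have : Fact (β < 1) := ⟨hβ₁⟩
  have habs : ∀ ε : ℝ, ε ∈ Ioo (-1 / 2 : ℝ) (1 / 2) → |ε| < 1 / 2 := fun ε hε =>
    abs_lt.2 ⟨by linarith [hε.1], hε.2⟩
  refine ⟨fun ε hε f hf w => VortexPair.GhatMap_apply hd (habs ε hε) hf w,
    ⟨VortexPair.linEquiv, VortexPair.linOp_apply, ?_⟩, ?_, ?_⟩
  -- On the whole unit ball `Ĝ(0, ·)` coincides with the linear operator, so differentiability needs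
  -- no estimate.
  · rw [VortexPair.coe_linEquiv]
    refine VortexPair.linOp.hasFDerivAt.congr_of_eventuallyEq ?_
    filter_upwards [Metric.ball_mem_nhds (0 : VortexPair.X β) one_pos] with f hf
    rw [VortexPair.GhatMap_eq hd (by norm_num) (by simpa using hf), VortexPair.proj_kGhat_zero]
  · intro ε hε f hf hG
    obtain ⟨g, hg, hgf⟩ := VortexPair.exists_reflection f
    refine ⟨g, hg.trans_lt hf, hgf, fun w => ?_⟩
    have h1 : (g : Circle → ℂ) = fun w => f (-w) := funext hgf
    rw [h1, VortexPair.Ghat_reflection, hG, neg_zero]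
  · obtain ⟨u, ρ, hρ, hρ2, hu0, hu, hsol⟩ := VortexPair.exists_curve (β := β) hd
    obtain ⟨δ, hδ, hnear⟩ := VortexPair.exists_nearCircle (β := β) hd
    have hle : ∀ ε ∈ Icc (-min ρ δ) (min ρ δ), |ε| ≤ ρ ∧ |ε| ≤ δ := fun ε hε =>
      le_min_iff.1 (abs_le.2 hε)
    have hzero : ∀ ε ∈ Icc (-min ρ δ) (min ρ δ), ∀ f : VortexPair.X β, ‖f‖ < 1 →
        ((∀ w, VortexPair.Ghat d ε f w = 0) ↔ f = u ε) := fun ε hε f hf => by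
      rw [VortexPair.Ghat_eq_zero_iff hd ((hle ε hε).1.trans_lt hρ2) hf]
      exact (hsol ε (hle ε hε).1).2 f hf
    refine ⟨min ρ δ, lt_min hρ hδ, (min_le_left _ _).trans_lt hρ2, u,
      hu.mono (Icc_subset_Icc (neg_le_neg (min_le_left _ _)) (min_le_left _ _)), hu0, ?_, ?_⟩
    · ext ⟨ε, f⟩
      simp only [mem_ofPred_eq, mem_image, Prod.mk.injEq]
      constructor
      · rintro ⟨hε, hf, hG⟩
        exact ⟨ε, hε, rfl, ((hzero ε hε f hf).1 hG).symm⟩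
      · rintro ⟨ε', hε, rfl, rfl⟩
        have hf := (hsol ε' (hle ε' hε).1).1
        exact ⟨hε, hf, (hzero ε' hε _ hf).2 rfl⟩
    · intro ε hε hε0
      have hf := (hsol ε (hle ε hε).1).1
      have hG := (hzero ε hε _ hf).2 rfl
      obtain ⟨n, r, hnr⟩ := hnear ε (hle ε hε).2 (u ε) hf hG
      refine ⟨fun h0 => ?_, hnr.injective, VortexPair.frontier_patch hnr hε0,
        VortexPair.isStrictlyConvexDomain_patch hnr hε0⟩
      obtain ⟨w, hw⟩ := VortexPair.exists_Ghat_zero_ne_zero hd ((hle ε hε).1.trans_lt hρ2) hε0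
      rw [h0, VortexPair.X.coe_zero] at hG
      exact hw (hG w)
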